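/- Let $n\ge 1$ be an integer, and let $\Omega=\mathbb H_{1/n}=\{(z_1,z_2)\in\mathbb C^2: |z_1|^{1/n}<|z_2|<1\}$. Let $B_\Omega(z,w)$ be its Bergman kernel, i.e. the reproducing kernel of the space of square-integrable holomorphic functions on $\Omega$. For a measurable function $f$ on $\Omega$ put $$\mathbf Bf(z)=\int_\Omega B_\Omega(z,w)f(w)\,dV(w),\qquad z\in\Omega,$$ whenever this integral converges absolutely for every $z\in\Omega$ (on $L^2(\Omega)$ this is the Bergman projection); in that case we say that $\mathbf Bf$ is defined. For $1<p<\infty$ let $L^p_1(\Omega)$ be the Sobolev space of functions in $L^p(\Omega)$ whose first-order distributional derivatives lie in $L^p(\Omega)$, with norm $\|f\|_{L^p_1}=\big(\sum_{|\alpha|\le1}\int_\Omega|\partial^\alpha f|^p\,dV\big)^{1/p}$, where $\partial^\alpha$ are the derivatives in the four real coordinates. (1) Let $1<p<\frac{2n+2}{2n}$. The functions $f\in L^p_1(\Omega)$ for which $\mathbf Bf$ is defined are dense in $L^p_1(\Omega)$; for each of them $\mathbf Bf$ is holomorphic on $\Omega$; and $f\mapsto\frac{\partial}{\partial z_1}\mathbf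 Bf$ extends from this dense subspace to a bounded linear operator $L^p_1(\Omega)\to L^p(\Omega)$. (2) Let $\frac{2n+2}{n+3}<p<2$. For every $f\in L^p_1(\Omega)$, $\mathbf Bf$ is defined and holomorphic on $\Omega$, and $\frac{\partial}{\partial z_2}\circ\mathbf B$ is a bounded operator $L^p_1(\Omega)\to L^p(\Omega)$: there is a constant $C$ depending only on $n$ and $p$ with $\big\|\frac{\partial}{\partial z_2}\mathbf Bf\big\|_{L^p(\Omega)}\le C\,\|f\|_{L^p_1(\Omega)}$ for all $f\in L^p_1(\Omega)$. -/

import Mathlib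

open MeasureTheory Set
open scoped ENNReal NNReal ContDiff ComplexConjugate

/-- The domain `{(z₁, z₂) ∈ ℂ² : |z₁| ^ γ < |z₂| < 1}`. -/
def hartogsDomain (γ : ℝ) : Set (ℂ × ℂ) :=
  {z | ‖z.1‖ ^ γ < ‖z.2‖ ∧ ‖z.2‖ < 1}

/-- The domain `ℍ_{1/n}`. -/
noncomputable abbrev thinHartogs (n : ℕ) : Set (ℂ × ℂ) := hartogsDomain (1 / (n : ℝ))

/-- Lebesgue measure of `ℂ² = ℝ⁴`, restricted to `Ω`. -/
noncomputable abbrev lebesgueOn (Ω : Set (ℂ × ℂ)) : Measure (ℂ × ℂ) :=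
  (volume : Measure (ℂ × ℂ)).restrict Ω

/-! ### The Bergman kernel and the Bergman projection -/

/-- `f` belongs to the Bergman space `𝒪(Ω) ∩ L²(Ω)`. -/
def MemBergman (Ω : Set (ℂ × ℂ)) (f : ℂ × ℂ → ℂ) : Prop :=
  DifferentiableOn ℂ f Ω ∧ MemLp f 2 (lebesgueOn Ω)

/-- `k` is the element of the Bergman space that represents evaluation at `z`:
`f z = ⟨f, k⟩` for all `f` in the Bergman space. -/
def RepresentsEval (Ω : Set (ℂ × ℂ)) (z : ℂ × ℂ) (k : ℂ × ℂ → ℂ) : Prop :=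
  MemBergman Ω k ∧ ∀ f, MemBergman Ω f → f z = ∫ w in Ω, f w * conj (k w)

/-- The representing element is unique on an open set `Ω`. -/
theorem RepresentsEval.eqOn {Ω : Set (ℂ × ℂ)} (hΩ : IsOpen Ω) {z : ℂ × ℂ}
    {k k' : ℂ × ℂ → ℂ} (h : RepresentsEval Ω z k) (h' : RepresentsEval Ω z k') :
    EqOn k k' Ω := by
  have hd : MemBergman Ω (k - k') := ⟨h.1.1.sub h'.1.1, h.1.2.sub h'.1.2⟩
  have e1 := h.2 _ hd
  have e2 := h'.2 _ hd
  have i1 : Integrable (fun w => (k - k') w * conj (k w)) (lebesgueOn Ω) :=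
    MemLp.integrable_mul (p := 2) (q := 2) hd.2 h.1.2.star
  have i2 : Integrable (fun w => (k - k') w * conj (k' w)) (lebesgueOn Ω) :=
    MemLp.integrable_mul (p := 2) (q := 2) hd.2 h'.1.2.star
  have e3 : ∫ w in Ω, (((‖(k - k') w‖ ^ 2 : ℝ)) : ℂ) = 0 := by
    have : ∀ w, (((‖(k - k') w‖ ^ 2 : ℝ)) : ℂ)
        = (k - k') w * conj (k w) - (k - k') w * conj (k' w) := by
      intro w
      rw [← mul_sub, ← map_sub]
      push_cast
      exact (RCLike.mul_conj _).symm
    simp_rw [this]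
    rw [integral_sub i1 i2, ← e1, ← e2, sub_self]
  have e3' : ∫ w in Ω, ‖(k - k') w‖ ^ 2 = 0 := by
    rw [← Complex.ofReal_eq_zero, ← e3]
    exact integral_ofReal.symm
  rw [integral_eq_zero_iff_of_nonneg (fun w => by positivity)
      ((memLp_two_iff_integrable_sq_norm hd.2.1).1 hd.2)] at e3'
  have e4 : k =ᵐ[lebesgueOn Ω] k' := by
    filter_upwards [e3'] with w hw
    have hw' : ‖(k - k') w‖ ^ 2 = 0 := hw
    rw [sq_eq_zero_iff, norm_eq_zero] at hw'
    exact sub_eq_zero.1 hw'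
  exact Measure.eqOn_open_of_ae_eq e4 hΩ h.1.1.continuousOn h'.1.1.continuousOn

open Classical in
/-- The Bergman kernel `B_Ω(z, w)`: the conjugate at `w` of the element of the Bergman space that
represents evaluation at `z`. -/
noncomputable def bergmanKernel (Ω : Set (ℂ × ℂ)) (z w : ℂ × ℂ) : ℂ :=
  if h : ∃ k, RepresentsEval Ω z k then conj (h.choose w) else 0

/-- The integral `∫_Ω B_Ω(z, w) f(w) dV(w)` converges for every `z ∈ Ω`. -/
def BergmanConverges (Ω : Set (ℂ × ℂ)) (f : ℂ × ℂ → ℂ) : Prop :=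
  ∀ z ∈ Ω, Integrable (fun w => bergmanKernel Ω z w * f w) (lebesgueOn Ω)

/-- The Bergman projection `𝐁 f (z) = ∫_Ω B_Ω(z, w) f(w) dV(w)`. -/
noncomputable def bergmanProj (Ω : Set (ℂ × ℂ)) (f : ℂ × ℂ → ℂ) (z : ℂ × ℂ) : ℂ :=
  ∫ w in Ω, bergmanKernel Ω z w * f w

/-! ### The Sobolev space `L^p_1(Ω)` -/

/-- `g` is the distributional derivative of `f` on `Ω` in the real direction `v`. -/
def HasWeakDeriv (Ω : Set (ℂ × ℂ)) (v : ℂ × ℂ) (f g : ℂ × ℂ → ℂ) : Prop :=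
  LocallyIntegrableOn f Ω ∧ LocallyIntegrableOn g Ω ∧
    ∀ φ : ℂ × ℂ → ℝ, ContDiff ℝ ∞ φ → HasCompactSupport φ → tsupport φ ⊆ Ω →
      ∫ x in Ω, (fderiv ℝ φ x v) • f x = -∫ x in Ω, φ x • g x

/-- The four real coordinate directions `∂/∂x₁, ∂/∂y₁, ∂/∂x₂, ∂/∂y₂` of `ℂ²`. -/
noncomputable def realDir : Fin 4 → ℂ × ℂ :=
  ![(1, 0), (Complex.I, 0), (0, 1), (0, Complex.I)]

/-- `f ∈ L^p_1(Ω)`: `f` and its first order distributional derivatives are in `L^p(Ω)`. -/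
def MemSobolevOne (Ω : Set (ℂ × ℂ)) (p : ℝ) (f : ℂ × ℂ → ℂ) : Prop :=
  MemLp f (ENNReal.ofReal p) (lebesgueOn Ω) ∧
    ∀ i, ∃ g, HasWeakDeriv Ω (realDir i) f g ∧ MemLp g (ENNReal.ofReal p) (lebesgueOn Ω)

open Classical in
/-- The distributional derivative (unique almost everywhere on an open set), `0` if there is
none. -/
noncomputable def weakDeriv (Ω : Set (ℂ × ℂ)) (v : ℂ × ℂ) (f : ℂ × ℂ → ℂ) : ℂ × ℂ → ℂ :=
  if h : ∃ g, HasWeakDeriv Ω v f g then h.choose else 0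

/-- The norm of `L^p_1(Ω)`; used only for `f ∈ L^p_1(Ω)`. -/
noncomputable def sobolevNorm (Ω : Set (ℂ × ℂ)) (p : ℝ) (f : ℂ × ℂ → ℂ) : ℝ≥0∞ :=
  ((∫⁻ x in Ω, ‖f x‖ₑ ^ p) + ∑ i, ∫⁻ x in Ω, ‖weakDeriv Ω (realDir i) f x‖ₑ ^ p) ^ (1 / p)

theorem integrable_testMul {Ω : Set (ℂ × ℂ)} {f : ℂ × ℂ → ℂ}
    (hf : LocallyIntegrableOn f Ω) {ψ : ℂ × ℂ → ℝ} (hc : Continuous ψ)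
    (hs : HasCompactSupport ψ) (ht : tsupport ψ ⊆ Ω) :
    Integrable (fun x => ψ x • f x) (lebesgueOn Ω) := by
  have h1 : IntegrableOn (fun x => ψ x • f x) (tsupport ψ) :=
    (hf.integrableOn_compact_subset ht hs).continuousOn_smul hc.continuousOn hs
  have h2 : Integrable (fun x => ψ x • f x) := by
    rwa [integrableOn_iff_integrable_of_support_subset] at h1
    intro x hx
    apply subset_tsupport ψ
    intro h0
    exact hx (by simp [h0])
  exact h2.restrict

theorem continuous_fderiv_dir {φ : ℂ × ℂ → ℝ} (h : ContDiff ℝ ∞ φ) (v : ℂ × ℂ) :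
    Continuous (fun x => fderiv ℝ φ x v) :=
  (h.continuous_fderiv (by simp)).clm_apply continuous_const

theorem HasWeakDeriv.add {Ω : Set (ℂ × ℂ)} {v : ℂ × ℂ} {f f' g g' : ℂ × ℂ → ℂ}
    (h : HasWeakDeriv Ω v f g) (h' : HasWeakDeriv Ω v f' g') :
    HasWeakDeriv Ω v (f + f') (g + g') := by
  refine ⟨h.1.add h'.1, h.2.1.add h'.2.1, fun φ h1 h2 h3 => ?_⟩
  have s1 : HasCompactSupport (fun x => fderiv ℝ φ x v) := h2.fderiv_apply ℝ v
  have s2 : tsupport (fun x => fderiv ℝ φ x v) ⊆ Ω := (tsupport_fderiv_apply_subset ℝ v).trans h3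
  have c := continuous_fderiv_dir h1 v
  simp only [Pi.add_apply, smul_add]
  rw [integral_add (integrable_testMul h.1 c s1 s2) (integrable_testMul h'.1 c s1 s2),
    integral_add (integrable_testMul h.2.1 h1.continuous h2 h3)
      (integrable_testMul h'.2.1 h1.continuous h2 h3), h.2.2 φ h1 h2 h3, h'.2.2 φ h1 h2 h3]
  ring

theorem HasWeakDeriv.const_smul {Ω : Set (ℂ × ℂ)} {v : ℂ × ℂ} {f g : ℂ × ℂ → ℂ} (c : ℂ)
    (h : HasWeakDeriv Ω v f g) : HasWeakDeriv Ω v (c • f) (c • g) := by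
  refine ⟨h.1.smul c, h.2.1.smul c, fun φ h1 h2 h3 => ?_⟩
  simp only [Pi.smul_apply, smul_comm _ c]
  rw [integral_smul, integral_smul, h.2.2 φ h1 h2 h3, smul_neg]

theorem HasWeakDeriv.zero (Ω : Set (ℂ × ℂ)) (v : ℂ × ℂ) : HasWeakDeriv Ω v 0 0 :=
  ⟨(locallyIntegrable_zero).locallyIntegrableOn Ω, (locallyIntegrable_zero).locallyIntegrableOn Ω,
    fun φ _ _ _ => by simp⟩

/-- The vector space `L^p_1(Ω)`. -/
def sobolevOne (Ω : Set (ℂ × ℂ)) (p : ℝ) : Submodule ℂ (ℂ × ℂ → ℂ) where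
  carrier := {f | MemSobolevOne Ω p f}
  zero_mem' := ⟨MemLp.zero, fun i => ⟨0, HasWeakDeriv.zero Ω _, MemLp.zero⟩⟩
  add_mem' := by
    rintro f f' ⟨h, hd⟩ ⟨h', hd'⟩
    refine ⟨h.add h', fun i => ?_⟩
    obtain ⟨g, a, b⟩ := hd i
    obtain ⟨g', a', b'⟩ := hd' i
    exact ⟨g + g', a.add a', b.add b'⟩
  smul_mem' := by
    rintro c f ⟨h, hd⟩
    refine ⟨h.const_smul c, fun i => ?_⟩
    obtain ⟨g, a, b⟩ := hd i
    exact ⟨c • g, a.const_smul c, b.const_smul c⟩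

/-! ### Polar coordinates on a disc -/

/-! The Bergman kernel is explicit. With x = z₁w̄₁/(z₂w̄₂)ⁿ and y = z₂w̄₂ it equals (z₂w̄₂)⁻ⁿ /
(π²(1-x)²(1-y)²): the kernel of a bidisc with an extra singular factor (`hartogsKernel_reproducing`,
`norm_hartogsKernel`). For fixed z it is comparable in w to |w₂|⁻ⁿ, so the integral defining 𝐁f
converges exactly when |w₂|⁻ⁿ|f| is integrable (`bergmanConverges_iff`), and 𝐁f may then be
differentiated under the integral.

The kernel K sees z and w only through z₁w̄₁ and z₂w̄₂. A derivative in z_j can therefore be traded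
for the derivative along rotations of w_j. These rotations preserve the domain and a family of
exhausting cutoffs, so integrating by parts onto f produces no boundary terms, although the boundary
is singular at the origin (`integral_fderiv_coordField_mul`). In the second variable this gives ∂₂𝐁f
= -(i/z₂)∫ K·(angular derivative of f), where the angular derivative is O(|w₂||∇f|). In the first
variable the division by z₁ is made harmless by subtracting from K its value at z₁ = 0, which is
invariant under rotations of w₁; the quotient is `rotPrimitive`.

Both derivatives are thus dominated by integrals of |∇f| against |z₂|^(-m)|w₂|^(m-2n)
`bidiscWeight`, with m = 2n for ∂₁ and m = n+1 for ∂₂. The Schur test with weights that are powers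
of |w₂| and of the bidisc defect, fed by Forelli-Rudin integrals on discs, bounds these kernels on
Lᵖ (`exists_lintegral_rpow_bidiscWeight_le`); the two values of m give precisely the two ranges of
p.

It remains to know when 𝐁f makes sense. In (2), an L¹ Hardy inequality along the weighted Euler
field controls |w₂|⁻ⁿ|f| by |w₂|^(1-n)|∇f| and |f|, and Hölder's inequality finishes
(`integrable_inv_norm_snd_pow_mul`). In (1), 𝐁f may diverge; smooth clipping of the values of f
gives bounded functions, for which 𝐁f is defined, approximating f in the Sobolev norm, while the
formula through `rotPrimitive` makes sense for every f and is the bounded extension. -/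

theorem polarCoord_symm_eq_circleMap (p : ℝ × ℝ) :
    Complex.polarCoord.symm p = circleMap 0 p.1 p.2 := by
  simp [circleMap, Complex.exp_mul_I]

theorem setLIntegral_ball_eq_polar {f : ℂ → ℝ≥0∞} (hf : Measurable f) (R : ℝ) :
    ∫⁻ w in Metric.ball (0 : ℂ) R, f w =
      ∫⁻ r in Ioo 0 R, ENNReal.ofReal r *
        ∫⁻ θ in Ioo (-Real.pi) Real.pi, f (circleMap 0 r θ) := by
  have hm : Measurable (fun p : ℝ × ℝ => circleMap 0 p.1 p.2) := by
    unfold circleMap; fun_prop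
  rw [← lintegral_indicator Metric.isOpen_ball.measurableSet,
    ← Complex.lintegral_comp_polarCoord_symm]
  have ht : polarCoord.target = Ioi (0 : ℝ) ×ˢ Ioo (-Real.pi) Real.pi := rfl
  rw [ht, Measure.volume_eq_prod, ← Measure.prod_restrict, lintegral_prod]
  · rw [show Ioo 0 R = Ioi 0 ∩ Iio R from Ioi_inter_Iio.symm, ← lintegral_indicator (measurableSet_Ioi.inter measurableSet_Iio),
      ← lintegral_indicator measurableSet_Ioi]
    congr 1 with r
    by_cases h0 : r ∈ Ioi (0 : ℝ)
    · by_cases hR : r < R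
      · rw [indicator_of_mem h0, indicator_of_mem (show r ∈ Ioi 0 ∩ Iio R from ⟨h0, hR⟩),
          ← lintegral_const_mul _ (by unfold circleMap; fun_prop)]
        congr 1 with θ
        rw [polarCoord_symm_eq_circleMap, indicator_of_mem, smul_eq_mul]
        simpa [abs_of_pos (mem_Ioi.1 h0)] using hR
      · rw [indicator_of_mem h0, indicator_of_notMem (fun h => hR h.2)]
        refine (lintegral_congr fun θ => ?_).trans lintegral_zero
        rw [polarCoord_symm_eq_circleMap, indicator_of_notMem]
        · simp
        · simpa [abs_of_pos (mem_Ioi.1 h0)] using hR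
    · rw [indicator_of_notMem h0, indicator_of_notMem (fun h => h0 h.1)]
  · simp only [polarCoord_symm_eq_circleMap]
    exact (Measurable.smul measurable_fst.ennreal_ofReal ((hf.indicator Metric.isOpen_ball.measurableSet).comp
            hm)).aemeasurable

theorem setIntegral_ball_eq_circleAverage {f : ℂ → ℂ} {R : ℝ}
    (hc : ContinuousOn f (Metric.ball 0 R)) (hf : IntegrableOn f (Metric.ball 0 R)) :
    ∫ w in Metric.ball (0 : ℂ) R, f w =
      ∫ r in Ioo 0 R, (2 * Real.pi * r) • Real.circleAverage f 0 r := by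
  classical
  have hm : Measurable (fun p : ℝ × ℝ => circleMap 0 p.1 p.2) := by
    unfold circleMap; fun_prop
  set g : ℂ → ℂ := (Metric.ball (0 : ℂ) R).indicator f with hg
  have hgm : Measurable g := by
    have := hc.measurable_piecewise (g := 0) continuousOn_const
      (Metric.isOpen_ball (x := (0:ℂ)) (ε := R)).measurableSet
    rwa [piecewise_eq_indicator] at this
  have hgi : Integrable g := hf.integrable_indicator Metric.isOpen_ball.measurableSet
  have ht : polarCoord.target = Ioi (0 : ℝ) ×ˢ Ioo (-Real.pi) Real.pi := rfl
  have hint : Integrable (fun p : ℝ × ℝ => p.1 • g (circleMap 0 p.1 p.2))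
      ((volume.restrict (Ioi (0 : ℝ))).prod (volume.restrict (Ioo (-Real.pi) Real.pi))) := by
    refine ⟨(Measurable.smul measurable_fst (hgm.comp hm)).aestronglyMeasurable, ?_⟩
    have := hgi.2
    unfold HasFiniteIntegral at this ⊢
    rw [← Complex.lintegral_comp_polarCoord_symm, ht, Measure.volume_eq_prod,
      ← Measure.prod_restrict] at this
    refine lt_of_le_of_lt (le_of_eq ?_) this
    rw [Measure.prod_restrict]
    refine setLIntegral_congr_fun (measurableSet_Ioi.prod measurableSet_Ioo) fun p hp => ?_
    simp only [polarCoord_symm_eq_circleMap, enorm_smul, smul_eq_mul]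
    rw [Real.enorm_of_nonneg (le_of_lt hp.1)]
  rw [← integral_indicator Metric.isOpen_ball.measurableSet, ← hg,
    ← Complex.integral_comp_polarCoord_symm, ht, Measure.volume_eq_prod, ← Measure.prod_restrict]
  simp only [polarCoord_symm_eq_circleMap]
  rw [integral_prod _ hint]
  have hsub : Ioo 0 R ⊆ Ioi (0 : ℝ) := fun r hr => hr.1
  rw [setIntegral_eq_of_subset_of_forall_sdiff_eq_zero measurableSet_Ioi hsub]
  · refine setIntegral_congr_fun measurableSet_Ioo fun r hr => ?_
    simp only
    rw [integral_smul, Real.circleAverage_eq_integral_add (-Real.pi), smul_smul]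
    rw [intervalIntegral.integral_comp_add_right (fun θ => f (circleMap 0 r θ)),
      intervalIntegral.integral_of_le (by linarith [Real.pi_pos]), ← integral_Ioc_eq_integral_Ioo]
    have h1 : 2 * Real.pi * r * (2 * Real.pi)⁻¹ = r := by
      field_simp
    rw [h1, show (0 : ℝ) + -Real.pi = -Real.pi by ring,
      show 2 * Real.pi + -Real.pi = Real.pi by ring]
    congr 1
    refine setIntegral_congr_fun measurableSet_Ioc fun θ _ => ?_
    simp only [hg]
    rw [indicator_of_mem]
    simpa [abs_of_pos hr.1] using hr.2
  · intro r hr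
    have : ∀ θ, g (circleMap 0 r θ) = 0 := fun θ => by
      rw [hg, indicator_of_notMem]
      have h2 : R ≤ r := by
        by_contra h; exact hr.2 ⟨hr.1, not_le.1 h⟩
      simpa [abs_of_pos (mem_Ioi.1 hr.1)] using h2
    simp [this]

/-- The Bergman kernel of a disc reproduces integrable holomorphic functions. -/
theorem integral_disc_reproducing {g : ℂ → ℂ} {R : ℝ} (hR : 0 < R)
    (hd : DifferentiableOn ℂ g (Metric.ball 0 R)) (hi : IntegrableOn g (Metric.ball 0 R))
    {a : ℂ} (ha : ‖a‖ < R) :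
    ∫ w in Metric.ball (0 : ℂ) R, g w / ((R : ℂ) ^ 2 - a * conj w) ^ 2 =
      (Real.pi / R ^ 2 : ℝ) * g a := by
  have hRC : (R : ℂ) ≠ 0 := by exact_mod_cast hR.ne'
  have hlow : ∀ w ∈ Metric.ball (0 : ℂ) R, R * (R - ‖a‖) ≤ ‖(R : ℂ) ^ 2 - a * conj w‖ := by
    intro w hw
    have h1 : ‖w‖ < R := by simpa using hw
    have h2 := norm_sub_norm_le ((R : ℂ) ^ 2) (a * conj w)
    have h3 : ‖(R : ℂ) ^ 2‖ = R ^ 2 := by simp [abs_of_pos hR]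
    rw [h3, norm_mul, RCLike.norm_conj] at h2
    nlinarith [norm_nonneg a, norm_nonneg w]
  have hpos : 0 < R * (R - ‖a‖) := mul_pos hR (by linarith)
  have hne : ∀ w ∈ Metric.ball (0 : ℂ) R, (R : ℂ) ^ 2 - a * conj w ≠ 0 := fun w hw h => by
    have := hlow w hw
    rw [h, norm_zero] at this
    linarith
  have hkc : ContinuousOn (fun w : ℂ => (((R : ℂ) ^ 2 - a * conj w) ^ 2)⁻¹) (Metric.ball 0 R) :=
    ContinuousOn.inv₀ (by fun_prop) fun w hw => pow_ne_zero 2 (hne w hw)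
  have hcont : ContinuousOn (fun w => g w / ((R : ℂ) ^ 2 - a * conj w) ^ 2) (Metric.ball 0 R) := by
    simp only [div_eq_mul_inv]
    exact hd.continuousOn.mul hkc
  rw [setIntegral_ball_eq_circleAverage hcont]
  swap
  · simp only [div_eq_mul_inv]
    refine Integrable.mul_bdd (c := ((R * (R - ‖a‖)) ^ 2)⁻¹) hi
      (hkc.aestronglyMeasurable Metric.isOpen_ball.measurableSet) ?_
    refine ae_restrict_of_forall_mem Metric.isOpen_ball.measurableSet fun w hw => ?_
    rw [norm_inv, norm_pow]
    exact inv_anti₀ (by positivity) (pow_le_pow_left₀ hpos.le (hlow w hw) 2)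
  -- On |w| = r one has w̄ = r²/w, so the circle average is R⁻⁴ times Cauchy's formula for the
  -- derivative of w g(w) at ar²/R².
  set G : ℂ → ℂ := fun w => w * g w with hG
  have hGd : DifferentiableOn ℂ G (Metric.ball 0 R) := differentiableOn_id.mul hd
  have hcr : ∀ r, 0 ≤ r → r ≤ R → a * r ^ 2 / R ^ 2 ∈ Metric.ball (0 : ℂ) R := by
    intro r h0 hr
    simp only [Metric.mem_ball, dist_zero_right, norm_div, norm_mul, norm_pow, Complex.norm_real,
      Real.norm_eq_abs, abs_of_pos hR, abs_of_nonneg h0]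
    rw [div_lt_iff₀ (by positivity)]
    nlinarith [norm_nonneg a, mul_le_mul hr hr h0 hR.le, mul_pos hR hR]
  have key : ∀ r ∈ Ioo 0 R, (2 * Real.pi * r) • Real.circleAverage
      (fun w => g w / ((R : ℂ) ^ 2 - a * conj w) ^ 2) 0 r =
      (Real.pi / R ^ 4 : ℝ) * (2 * r * deriv G (a * r ^ 2 / R ^ 2)) := by
    intro r hr
    have hr0 : (r : ℂ) ≠ 0 := by exact_mod_cast hr.1.ne'
    have hcc : a * r ^ 2 / R ^ 2 ∈ Metric.ball (0 : ℂ) r := by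
      simp only [Metric.mem_ball, dist_zero_right, norm_div, norm_mul, norm_pow,
        Complex.norm_real, Real.norm_eq_abs, abs_of_pos hR, abs_of_pos hr.1]
      rw [div_lt_iff₀ (by positivity)]
      have h5 : ‖a‖ * r < R ^ 2 := by nlinarith [norm_nonneg a, hr.1, hr.2]
      nlinarith [hr.1]
    have hcau := Complex.two_pi_I_inv_smul_circleIntegral_sub_sq_inv_smul_of_differentiable (U :=
      Metric.ball (0 : ℂ) R) Metric.isOpen_ball (c := 0) (R := r)
      (Metric.closedBall_subset_ball hr.2) hGd hcc
    rw [Real.circleAverage_eq_circleIntegral hr.1.ne', ← hcau]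
    have : (∮ z in C(0, r), (z - 0)⁻¹ • (g z / ((R : ℂ) ^ 2 - a * conj z) ^ 2)) =
        ∮ z in C(0, r), ((R : ℂ) ^ 4)⁻¹ • (((z - a * r ^ 2 / R ^ 2) ^ 2)⁻¹ • G z) := by
      refine circleIntegral.integral_congr hr.1.le fun z hz => ?_
      have hz1 : ‖z‖ = r := by simpa using hz
      have hz0 : z ≠ 0 := by rw [← norm_pos_iff, hz1]; exact hr.1
      have hconj : conj z = r ^ 2 / z := by
        rw [eq_div_iff hz0, mul_comm, Complex.mul_conj, Complex.normSq_eq_norm_sq, hz1]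
        push_cast; ring
      have hzb : z ∈ Metric.ball (0 : ℂ) R := by simpa [hz1] using hr.2
      have h6 := hne z hzb
      simp only [sub_zero, smul_eq_mul, hG]
      have h7 : z - a * r ^ 2 / R ^ 2 = z * ((R : ℂ) ^ 2 - a * conj z) / R ^ 2 := by
        rw [hconj]; field_simp
      rw [h7]
      field_simp
    rw [this, circleIntegral.integral_smul, smul_comm, smul_eq_mul]
    simp only [smul_eq_mul, Complex.real_smul, Complex.ofReal_mul, Complex.ofReal_div, Complex.ofReal_pow,
      Complex.ofReal_ofNat]
    field_simp
  rw [setIntegral_congr_fun measurableSet_Ioo key, integral_const_mul,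
    ← integral_Ioc_eq_integral_Ioo, ← intervalIntegral.integral_of_le hR.le]
  have hmaps : MapsTo (fun r : ℝ => a * (r : ℂ) ^ 2 / (R : ℂ) ^ 2) (uIcc 0 R)
      (Metric.ball (0 : ℂ) R) := fun r hr => by
    rw [uIcc_of_le hR.le] at hr
    exact hcr r hr.1 hr.2
  -- The radial integrand 2r(wg)'(ar²/R²) is the derivative of r²g(ar²/R²), so only the endpoint r =
  -- R contributes.
  have hFTC := intervalIntegral.integral_eq_sub_of_hasDerivAt (a := 0) (b := R)
    (f := fun r : ℝ => (r : ℂ) ^ 2 * g (a * r ^ 2 / R ^ 2))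
    (f' := fun r : ℝ => 2 * r * deriv G (a * r ^ 2 / R ^ 2)) ?_ ?_
  · rw [hFTC]
    have : a * (R : ℂ) ^ 2 / R ^ 2 = a := by field_simp
    rw [this]
    push_cast
    field_simp
    simp
  · intro r hr
    rw [uIcc_of_le hR.le] at hr
    have hmem := hcr r hr.1 hr.2
    have hgd : HasDerivAt g (deriv g (a * r ^ 2 / R ^ 2)) (a * r ^ 2 / R ^ 2) :=
      (hd.differentiableAt (Metric.isOpen_ball.mem_nhds hmem)).hasDerivAt
    have hin : HasDerivAt (fun r : ℝ => a * (r : ℂ) ^ 2 / (R : ℂ) ^ 2)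
        (a * (2 * r) / (R : ℂ) ^ 2) r := by
      have := ((Complex.ofRealCLM.hasDerivAt (x := r)).fun_pow 2).const_mul a |>.div_const ((R : ℂ) ^ 2)
      simpa using this
    have h2 : HasDerivAt (fun r : ℝ => (r : ℂ) ^ 2) (2 * r) r := by
      have := (Complex.ofRealCLM.hasDerivAt (x := r)).fun_pow 2
      simpa using this
    have h3 := h2.mul (HasDerivAt.scomp r hgd hin)
    refine h3.congr_deriv ?_
    have h4 : deriv G (a * r ^ 2 / R ^ 2) = g (a * r ^ 2 / R ^ 2) +
        a * r ^ 2 / R ^ 2 * deriv g (a * r ^ 2 / R ^ 2) := by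
      have := (hasDerivAt_id (a * (r : ℂ) ^ 2 / R ^ 2)).mul hgd
      have h5 := this.deriv
      simp only [id, one_mul] at h5
      rw [← h5]
      rfl
    rw [h4]
    simp only [smul_eq_mul, Function.comp]
    field_simp
  · refine ContinuousOn.intervalIntegrable (ContinuousOn.mul (by fun_prop) ?_)
    exact (hGd.deriv Metric.isOpen_ball).continuousOn.comp (by fun_prop) hmaps

/-! ### Square integrable holomorphic functions of one variable -/

/-- The reproducing formula is applied to g², which is integrable; the denominator of the kernel is
at least R(R - |a|) in norm. -/
theorem norm_sq_le_setIntegral_disc {g : ℂ → ℂ} {R : ℝ} (hR : 0 < R)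
    (hd : DifferentiableOn ℂ g (Metric.ball 0 R))
    (hi : IntegrableOn (fun w => ‖g w‖ ^ 2) (Metric.ball 0 R)) {a : ℂ} (ha : ‖a‖ < R) :
    ‖g a‖ ^ 2 ≤ (Real.pi * (R - ‖a‖) ^ 2)⁻¹ * ∫ w in Metric.ball (0 : ℂ) R, ‖g w‖ ^ 2 := by
  have hd2 : DifferentiableOn ℂ (fun w => g w ^ 2) (Metric.ball 0 R) := hd.pow 2
  have hi2 : IntegrableOn (fun w => g w ^ 2) (Metric.ball 0 R) := by
    refine Integrable.mono' hi
      (hd2.continuousOn.aestronglyMeasurable Metric.isOpen_ball.measurableSet)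
      (Filter.Eventually.of_forall fun w => by simp)
  have key := integral_disc_reproducing hR hd2 hi2 ha
  have hpi := Real.pi_pos
  have hRa : 0 < R - ‖a‖ := by linarith
  have hnorm : ‖∫ w in Metric.ball (0 : ℂ) R, g w ^ 2 / ((R : ℂ) ^ 2 - a * conj w) ^ 2‖ ≤
      ∫ w in Metric.ball (0 : ℂ) R, ((R * (R - ‖a‖)) ^ 2)⁻¹ * ‖g w‖ ^ 2 := by
    refine norm_integral_le_of_norm_le (hi.const_mul _) ?_
    refine ae_restrict_of_forall_mem Metric.isOpen_ball.measurableSet fun w hw => ?_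
    have h1 : ‖w‖ < R := by simpa using hw
    have h2 := norm_sub_norm_le ((R : ℂ) ^ 2) (a * conj w)
    have h3 : ‖(R : ℂ) ^ 2‖ = R ^ 2 := by simp [abs_of_pos hR]
    rw [h3, norm_mul, RCLike.norm_conj] at h2
    have h4 : R * (R - ‖a‖) ≤ ‖(R : ℂ) ^ 2 - a * conj w‖ := by
      nlinarith [norm_nonneg a, norm_nonneg w]
    rw [norm_div, norm_pow, norm_pow, div_eq_inv_mul]
    gcongr
  rw [key, integral_const_mul] at hnorm
  rw [norm_mul, Complex.norm_real, norm_pow, Real.norm_of_nonneg (by positivity)] at hnorm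
  have h5 : ‖g a‖ ^ 2 = R ^ 2 / Real.pi * (Real.pi / R ^ 2 * ‖g a‖ ^ 2) := by field_simp
  rw [h5]
  refine (mul_le_mul_of_nonneg_left hnorm (by positivity)).trans (le_of_eq ?_)
  field_simp

theorem norm_sq_center_le_setIntegral {g : ℂ → ℂ} {c : ℂ} {R : ℝ} (hR : 0 < R)
    (hd : DifferentiableOn ℂ g (Metric.ball c R))
    (hi : IntegrableOn (fun w => ‖g w‖ ^ 2) (Metric.ball c R)) :
    ‖g c‖ ^ 2 ≤ (Real.pi * R ^ 2)⁻¹ * ∫ w in Metric.ball c R, ‖g w‖ ^ 2 := by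
  have hmp : MeasurePreserving (fun w : ℂ => w + c) volume volume :=
    measurePreserving_add_right volume c
  have hemb : MeasurableEmbedding (fun w : ℂ => w + c) := measurableEmbedding_addRight c
  have hpre : (fun w : ℂ => w + c) ⁻¹' Metric.ball c R = Metric.ball 0 R := by
    ext w; simp [Metric.mem_ball, dist_eq_norm]
  have h1 := norm_sq_le_setIntegral_disc (g := fun w => g (w + c)) (a := 0) hR
    (hd.comp (by fun_prop) (fun w hw => by
      simpa [Metric.mem_ball, dist_eq_norm] using hw)) ?_ (by simpa using hR)
  · rw [zero_add, norm_zero, sub_zero] at h1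
    rwa [← hmp.setIntegral_preimage_emb hemb, hpre]
  · have := (hmp.integrableOn_comp_preimage hemb).2 hi
    rwa [hpre] at this

/-- A square integrable holomorphic function on a punctured disc extends across the puncture. -/
theorem exists_differentiableOn_eqOn_punctured {g : ℂ → ℂ} {R : ℝ} (hR : 0 < R)
    (hd : DifferentiableOn ℂ g (Metric.ball 0 R \ {0}))
    (hi : IntegrableOn (fun w => ‖g w‖ ^ 2) (Metric.ball 0 R)) :
    ∃ G, DifferentiableOn ℂ G (Metric.ball 0 R) ∧ EqOn G g (Metric.ball 0 R \ {0}) := by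
  refine ⟨Function.update g 0 (Filter.limUnder (nhdsWithin 0 {0}ᶜ) g), ?_, ?_⟩
  · refine Complex.differentiableOn_update_limUnder_of_isLittleO (Metric.ball_mem_nhds 0 hR) hd ?_
    have hinv : Filter.Tendsto (fun z : ℂ => z) (nhdsWithin 0 {0}ᶜ) (nhds 0) :=
      nhdsWithin_le_nhds
    have hc0 : (fun _ : ℂ => g 0) =o[nhdsWithin 0 {0}ᶜ] fun z => (z - 0)⁻¹ := by
      rw [Asymptotics.isLittleO_const_left]
      right
      simp only [sub_zero]
      exact tendsto_norm_cobounded_atTop.comp Filter.tendsto_inv₀_nhdsNE_zero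
    refine Asymptotics.IsLittleO.sub ?_ hc0
    -- The disc of radius |z| about z misses the puncture and its area tends to zero, so the
    -- integral of |g|² over it is o(1). The bound at the centre then gives g(z) = o(1/|z|), which
    -- is Riemann's criterion.
    have hvol : Filter.Tendsto ((volume.restrict (Metric.ball (0 : ℂ) R)) ∘
        fun z : ℂ => Metric.ball z ‖z‖) (nhds 0) (nhds 0) := by
      have h1 : Filter.Tendsto (fun z : ℂ => ENNReal.ofReal ‖z‖ ^ 2 * NNReal.pi) (nhds 0)
          (nhds (ENNReal.ofReal ‖(0 : ℂ)‖ ^ 2 * NNReal.pi)) := by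
        refine ENNReal.Tendsto.mul_const ?_ (Or.inr ENNReal.coe_ne_top)
        exact ((ENNReal.continuous_pow 2).comp
          (ENNReal.continuous_ofReal.comp continuous_norm)).tendsto 0
      rw [norm_zero, ENNReal.ofReal_zero, zero_pow two_ne_zero, zero_mul] at h1
      refine tendsto_of_tendsto_of_tendsto_of_le_of_le tendsto_const_nhds h1 (fun _ => zero_le)
        fun z => (Measure.restrict_apply_le _ _).trans ?_
      rw [Complex.volume_ball]
    have htend := Integrable.tendsto_setIntegral_nhds_zero hi hvol
    rw [Asymptotics.isLittleO_iff]
    intro c hc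
    have hpi := Real.pi_pos
    have hev := (htend.mono_left (nhdsWithin_le_nhds (s := {0}ᶜ))).eventually
      (gt_mem_nhds (show 0 < Real.pi * c ^ 2 by positivity))
    filter_upwards [hev, self_mem_nhdsWithin, nhdsWithin_le_nhds
      (Metric.ball_mem_nhds (0 : ℂ) (half_pos hR))] with z h1 h2 h3
    have hz : 0 < ‖z‖ := norm_pos_iff.2 h2
    have hz2 : ‖z‖ < R / 2 := by simpa using h3
    have hsub : Metric.ball z ‖z‖ ⊆ Metric.ball (0 : ℂ) R \ {0} := by
      intro w hw
      have hw' : ‖w - z‖ < ‖z‖ := by simpa [dist_eq_norm] using hw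
      refine ⟨?_, ?_⟩
      · have : ‖w‖ ≤ ‖w - z‖ + ‖z‖ := by simpa using norm_add_le (w - z) z
        rw [mem_ball_zero_iff]; linarith
      · rintro rfl
        simp at hw'
    have hsub' : Metric.ball z ‖z‖ ⊆ Metric.ball (0 : ℂ) R := hsub.trans sdiff_subset
    have h4 := norm_sq_center_le_setIntegral hz (hd.mono hsub) (hi.mono_set hsub')
    rw [Measure.restrict_restrict Metric.isOpen_ball.measurableSet,
      inter_eq_self_of_subset_left hsub'] at h1
    rw [sub_zero, norm_inv]
    refine abs_le_of_sq_le_sq' ?_ (by positivity) |>.2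
    calc ‖g z‖ ^ 2 ≤ (Real.pi * ‖z‖ ^ 2)⁻¹ * (Real.pi * c ^ 2) := h4.trans (by gcongr)
      _ = (c * ‖z‖⁻¹) ^ 2 := by field_simp
  · intro w hw
    exact Function.update_of_ne hw.2 _ _

/-! ### Forelli-Rudin estimate -/

/-- The norm equals the distance from exp(iθ) to br, so the integrand is a multiple of the Poisson
kernel at br, whose circle average is one. -/
theorem lintegral_circle_inv_norm_sq {b : ℂ} {r : ℝ} (hr : 0 ≤ r) (hb : ‖b‖ * r < 1) :
    ∫⁻ θ in Ioo (-Real.pi) Real.pi, ENNReal.ofReal ((‖1 - b * conj (circleMap 0 r θ)‖ ^ 2)⁻¹) =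
      ENNReal.ofReal (2 * Real.pi * (1 - ‖b‖ ^ 2 * r ^ 2)⁻¹) := by
  have hbr : ‖b * r‖ < 1 := by simpa [abs_of_nonneg hr] using hb
  have hpos : 0 < 1 - ‖b‖ ^ 2 * r ^ 2 := by
    have : ‖b‖ * r * (‖b‖ * r) < 1 := by nlinarith [mul_nonneg (norm_nonneg b) hr]
    nlinarith
  have hid : ∀ θ : ℝ, ‖1 - b * conj (circleMap 0 r θ)‖ = ‖circleMap 0 1 θ - b * r‖ := by
    intro θ
    have h1 : circleMap 0 1 θ * conj (circleMap 0 1 θ) = 1 := by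
      rw [Complex.mul_conj, Complex.normSq_eq_norm_sq]; simp
    have h2 : conj (circleMap 0 r θ) = r * conj (circleMap 0 1 θ) := by
      simp [circleMap]
    have h3 : circleMap 0 1 θ - b * r = circleMap 0 1 θ * (1 - b * conj (circleMap 0 r θ)) := by
      rw [h2]; linear_combination b * r * h1
    rw [h3, norm_mul]; simp
  have hne : ∀ θ : ℝ, ‖circleMap 0 1 θ - b * r‖ ≠ 0 := by
    intro θ h
    have h1 : circleMap 0 1 θ = b * r := by rwa [norm_eq_zero, sub_eq_zero] at h
    have h2 : ‖circleMap 0 1 θ‖ = 1 := by simp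
    rw [h1] at h2; linarith
  have hcont : Continuous fun θ : ℝ => (‖circleMap 0 1 θ - b * r‖ ^ 2)⁻¹ :=
    Continuous.inv₀ (by fun_prop) fun θ => pow_ne_zero 2 (hne θ)
  have hP := DiffContOnCl.circleAverage_poissonKernel_smul' (c := 0) (R := 1) (w := b * r)
    (f := fun _ => (1 : ℂ)) diffContOnCl_const (by simpa using hbr)
  simp only [hid]
  rw [← ofReal_integral_eq_lintegral_ofReal]
  · congr 1
    rw [Real.circleAverage_eq_integral_add (-Real.pi), intervalIntegral.integral_comp_add_right
      (fun θ => ((‖circleMap (0:ℂ) 1 θ - 0‖ ^ 2 - ‖b * (r:ℂ) - 0‖ ^ 2) /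
        ‖circleMap 0 1 θ - 0 - (b * r - 0)‖ ^ 2) • (1 : ℂ)),
      show (0 : ℝ) + -Real.pi = -Real.pi by ring,
      show 2 * Real.pi + -Real.pi = Real.pi by ring,
      intervalIntegral.integral_smul_const, Complex.real_smul, Complex.real_smul, mul_one] at hP
    norm_cast at hP
    simp only [sub_zero, norm_circleMap_zero, abs_one, norm_mul, Complex.norm_real,
      Real.norm_of_nonneg hr, div_eq_mul_inv, intervalIntegral.integral_const_mul] at hP
    rw [intervalIntegral.integral_of_le (by linarith [Real.pi_pos]),
      integral_Ioc_eq_integral_Ioo] at hP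
    have hpi := Real.pi_pos
    rw [one_pow, mul_pow] at hP
    set J := ∫ θ in Ioo (-Real.pi) Real.pi, (‖circleMap 0 1 θ - b * r‖ ^ 2)⁻¹
    field_simp at hP ⊢
    linarith
  · exact (hcont.integrableOn_Icc).mono_set Ioo_subset_Icc_self
  · exact Filter.Eventually.of_forall fun θ => by positivity

theorem lintegral_rpow_Ioc {δ s : ℝ} (hδ : 0 ≤ δ) (hs : -1 < s) :
    ∫⁻ u in Ioc 0 δ, ENNReal.ofReal (u ^ s) = ENNReal.ofReal (δ ^ (s + 1) / (s + 1)) := by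
  rw [← ofReal_integral_eq_lintegral_ofReal]
  · rw [← intervalIntegral.integral_of_le hδ, integral_rpow (Or.inl hs),
      Real.zero_rpow (by linarith), sub_zero]
  · exact (intervalIntegrable_iff_integrableOn_Ioc_of_le hδ).1
      (intervalIntegral.intervalIntegrable_rpow' hs)
  · exact ae_restrict_of_forall_mem measurableSet_Ioc fun u hu => Real.rpow_nonneg hu.1.le _

/-- Below δ the maximum is the constant δ and ε < 1 gives integrability at 0; above δ the integrand
is u^(-ε-1) and ε > 0 gives integrability at infinity. Each piece has size δ^(-ε). -/
theorem lintegral_rpow_div_max_le {δ ε : ℝ} (hδ : 0 < δ) (hε : 0 < ε) (hε1 : ε < 1) :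
    ∫⁻ u in Ioi 0, ENNReal.ofReal (u ^ (-ε) * (max δ u)⁻¹) ≤
      ENNReal.ofReal ((1 / (1 - ε) + 1 / ε) * δ ^ (-ε)) := by
  rw [← Ioc_union_Ioi_eq_Ioi hδ.le]
  refine (lintegral_union_le _ _ _).trans ?_
  have h1 : ∫⁻ u in Ioc 0 δ, ENNReal.ofReal (u ^ (-ε) * (max δ u)⁻¹) ≤
      ENNReal.ofReal (1 / (1 - ε) * δ ^ (-ε)) := by
    calc ∫⁻ u in Ioc 0 δ, ENNReal.ofReal (u ^ (-ε) * (max δ u)⁻¹)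
        = ∫⁻ u in Ioc 0 δ, ENNReal.ofReal (δ⁻¹) * ENNReal.ofReal (u ^ (-ε)) := by
          refine setLIntegral_congr_fun measurableSet_Ioc fun u hu => ?_
          rw [max_eq_left hu.2, mul_comm, ENNReal.ofReal_mul (by positivity)]
      _ = ENNReal.ofReal (1 / (1 - ε) * δ ^ (-ε)) := by
          rw [lintegral_const_mul _ (by fun_prop), lintegral_rpow_Ioc hδ.le (by linarith),
            ← ENNReal.ofReal_mul (by positivity), Real.rpow_add hδ, Real.rpow_one]
          congr 1
          have : (1 - ε) ≠ 0 := by linarith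
          rw [show -ε + 1 = 1 - ε by ring]
          field_simp
      _ ≤ _ := le_rfl
  have h2 : ∫⁻ u in Ioi δ, ENNReal.ofReal (u ^ (-ε) * (max δ u)⁻¹) ≤
      ENNReal.ofReal (1 / ε * δ ^ (-ε)) := by
    calc ∫⁻ u in Ioi δ, ENNReal.ofReal (u ^ (-ε) * (max δ u)⁻¹)
        = ∫⁻ u in Ioi δ, ENNReal.ofReal (u ^ (-ε - 1)) := by
          refine setLIntegral_congr_fun measurableSet_Ioi fun u hu => ?_
          have hu0 : 0 < u := hδ.trans hu
          rw [max_eq_right (le_of_lt hu), Real.rpow_sub hu0, Real.rpow_one, div_eq_mul_inv]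
      _ = ENNReal.ofReal (1 / ε * δ ^ (-ε)) := by
          rw [← ofReal_integral_eq_lintegral_ofReal, integral_Ioi_rpow_of_lt (by linarith) hδ]
          · congr 1
            rw [show -ε - 1 + 1 = -ε by ring]
            field_simp
          · exact integrableOn_Ioi_rpow_of_lt (by linarith) hδ
          · exact ae_restrict_of_forall_mem measurableSet_Ioi fun u hu =>
              Real.rpow_nonneg (hδ.le.trans (le_of_lt hu)) _
      _ ≤ _ := le_rfl
  refine (add_le_add h1 h2).trans ?_
  have h3 : 0 < 1 - ε := by linarith
  rw [← ENNReal.ofReal_add (by positivity) (by positivity), add_mul]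

/-- Angular integration is exact and leaves 1/(1-|b|²r²), at most 1/max(1-|b|², 1-r). The remaining
radial integral has a singularity at r = 0, integrable because κ > -2, and one at r = 1, which
yields the power of 1-|b|². -/
theorem exists_lintegral_forelliRudin_le {κ ε : ℝ} (hκ : -2 < κ) (hε : 0 < ε) (hε1 : ε < 1) :
    ∃ C : ℝ, 0 ≤ C ∧ ∀ b : ℂ, ‖b‖ < 1 →
      ∫⁻ w in Metric.ball (0 : ℂ) 1, ENNReal.ofReal
        (‖w‖ ^ κ * (1 - ‖w‖ ^ 2) ^ (-ε) * (‖1 - b * conj w‖ ^ 2)⁻¹) ≤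
      ENNReal.ofReal (C * (1 - ‖b‖ ^ 2) ^ (-ε)) := by
  have h1ε : 0 < 1 - ε := by linarith
  have hκ2 : 0 < κ + 2 := by linarith
  have hpi := Real.pi_pos
  refine ⟨2 * Real.pi * (4 * (1 / (κ + 2)) + 2 ^ |κ + 1| * (1 / (1 - ε) + 1 / ε)), by positivity,
    fun b hb => ?_⟩
  set δ := 1 - ‖b‖ ^ 2 with hδdef
  have hδ : 0 < δ := by rw [hδdef]; nlinarith [norm_nonneg b]
  have hδ1 : δ ≤ 1 := by rw [hδdef]; nlinarith [norm_nonneg b]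
  rw [setLIntegral_ball_eq_polar (by fun_prop)]
  have hrad : ∀ r ∈ Ioo (0 : ℝ) 1, ENNReal.ofReal r * ∫⁻ θ in Ioo (-Real.pi) Real.pi,
      ENNReal.ofReal (‖circleMap 0 r θ‖ ^ κ * (1 - ‖circleMap 0 r θ‖ ^ 2) ^ (-ε) *
        (‖1 - b * conj (circleMap 0 r θ)‖ ^ 2)⁻¹) ≤
      ENNReal.ofReal (2 * Real.pi) * (ENNReal.ofReal 4 * ENNReal.ofReal (r ^ (κ + 1)) +
        ENNReal.ofReal (2 ^ |κ + 1|) *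
          ENNReal.ofReal ((1 - r) ^ (-ε) * (max δ (1 - r))⁻¹)) := by
    intro r hr
    have hr0 := hr.1
    have hr1 : 0 < 1 - r := by linarith [hr.2]
    have hr2 : 0 < 1 - r ^ 2 := by nlinarith
    have hbr : ‖b‖ * r < 1 := by nlinarith [norm_nonneg b, hr.2]
    have hden : max δ (1 - r) ≤ 1 - ‖b‖ ^ 2 * r ^ 2 := by
      refine max_le ?_ ?_
      · rw [hδdef]; nlinarith [sq_nonneg ‖b‖, hr.2]
      · nlinarith [sq_nonneg ‖b‖, hr.2, norm_nonneg b, mul_nonneg (norm_nonneg b) hr0.le]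
    have hmaxpos : 0 < max δ (1 - r) := lt_max_of_lt_left hδ
    simp only [norm_circleMap_zero, abs_of_pos hr0]
    have e1 : ∀ θ : ℝ, ENNReal.ofReal (r ^ κ * (1 - r ^ 2) ^ (-ε) *
        (‖1 - b * conj (circleMap 0 r θ)‖ ^ 2)⁻¹) = ENNReal.ofReal (r ^ κ * (1 - r ^ 2) ^ (-ε)) *
        ENNReal.ofReal ((‖1 - b * conj (circleMap 0 r θ)‖ ^ 2)⁻¹) := fun θ =>
      ENNReal.ofReal_mul (by positivity)
    simp only [e1]
    rw [lintegral_const_mul _ (by unfold circleMap; fun_prop),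
      lintegral_circle_inv_norm_sq hr0.le hbr,
      ← ENNReal.ofReal_mul (by positivity), ← ENNReal.ofReal_mul hr0.le,
      ← ENNReal.ofReal_mul (by positivity), ← ENNReal.ofReal_mul (by positivity),
      ← ENNReal.ofReal_add (by positivity) (by positivity),
      ← ENNReal.ofReal_mul (by positivity)]
    refine ENNReal.ofReal_le_ofReal ?_
    have hA : (1 - r ^ 2) ^ (-ε) ≤ (1 - r) ^ (-ε) :=
      Real.rpow_le_rpow_of_nonpos hr1 (by nlinarith) (by linarith)
    have hB : (1 - ‖b‖ ^ 2 * r ^ 2)⁻¹ ≤ (max δ (1 - r))⁻¹ := inv_anti₀ hmaxpos hden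
    have hB0 : 0 ≤ (1 - ‖b‖ ^ 2 * r ^ 2)⁻¹ := inv_nonneg.2 (hmaxpos.le.trans hden)
    have hC : r ^ (κ + 1) = r * r ^ κ := by
      rw [Real.rpow_add hr0, Real.rpow_one, mul_comm]
    have hD : r * (r ^ κ * (1 - r ^ 2) ^ (-ε) * (2 * Real.pi * (1 - ‖b‖ ^ 2 * r ^ 2)⁻¹)) ≤
        2 * Real.pi * (r ^ (κ + 1) * ((1 - r) ^ (-ε) * (max δ (1 - r))⁻¹)) := by
      rw [hC]
      calc _ = 2 * Real.pi * ((r * r ^ κ) * ((1 - r ^ 2) ^ (-ε) *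
              (1 - ‖b‖ ^ 2 * r ^ 2)⁻¹)) := by ring
        _ ≤ _ := by gcongr
    refine hD.trans ?_
    gcongr
    -- In the inner half the two factors singular at r = 1 are at most 2 each, whence the constant
    -- 4; in the outer half r^(κ+1) is at most 2^|κ+1|.
    rcases le_total r (1 / 2) with h | h
    · have hE : (1 - r) ^ (-ε) ≤ 2 := by
        calc (1 - r) ^ (-ε) ≤ (1 / 2 : ℝ) ^ (-ε) :=
              Real.rpow_le_rpow_of_nonpos (by norm_num) (by linarith) (by linarith)
          _ = 2 ^ ε := by rw [one_div, Real.inv_rpow (by norm_num), Real.rpow_neg (by norm_num),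
              inv_inv]
          _ ≤ 2 ^ (1 : ℝ) := Real.rpow_le_rpow_of_exponent_le (by norm_num) hε1.le
          _ = 2 := Real.rpow_one 2
      have hF : (max δ (1 - r))⁻¹ ≤ 2 := by
        rw [inv_le_comm₀ hmaxpos (by norm_num)]
        exact le_max_of_le_right (by linarith)
      have hG : (1 - r) ^ (-ε) * (max δ (1 - r))⁻¹ ≤ 2 * 2 := by gcongr
      have hH : 0 ≤ 2 ^ |κ + 1| * ((1 - r) ^ (-ε) * (max δ (1 - r))⁻¹) := by positivity
      have hI : 0 ≤ r ^ (κ + 1) := by positivity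
      nlinarith
    · have hE : r ^ (κ + 1) ≤ 2 ^ |κ + 1| := by
        rcases le_total 0 (κ + 1) with h' | h'
        · calc r ^ (κ + 1) ≤ 1 := Real.rpow_le_one hr0.le hr.2.le h'
            _ ≤ _ := Real.one_le_rpow (by norm_num) (abs_nonneg _)
        · calc r ^ (κ + 1) ≤ (1 / 2 : ℝ) ^ (κ + 1) :=
                Real.rpow_le_rpow_of_nonpos (by norm_num) h h'
            _ = 2 ^ |κ + 1| := by
              rw [one_div, Real.inv_rpow (by norm_num), ← Real.rpow_neg (by norm_num),
                abs_of_nonpos h']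
      have hI : 0 ≤ r ^ (κ + 1) := by positivity
      have hJ : 0 ≤ (1 - r) ^ (-ε) * (max δ (1 - r))⁻¹ := by positivity
      nlinarith [mul_le_mul_of_nonneg_right hE hJ]
  refine (setLIntegral_mono (by fun_prop) hrad).trans ?_
  have hI1 : ∫⁻ r in Ioo (0 : ℝ) 1, ENNReal.ofReal (r ^ (κ + 1)) ≤
      ENNReal.ofReal (1 / (κ + 2)) := by
    refine (lintegral_mono_set Ioo_subset_Ioc_self).trans ?_
    rw [lintegral_rpow_Ioc zero_le_one (by linarith), Real.one_rpow,
      show κ + 1 + 1 = κ + 2 by ring]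
  have hI2 : ∫⁻ r in Ioo (0 : ℝ) 1, ENNReal.ofReal ((1 - r) ^ (-ε) * (max δ (1 - r))⁻¹) ≤
      ENNReal.ofReal ((1 / (1 - ε) + 1 / ε) * δ ^ (-ε)) := by
    refine le_trans ?_ (lintegral_rpow_div_max_le hδ hε hε1)
    rw [← lintegral_indicator measurableSet_Ioo, ← lintegral_indicator measurableSet_Ioi,
      ← lintegral_sub_left_eq_self ((Ioi (0 : ℝ)).indicator _) (1 : ℝ)]
    refine lintegral_mono fun r => ?_
    by_cases hr : r ∈ Ioo (0 : ℝ) 1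
    · rw [indicator_of_mem hr, indicator_of_mem (by simpa using hr.2)]
    · rw [indicator_of_notMem hr]; exact zero_le
  rw [lintegral_const_mul _ (by fun_prop), lintegral_add_left (by fun_prop),
    lintegral_const_mul _ (by fun_prop), lintegral_const_mul _ (by fun_prop)]
  have hδε : 1 ≤ δ ^ (-ε) := Real.one_le_rpow_of_pos_of_le_one_of_nonpos hδ hδ1 (by linarith)
  calc _ ≤ ENNReal.ofReal (2 * Real.pi) * (ENNReal.ofReal 4 * ENNReal.ofReal (1 / (κ + 2)) +
        ENNReal.ofReal (2 ^ |κ + 1|) * ENNReal.ofReal ((1 / (1 - ε) + 1 / ε) * δ ^ (-ε))) := by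
        gcongr
    _ = ENNReal.ofReal (2 * Real.pi * (4 * (1 / (κ + 2)) +
          2 ^ |κ + 1| * ((1 / (1 - ε) + 1 / ε) * δ ^ (-ε)))) := by
        rw [ENNReal.ofReal_mul (by positivity : 0 ≤ 2 * Real.pi),
          ENNReal.ofReal_add (by positivity) (by positivity),
          ENNReal.ofReal_mul (by positivity : (0:ℝ) ≤ 4),
          ENNReal.ofReal_mul (by positivity : (0:ℝ) ≤ 2 ^ |κ + 1|)]
    _ ≤ _ := by
        refine ENNReal.ofReal_le_ofReal ?_
        rw [mul_assoc (2 * Real.pi)]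
        gcongr
        have : 0 ≤ 4 * (1 / (κ + 2)) := by positivity
        nlinarith

/-! ### The domain -/

theorem mem_thinHartogs {n : ℕ} (hn : 1 ≤ n) {z : ℂ × ℂ} :
    z ∈ thinHartogs n ↔ ‖z.1‖ < ‖z.2‖ ^ n ∧ ‖z.2‖ < 1 := by
  have hn0 : (0 : ℝ) < n := by exact_mod_cast hn
  have h : ‖z.1‖ ^ (1 / (n : ℝ)) < ‖z.2‖ ↔ ‖z.1‖ < ‖z.2‖ ^ n := by
    rw [one_div, Real.rpow_inv_lt_iff_of_pos (norm_nonneg _) (norm_nonneg _) hn0,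
      Real.rpow_natCast]
  exact and_congr_left fun _ => h

theorem isOpen_thinHartogs {n : ℕ} (hn : 1 ≤ n) : IsOpen (thinHartogs n) := by
  have : thinHartogs n = {z : ℂ × ℂ | ‖z.1‖ < ‖z.2‖ ^ n} ∩ {z | ‖z.2‖ < 1} := by
    ext z; exact mem_thinHartogs hn
  rw [this]
  exact (isOpen_lt (by fun_prop) (by fun_prop)).inter (isOpen_lt (by fun_prop) (by fun_prop))

theorem norm_snd_pos {n : ℕ} {z : ℂ × ℂ} (hz : z ∈ thinHartogs n) : 0 < ‖z.2‖ :=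
  lt_of_le_of_lt (Real.rpow_nonneg (norm_nonneg _) _) hz.1

theorem thinHartogs_subset_ball {n : ℕ} (hn : 1 ≤ n) : thinHartogs n ⊆ Metric.ball 0 1 := by
  intro z hz
  have h := (mem_thinHartogs hn).1 hz
  rw [mem_ball_zero_iff, Prod.norm_def, max_lt_iff]
  exact ⟨h.1.trans_le (pow_le_one₀ (norm_nonneg _) h.2.le), h.2⟩

theorem isFiniteMeasure_lebesgueOn {n : ℕ} (hn : 1 ≤ n) :
    IsFiniteMeasure (lebesgueOn (thinHartogs n)) :=
  ⟨by
    rw [Measure.restrict_apply_univ]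
    exact (measure_mono (thinHartogs_subset_ball hn)).trans_lt measure_ball_lt_top⟩

/-- The domain fibres over w₂ in the unit disc with fibre the disc of radius |w₂|ⁿ, empty at w₂ = 0.
Every iterated integral over the domain uses this. -/
theorem indicator_thinHartogs {n : ℕ} (hn : 1 ≤ n) {E : Type*} [Zero E] (f : ℂ × ℂ → E)
    (w₁ w₂ : ℂ) : (thinHartogs n).indicator f (w₁, w₂) = (Metric.ball (0 : ℂ) 1).indicator
      (fun w₂ => (Metric.ball (0 : ℂ) (‖w₂‖ ^ n)).indicator (fun w₁ => f (w₁, w₂)) w₁) w₂ := by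
  have hiff : (w₁, w₂) ∈ thinHartogs n ↔ ‖w₁‖ < ‖w₂‖ ^ n ∧ ‖w₂‖ < 1 := mem_thinHartogs hn
  by_cases h2 : ‖w₂‖ < 1 <;> by_cases h1 : ‖w₁‖ < ‖w₂‖ ^ n <;>
    simp only [indicator, hiff, h1, h2, mem_ball_zero_iff, and_true, and_false, if_true, if_false]

theorem setLIntegral_thinHartogs {n : ℕ} (hn : 1 ≤ n) {f : ℂ × ℂ → ℝ≥0∞} (hf : Measurable f) :
    ∫⁻ w in thinHartogs n, f w = ∫⁻ w₂ in Metric.ball (0 : ℂ) 1,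
      ∫⁻ w₁ in Metric.ball (0 : ℂ) (‖w₂‖ ^ n), f (w₁, w₂) := by
  rw [← lintegral_indicator (isOpen_thinHartogs hn).measurableSet, Measure.volume_eq_prod,
    lintegral_prod_symm _ (hf.indicator (isOpen_thinHartogs hn).measurableSet).aemeasurable,
    ← lintegral_indicator Metric.isOpen_ball.measurableSet]
  refine lintegral_congr fun w₂ => ?_
  simp only [indicator_thinHartogs hn]
  by_cases h : w₂ ∈ Metric.ball (0 : ℂ) 1
  · simp only [indicator_of_mem h]
    rw [lintegral_indicator Metric.isOpen_ball.measurableSet]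
  · simp only [indicator_of_notMem h, lintegral_zero]

/-! ### Fubini's theorem over the fibres of the domain -/

section Fubini

variable {n : ℕ} {E : Type*} [NormedAddCommGroup E] {f : ℂ × ℂ → E}

theorem ae_integrableOn_slice (hn : 1 ≤ n) (hf : Integrable f (lebesgueOn (thinHartogs n))) :
    ∀ᵐ w₂ ∂(volume.restrict (Metric.ball (0 : ℂ) 1)),
      IntegrableOn (fun w₁ => f (w₁, w₂)) (Metric.ball 0 (‖w₂‖ ^ n)) := by
  have h1 := (integrable_indicator_iff (isOpen_thinHartogs hn).measurableSet).2 hf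
  rw [Measure.volume_eq_prod] at h1
  rw [ae_restrict_iff' Metric.isOpen_ball.measurableSet]
  filter_upwards [h1.prod_left_ae] with w₂ h2 h3
  simp only [indicator_thinHartogs hn, indicator_of_mem h3] at h2
  exact (integrable_indicator_iff Metric.isOpen_ball.measurableSet).1 h2

variable [NormedSpace ℝ E]

theorem integral_slice_indicator (hn : 1 ≤ n) (w₂ : ℂ) :
    ∫ w₁, (thinHartogs n).indicator f (w₁, w₂) = (Metric.ball (0 : ℂ) 1).indicator
      (fun w₂ => ∫ w₁ in Metric.ball (0 : ℂ) (‖w₂‖ ^ n), f (w₁, w₂)) w₂ := by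
  simp only [indicator_thinHartogs hn]
  by_cases h : w₂ ∈ Metric.ball (0 : ℂ) 1
  · simp only [indicator_of_mem h]
    rw [integral_indicator Metric.isOpen_ball.measurableSet]
  · simp only [indicator_of_notMem h, integral_zero]

theorem integrableOn_integral_slice (hn : 1 ≤ n)
    (hf : Integrable f (lebesgueOn (thinHartogs n))) :
    IntegrableOn (fun w₂ => ∫ w₁ in Metric.ball (0 : ℂ) (‖w₂‖ ^ n), f (w₁, w₂))
      (Metric.ball (0 : ℂ) 1) := by
  have h1 := (integrable_indicator_iff (isOpen_thinHartogs hn).measurableSet).2 hf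
  rw [Measure.volume_eq_prod] at h1
  have h2 := h1.integral_prod_right
  simp only [integral_slice_indicator hn] at h2
  exact (integrable_indicator_iff Metric.isOpen_ball.measurableSet).1 h2

theorem setIntegral_thinHartogs (hn : 1 ≤ n) (hf : Integrable f (lebesgueOn (thinHartogs n))) :
    ∫ w in thinHartogs n, f w = ∫ w₂ in Metric.ball (0 : ℂ) 1,
      ∫ w₁ in Metric.ball (0 : ℂ) (‖w₂‖ ^ n), f (w₁, w₂) := by
  have h1 := (integrable_indicator_iff (isOpen_thinHartogs hn).measurableSet).2 hf
  rw [← integral_indicator (isOpen_thinHartogs hn).measurableSet]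
  rw [Measure.volume_eq_prod] at h1 ⊢
  rw [integral_prod_symm _ h1]
  simp only [integral_slice_indicator hn]
  rw [integral_indicator Metric.isOpen_ball.measurableSet]

end Fubini

theorem setLIntegral_ball_scale {f : ℂ → ℝ≥0∞} (hf : Measurable f) {ρ : ℝ} (hρ : 0 < ρ) :
    ∫⁻ w in Metric.ball (0 : ℂ) ρ, f w =
      ENNReal.ofReal (ρ ^ 2) * ∫⁻ w in Metric.ball (0 : ℂ) 1, f (ρ * w) := by
  have h1 := Measure.map_addHaar_smul (volume : Measure ℂ) hρ.ne'
  rw [Complex.finrank_real_complex] at h1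
  have h2 : ∫⁻ w, (Metric.ball (0 : ℂ) ρ).indicator f w ∂(Measure.map (ρ • ·) volume) =
      ∫⁻ w in Metric.ball (0 : ℂ) 1, f (ρ * w) := by
    rw [lintegral_map (hf.indicator Metric.isOpen_ball.measurableSet) (by fun_prop),
      ← lintegral_indicator Metric.isOpen_ball.measurableSet]
    refine lintegral_congr fun w => ?_
    have : ρ • w ∈ Metric.ball (0 : ℂ) ρ ↔ w ∈ Metric.ball (0 : ℂ) 1 := by
      simp [abs_of_pos hρ, hρ]
    by_cases h : w ∈ Metric.ball (0 : ℂ) 1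
    · rw [indicator_of_mem h, indicator_of_mem (this.2 h), Complex.real_smul]
    · rw [indicator_of_notMem h, indicator_of_notMem (fun h' => h (this.1 h'))]
  rw [← h2, h1, lintegral_smul_measure, lintegral_indicator Metric.isOpen_ball.measurableSet,
    smul_eq_mul, ← mul_assoc, ← ENNReal.ofReal_mul (by positivity),
    abs_of_pos (by positivity), mul_inv_cancel₀ (by positivity), ENNReal.ofReal_one, one_mul]

/-! ### The Bergman kernel of the thin Hartogs triangle -/

/-- The Bergman kernel of `ℍ_{1/n}` in closed form. -/
noncomputable def hartogsKernel (n : ℕ) (z w : ℂ × ℂ) : ℂ :=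
  (z.2 * conj w.2) ^ n / (Real.pi ^ 2 * ((z.2 * conj w.2) ^ n - z.1 * conj w.1) ^ 2 *
    (1 - z.2 * conj w.2) ^ 2)

/-- `|1 - x|⁻² |1 - y|⁻²` with `x = z₁ w̄₁ / (z₂ w̄₂) ^ n` and `y = z₂ w̄₂`. -/
noncomputable def bidiscWeight (n : ℕ) (z w : ℂ × ℂ) : ℝ :=
  (‖1 - z.1 / z.2 ^ n * conj (w.1 / w.2 ^ n)‖ ^ 2)⁻¹ * (‖1 - z.2 * conj w.2‖ ^ 2)⁻¹

theorem bidiscWeight_nonneg (n : ℕ) (z w : ℂ × ℂ) : 0 ≤ bidiscWeight n z w := by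
  unfold bidiscWeight; positivity

theorem bidiscWeight_comm (n : ℕ) (z w : ℂ × ℂ) : bidiscWeight n z w = bidiscWeight n w z := by
  unfold bidiscWeight
  congr 3
  · rw [← RCLike.norm_conj]; simp [mul_comm]
  · rw [← RCLike.norm_conj]; simp [mul_comm]

theorem hartogsKernel_conj (n : ℕ) (z w : ℂ × ℂ) :
    conj (hartogsKernel n z w) = hartogsKernel n w z := by
  simp [hartogsKernel, mul_comm]

/-! ### Size and regularity of the kernel -/

section Bounds

variable {n : ℕ} {z w : ℂ × ℂ}

theorem norm_fst_div_lt_one (hn : 1 ≤ n) (hz : z ∈ thinHartogs n) : ‖z.1 / z.2 ^ n‖ < 1 := by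
  have h := norm_snd_pos hz
  rw [norm_div, norm_pow, div_lt_one (by positivity)]
  exact ((mem_thinHartogs hn).1 hz).1

theorem pow_sub_eq_mul (hz : z.2 ≠ 0) (hw : w.2 ≠ 0) :
    (z.2 * conj w.2) ^ n - z.1 * conj w.1 =
      (z.2 * conj w.2) ^ n * (1 - z.1 / z.2 ^ n * conj (w.1 / w.2 ^ n)) := by
  have : conj w.2 ≠ 0 := by simpa using hw
  rw [map_div₀, map_pow]
  simp only [mul_pow]
  field_simp

theorem norm_one_sub_mul_conj_pos {a b : ℂ} (ha : ‖a‖ < 1) (hb : ‖b‖ < 1) :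
    0 < ‖1 - a * conj b‖ := by
  rw [norm_pos_iff]
  intro h
  have h1 : ‖a * conj b‖ = 1 := by rw [← sub_eq_zero.1 h, norm_one]
  rw [norm_mul, RCLike.norm_conj] at h1
  nlinarith [norm_nonneg a, norm_nonneg b]

theorem one_sub_le_norm_one_sub_mul_conj {a b : ℂ} (hb : ‖b‖ < 1) :
    1 - ‖a‖ ≤ ‖1 - a * conj b‖ := by
  have h := norm_sub_norm_le (1 : ℂ) (a * conj b)
  rw [norm_one, norm_mul, RCLike.norm_conj] at h
  nlinarith [norm_nonneg a, norm_nonneg b]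

/-- The bound is uniform in w up to the boundary, as needed to dominate the kernel and its
derivatives. -/
theorem bidiscWeight_le (hn : 1 ≤ n) {r : ℝ} (hr : r < 1) (hz1 : ‖z.1 / z.2 ^ n‖ ≤ r)
    (hz2 : ‖z.2‖ ≤ r) (hw : w ∈ thinHartogs n) : bidiscWeight n z w ≤ ((1 - r) ^ 4)⁻¹ := by
  have h1 := one_sub_le_norm_one_sub_mul_conj (a := z.1 / z.2 ^ n) (norm_fst_div_lt_one hn hw)
  have h2 := one_sub_le_norm_one_sub_mul_conj (a := z.2) ((mem_thinHartogs hn).1 hw).2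
  have hr' : 0 < 1 - r := by linarith
  have h1' : 1 - r ≤ ‖1 - z.1 / z.2 ^ n * conj (w.1 / w.2 ^ n)‖ := by linarith
  have h2' : 1 - r ≤ ‖1 - z.2 * conj w.2‖ := by linarith
  calc bidiscWeight n z w ≤ ((1 - r) ^ 2)⁻¹ * ((1 - r) ^ 2)⁻¹ := by
        unfold bidiscWeight; gcongr
    _ = ((1 - r) ^ 4)⁻¹ := by rw [← mul_inv]; ring_nf

theorem norm_one_sub_mul_conj_le_two {a b : ℂ} (ha : ‖a‖ < 1) (hb : ‖b‖ < 1) :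
    ‖1 - a * conj b‖ ≤ 2 := by
  have h := norm_sub_le (1 : ℂ) (a * conj b)
  rw [norm_one, norm_mul, RCLike.norm_conj] at h
  nlinarith [norm_nonneg a, norm_nonneg b]

/-- Since this factor cannot vanish, convergence of the Bergman integral at a single point already
forces a weighted integrability of the function. -/
theorem le_bidiscWeight (hn : 1 ≤ n) (hz : z ∈ thinHartogs n) (hw : w ∈ thinHartogs n) :
    (16 : ℝ)⁻¹ ≤ bidiscWeight n z w := by
  have h1 := norm_one_sub_mul_conj_le_two (norm_fst_div_lt_one hn hz) (norm_fst_div_lt_one hn hw)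
  have h2 := norm_one_sub_mul_conj_le_two ((mem_thinHartogs hn).1 hz).2 ((mem_thinHartogs hn).1 hw).2
  have h3 := norm_one_sub_mul_conj_pos (norm_fst_div_lt_one hn hz) (norm_fst_div_lt_one hn hw)
  have h4 := norm_one_sub_mul_conj_pos ((mem_thinHartogs hn).1 hz).2 ((mem_thinHartogs hn).1 hw).2
  calc (16 : ℝ)⁻¹ = (2 ^ 2)⁻¹ * (2 ^ 2)⁻¹ := by norm_num
    _ ≤ bidiscWeight n z w := by unfold bidiscWeight; gcongr

theorem pow_sub_ne_zero (hn : 1 ≤ n) (hz : z ∈ thinHartogs n) (hw : w ∈ thinHartogs n) :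
    (z.2 * conj w.2) ^ n - z.1 * conj w.1 ≠ 0 := by
  have hz2 : z.2 ≠ 0 := norm_pos_iff.1 (norm_snd_pos hz)
  have hw2 : w.2 ≠ 0 := norm_pos_iff.1 (norm_snd_pos hw)
  rw [pow_sub_eq_mul hz2 hw2]
  refine mul_ne_zero (pow_ne_zero _ (mul_ne_zero hz2 (by simpa using hw2))) ?_
  exact norm_pos_iff.1
    (norm_one_sub_mul_conj_pos (norm_fst_div_lt_one hn hz) (norm_fst_div_lt_one hn hw))

theorem one_sub_snd_ne_zero (hn : 1 ≤ n) (hz : z ∈ thinHartogs n) (hw : w ∈ thinHartogs n) :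
    1 - z.2 * conj w.2 ≠ 0 :=
  norm_pos_iff.1
    (norm_one_sub_mul_conj_pos ((mem_thinHartogs hn).1 hz).2 ((mem_thinHartogs hn).1 hw).2)

theorem norm_hartogsKernel (hz : z ∈ thinHartogs n) (hw : w ∈ thinHartogs n) :
    ‖hartogsKernel n z w‖ =
      (Real.pi ^ 2)⁻¹ * ((‖z.2‖ ^ n)⁻¹ * (‖w.2‖ ^ n)⁻¹ * bidiscWeight n z w) := by
  have hz2 : z.2 ≠ 0 := norm_pos_iff.1 (norm_snd_pos hz)
  have hw2 : w.2 ≠ 0 := norm_pos_iff.1 (norm_snd_pos hw)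
  have hzp := norm_snd_pos hz
  have hwp := norm_snd_pos hw
  unfold hartogsKernel bidiscWeight
  rw [pow_sub_eq_mul hz2 hw2]
  simp only [norm_div, norm_mul, norm_pow, RCLike.norm_conj, Complex.norm_real, Real.norm_eq_abs,
    abs_of_pos Real.pi_pos, mul_pow]
  have hpi := Real.pi_pos
  field_simp

theorem differentiableOn_hartogsKernel (hn : 1 ≤ n) (hw : w ∈ thinHartogs n) :
    DifferentiableOn ℂ (fun z => hartogsKernel n z w) (thinHartogs n) := by
  unfold hartogsKernel
  simp only [div_eq_mul_inv]
  refine DifferentiableOn.fun_mul (by fun_prop) (DifferentiableOn.fun_inv (by fun_prop) fun z hz => ?_)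
  exact mul_ne_zero (mul_ne_zero (by simp [Real.pi_ne_zero])
    (pow_ne_zero _ (pow_sub_ne_zero hn hz hw))) (pow_ne_zero _ (one_sub_snd_ne_zero hn hz hw))

theorem measurable_hartogsKernel (n : ℕ) :
    Measurable fun p : (ℂ × ℂ) × (ℂ × ℂ) => hartogsKernel n p.1 p.2 := by
  unfold hartogsKernel; fun_prop

theorem exists_norm_hartogsKernel_le (hn : 1 ≤ n) (hz : z ∈ thinHartogs n) :
    ∃ C : ℝ, 0 < C ∧ ∀ w ∈ thinHartogs n, ‖hartogsKernel n z w‖ ≤ C * (‖w.2‖ ^ n)⁻¹ := by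
  have h1 := norm_fst_div_lt_one hn hz
  have h2 := ((mem_thinHartogs hn).1 hz).2
  have hz2 := norm_snd_pos hz
  set r := max ‖z.1 / z.2 ^ n‖ ‖z.2‖
  have hr : r < 1 := max_lt h1 h2
  have hr' : 0 < 1 - r := by linarith
  refine ⟨(Real.pi ^ 2)⁻¹ * ((‖z.2‖ ^ n)⁻¹ * ((1 - r) ^ 4)⁻¹), ?_, fun w hw => ?_⟩
  · have := Real.pi_pos
    positivity
  rw [norm_hartogsKernel hz hw]
  have := bidiscWeight_le hn hr (le_max_left _ _) (le_max_right _ _) hw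
  have hw2 := norm_snd_pos hw
  calc _ ≤ (Real.pi ^ 2)⁻¹ * ((‖z.2‖ ^ n)⁻¹ * (‖w.2‖ ^ n)⁻¹ * ((1 - r) ^ 4)⁻¹) := by
        gcongr
    _ = _ := by ring

end Bounds

/-- The fibre over w₂ has area π|w₂|²ⁿ, which cancels the weight. -/
theorem lintegral_inv_norm_snd_pow_sq_lt_top {n : ℕ} (hn : 1 ≤ n) :
    ∫⁻ w in thinHartogs n, ENNReal.ofReal (((‖w.2‖ ^ n)⁻¹) ^ 2) < ⊤ := by
  rw [setLIntegral_thinHartogs hn (by fun_prop)]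
  have : ∀ w₂ ∈ Metric.ball (0 : ℂ) 1,
      ∫⁻ _ in Metric.ball (0 : ℂ) (‖w₂‖ ^ n), ENNReal.ofReal (((‖w₂‖ ^ n)⁻¹) ^ 2) ≤
        NNReal.pi := by
    intro w₂ _
    rw [setLIntegral_const, Complex.volume_ball, ← mul_assoc, ← ENNReal.ofReal_pow (by positivity),
      ← ENNReal.ofReal_mul (by positivity)]
    refine (mul_le_mul_left (ENNReal.ofReal_le_one.2 ?_) _).trans_eq (one_mul _)
    rw [← mul_pow]
    exact pow_le_one₀ (by positivity) (inv_mul_le_one)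
  refine (setLIntegral_mono measurable_const this).trans_lt ?_
  rw [setLIntegral_const]
  exact ENNReal.mul_lt_top ENNReal.coe_lt_top measure_ball_lt_top

theorem memBergman_hartogsKernel {n : ℕ} (hn : 1 ≤ n) {z : ℂ × ℂ} (hz : z ∈ thinHartogs n) :
    MemBergman (thinHartogs n) (fun w => hartogsKernel n w z) := by
  have hd := differentiableOn_hartogsKernel hn hz
  have hm : AEStronglyMeasurable (fun w => hartogsKernel n w z) (lebesgueOn (thinHartogs n)) :=
    hd.continuousOn.aestronglyMeasurable (isOpen_thinHartogs hn).measurableSet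
  refine ⟨hd, (memLp_two_iff_integrable_sq_norm hm).2 ?_⟩
  obtain ⟨C, hC, hb⟩ := exists_norm_hartogsKernel_le hn hz
  have hint : Integrable (fun w : ℂ × ℂ => ((‖w.2‖ ^ n)⁻¹) ^ 2) (lebesgueOn (thinHartogs n)) := by
    refine ⟨by fun_prop, ?_⟩
    rw [hasFiniteIntegral_iff_ofReal (Filter.Eventually.of_forall fun w => by positivity)]
    exact lintegral_inv_norm_snd_pow_sq_lt_top hn
  refine Integrable.mono' (hint.const_mul (C ^ 2)) (hm.norm.pow 2) ?_
  refine ae_restrict_of_forall_mem (isOpen_thinHartogs hn).measurableSet fun w hw => ?_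
  rw [Real.norm_of_nonneg (by positivity), ← mul_pow, ← hartogsKernel_conj, RCLike.norm_conj]
  exact pow_le_pow_left₀ (norm_nonneg _) (hb w hw) 2

/-- On the fibre w₂ = β the kernel is a constant times the Bergman kernel of the disc of radius |β|ⁿ
at the point z₁βⁿ/z₂ⁿ. The factor v stands for the values of the function to be reproduced. -/
theorem mul_hartogsKernel_slice {n : ℕ} {z : ℂ × ℂ} (hz2 : z.2 ≠ 0)
    {β : ℂ} (hβ : β ≠ 0) (v w₁ : ℂ) :
    v * hartogsKernel n z (w₁, β) =
      (z.2 * conj β) ^ n * (β / z.2) ^ (2 * n) / (Real.pi ^ 2 * (1 - z.2 * conj β) ^ 2) *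
        (v / (((‖β‖ ^ n : ℝ) : ℂ) ^ 2 - z.1 * β ^ n / z.2 ^ n * conj w₁) ^ 2) := by
  have hR : ((‖β‖ ^ n : ℝ) : ℂ) ^ 2 = β ^ n * conj β ^ n := by
    rw [← mul_pow, Complex.mul_conj, Complex.normSq_eq_norm_sq]
    push_cast; ring
  have h1 : (z.2 * conj β) ^ n - z.1 * conj w₁ =
      (z.2 / β) ^ n * (((‖β‖ ^ n : ℝ) : ℂ) ^ 2 - z.1 * β ^ n / z.2 ^ n * conj w₁) := by
    rw [hR, div_pow, mul_pow]; field_simp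
  unfold hartogsKernel
  simp only
  rw [h1, pow_mul' (β / z.2) 2 n, div_pow, div_pow]
  set D := ((‖β‖ ^ n : ℝ) : ℂ) ^ 2 - z.1 * β ^ n / z.2 ^ n * conj w₁
  have hpi : (Real.pi : ℂ) ≠ 0 := by simp [Real.pi_ne_zero]
  -- The points are not assumed to lie in the domain; if a denominator vanishes, both sides are zero
  -- by the convention for division.
  by_cases hD : D = 0
  · simp [hD]
  by_cases hE : 1 - z.2 * conj β = 0
  · simp [hE]
  field_simp

/-- The reproducing formula on the fibre over β evaluates f at (z₁βⁿ/z₂ⁿ, β), on the curve through z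
where w₁/w₂ⁿ is constant. Along this curve βⁿf is holomorphic and square integrable on the punctured
disc, so it extends over 0, and a second reproducing formula in β evaluates it at z₂. -/
theorem hartogsKernel_reproducing {n : ℕ} (hn : 1 ≤ n) {z : ℂ × ℂ} (hz : z ∈ thinHartogs n)
    {f : ℂ × ℂ → ℂ} (hf : MemBergman (thinHartogs n) f) :
    f z = ∫ w in thinHartogs n, f w * hartogsKernel n z w := by
  have hpi := Real.pi_pos
  have hz2 : z.2 ≠ 0 := norm_pos_iff.1 (norm_snd_pos hz)
  have hz1 := norm_fst_div_lt_one hn hz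
  have hfin := isFiniteMeasure_lebesgueOn hn
  have hint : Integrable (fun w => f w * hartogsKernel n z w) (lebesgueOn (thinHartogs n)) := by
    have := MemLp.integrable_mul (p := 2) (q := 2) hf.2 (memBergman_hartogsKernel hn hz).2.star
    refine this.congr (Filter.Eventually.of_forall fun w => ?_)
    simp only [Pi.mul_apply, Pi.star_apply]
    rw [← hartogsKernel_conj n w z]; rfl
  have hsq : Integrable (fun w => ‖f w‖ ^ 2) (lebesgueOn (thinHartogs n)) :=
    (memLp_two_iff_integrable_sq_norm hf.2.1).1 hf.2
  have hfi : Integrable f (lebesgueOn (thinHartogs n)) := hf.2.integrable one_le_two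
  set h : ℂ → ℂ := fun β => β ^ n * f (z.1 * β ^ n / z.2 ^ n, β) with hh
  have hmem : ∀ β ∈ Metric.ball (0 : ℂ) 1 \ {0}, ‖z.1 * β ^ n / z.2 ^ n‖ < ‖β‖ ^ n := by
    intro β hβ
    have h0 : 0 < ‖β‖ := norm_pos_iff.2 hβ.2
    rw [mul_div_right_comm, norm_mul, norm_pow]
    have : 0 < ‖β‖ ^ n := by positivity
    nlinarith
  have hhd : DifferentiableOn ℂ h (Metric.ball 0 1 \ {0}) := by
    refine DifferentiableOn.mul (by fun_prop) (hf.1.comp (by fun_prop) fun β hβ => ?_)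
    exact (mem_thinHartogs hn).2 ⟨hmem β hβ, by simpa using hβ.1⟩
  have hslice : ∀ β ∈ Metric.ball (0 : ℂ) 1 \ {0},
      DifferentiableOn ℂ (fun w₁ => f (w₁, β)) (Metric.ball 0 (‖β‖ ^ n)) := by
    intro β hβ
    refine hf.1.comp (by fun_prop) fun w₁ hw => ?_
    exact (mem_thinHartogs hn).2 ⟨by simpa using hw, by simpa using hβ.1⟩
  have h0 : ∀ᵐ β ∂(volume.restrict (Metric.ball (0 : ℂ) 1)), β ∈ Metric.ball (0 : ℂ) 1 \ {0} := by
    filter_upwards [ae_restrict_mem Metric.isOpen_ball.measurableSet,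
      ae_restrict_of_ae (Measure.ae_ne volume (0 : ℂ))] with β h1 h2
    exact ⟨h1, h2⟩
  have hhm : AEStronglyMeasurable h (volume.restrict (Metric.ball (0 : ℂ) 1)) := by
    have h1 := hhd.continuousOn.aestronglyMeasurable (μ := volume)
      (Metric.isOpen_ball.measurableSet.diff (measurableSet_singleton 0))
    rwa [Measure.restrict_congr_set (sdiff_null_ae_eq_self (measure_singleton 0))] at h1
  -- The point estimate on a fibre costs |β|^(-2n), which the factor βⁿ in `h` absorbs exactly.
  have hh2 : IntegrableOn (fun β => ‖h β‖ ^ 2) (Metric.ball 0 1) := by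
    refine Integrable.mono' ((integrableOn_integral_slice hn hsq).const_mul
      ((Real.pi * (1 - ‖z.1 / z.2 ^ n‖) ^ 2)⁻¹)) (hhm.norm.pow 2) ?_
    filter_upwards [h0, ae_integrableOn_slice hn hsq] with β hβ hi
    have hβ0 : 0 < ‖β‖ := norm_pos_iff.2 hβ.2
    have h1 := norm_sq_le_setIntegral_disc (pow_pos hβ0 n) (hslice β hβ) hi (hmem β hβ)
    have h2 : ‖β‖ ^ n - ‖z.1 * β ^ n / z.2 ^ n‖ = ‖β‖ ^ n * (1 - ‖z.1 / z.2 ^ n‖) := by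
      rw [mul_div_right_comm, norm_mul, norm_pow]; ring
    rw [h2] at h1
    have h3 : 0 < 1 - ‖z.1 / z.2 ^ n‖ := by linarith
    rw [Real.norm_of_nonneg (by positivity), hh, norm_mul, norm_pow, mul_pow]
    refine (mul_le_mul_of_nonneg_left h1 (by positivity)).trans (le_of_eq ?_)
    field_simp
  obtain ⟨H, hHd, hHe⟩ := exists_differentiableOn_eqOn_punctured one_pos hhd hh2
  have hHi : IntegrableOn H (Metric.ball 0 1) := by
    have h1 : MemLp h 2 (volume.restrict (Metric.ball (0 : ℂ) 1)) :=
      (memLp_two_iff_integrable_sq_norm hhm).2 hh2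
    have : IsFiniteMeasure (volume.restrict (Metric.ball (0 : ℂ) 1)) :=
      ⟨by rw [Measure.restrict_apply_univ]; exact measure_ball_lt_top⟩
    refine (h1.integrable one_le_two).congr ?_
    filter_upwards [h0] with β hβ using (hHe hβ).symm
  have hz21 : ‖z.2‖ < 1 := ((mem_thinHartogs hn).1 hz).2
  have hrep := integral_disc_reproducing one_pos hHd hHi hz21
  rw [setIntegral_thinHartogs hn hint]
  have key : ∀ᵐ β ∂(volume.restrict (Metric.ball (0 : ℂ) 1)),
      ∫ w₁ in Metric.ball (0 : ℂ) (‖β‖ ^ n), f (w₁, β) * hartogsKernel n z (w₁, β) =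
      (Real.pi * z.2 ^ n : ℂ)⁻¹ * (H β / (((1 : ℝ) : ℂ) ^ 2 - z.2 * conj β) ^ 2) := by
    filter_upwards [h0, ae_integrableOn_slice hn hfi] with β hβ hi
    have hβ0 : β ≠ 0 := hβ.2
    have hβn : 0 < ‖β‖ := norm_pos_iff.2 hβ0
    have hcβ : conj β ≠ 0 := by simpa using hβ0
    have h1 := integral_disc_reproducing (pow_pos hβn n) (hslice β hβ) hi (hmem β hβ)
    simp only [mul_hartogsKernel_slice hz2 hβ0]
    rw [integral_const_mul, h1, hHe hβ, hh]
    have hR : ((‖β‖ ^ n : ℝ) : ℂ) ^ 2 = β ^ n * conj β ^ n := by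
      rw [← mul_pow, Complex.mul_conj, Complex.normSq_eq_norm_sq]
      push_cast; ring
    have hpi' : (Real.pi : ℂ) ≠ 0 := by simp [Real.pi_ne_zero]
    have hE : 1 - z.2 * conj β ≠ 0 :=
      norm_pos_iff.1 (norm_one_sub_mul_conj_pos hz21 (by simpa using hβ.1))
    rw [Complex.ofReal_div, Complex.ofReal_pow, hR, Complex.ofReal_one, one_pow]
    simp only [mul_pow, div_pow, pow_mul' _ 2 n]
    field_simp
  rw [integral_congr_ae key, integral_const_mul, hrep, hHe ⟨by simpa using hz21, hz2⟩, hh]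
  simp only
  rw [mul_div_assoc, div_self (pow_ne_zero n hz2), mul_one]
  have hpi' : (Real.pi : ℂ) ≠ 0 := by simp [Real.pi_ne_zero]
  push_cast
  field_simp

theorem representsEval_hartogsKernel {n : ℕ} (hn : 1 ≤ n) {z : ℂ × ℂ} (hz : z ∈ thinHartogs n) :
    RepresentsEval (thinHartogs n) z (fun w => hartogsKernel n w z) := by
  refine ⟨memBergman_hartogsKernel hn hz, fun f hf => ?_⟩
  simp only [hartogsKernel_conj]
  exact hartogsKernel_reproducing hn hz hf

theorem bergmanKernel_thinHartogs {n : ℕ} (hn : 1 ≤ n) {z w : ℂ × ℂ} (hz : z ∈ thinHartogs n)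
    (hw : w ∈ thinHartogs n) : bergmanKernel (thinHartogs n) z w = hartogsKernel n z w := by
  have hex : ∃ k, RepresentsEval (thinHartogs n) z k := ⟨_, representsEval_hartogsKernel hn hz⟩
  rw [bergmanKernel, dif_pos hex, (hex.choose_spec).eqOn (isOpen_thinHartogs hn)
    (representsEval_hartogsKernel hn hz) hw, hartogsKernel_conj]

/-! ### Weak derivatives -/

theorem HasWeakDeriv.ae_unique {Ω : Set (ℂ × ℂ)} (hΩ : IsOpen Ω) {v : ℂ × ℂ}
    {f g g' : ℂ × ℂ → ℂ} (h : HasWeakDeriv Ω v f g) (h' : HasWeakDeriv Ω v f g') :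
    g =ᵐ[lebesgueOn Ω] g' := by
  have key := IsOpen.ae_eq_zero_of_integral_contDiff_smul_eq_zero (μ := volume) hΩ
    (h.2.1.sub h'.2.1) fun φ h1 h2 h3 => by
      have e1 := h.2.2 φ h1 h2 h3
      have e2 := h'.2.2 φ h1 h2 h3
      have e3 : ∫ x in Ω, φ x • g x = ∫ x in Ω, φ x • g' x := by
        rw [← neg_inj, ← e1, ← e2]
      have e4 : ∫ x in Ω, φ x • (g - g') x = 0 := by
        simp only [Pi.sub_apply, smul_sub]
        rw [integral_sub (integrable_testMul h.2.1 h1.continuous h2 h3)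
          (integrable_testMul h'.2.1 h1.continuous h2 h3), e3, sub_self]
      rw [← e4, setIntegral_eq_integral_of_forall_compl_eq_zero]
      intro x hx
      rw [image_eq_zero_of_notMem_tsupport fun hx' => hx (h3 hx'), zero_smul]
  rw [Filter.EventuallyEq, ae_restrict_iff' hΩ.measurableSet]
  filter_upwards [key] with x hx hxΩ
  exact sub_eq_zero.1 (hx hxΩ)

theorem hasWeakDeriv_weakDeriv {Ω : Set (ℂ × ℂ)} {v : ℂ × ℂ} {f g : ℂ × ℂ → ℂ}
    (h : HasWeakDeriv Ω v f g) : HasWeakDeriv Ω v f (weakDeriv Ω v f) := by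
  have hex : ∃ g, HasWeakDeriv Ω v f g := ⟨g, h⟩
  rw [weakDeriv, dif_pos hex]
  exact hex.choose_spec

theorem MemSobolevOne.hasWeakDeriv {Ω : Set (ℂ × ℂ)} {p : ℝ} {f : ℂ × ℂ → ℂ}
    (h : MemSobolevOne Ω p f) (i : Fin 4) :
    HasWeakDeriv Ω (realDir i) f (weakDeriv Ω (realDir i) f) := by
  obtain ⟨g, hg, _⟩ := h.2 i
  exact hasWeakDeriv_weakDeriv hg

theorem MemSobolevOne.memLp_weakDeriv {Ω : Set (ℂ × ℂ)} (hΩ : IsOpen Ω) {p : ℝ}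
    {f : ℂ × ℂ → ℂ} (h : MemSobolevOne Ω p f) (i : Fin 4) :
    MemLp (weakDeriv Ω (realDir i) f) (ENNReal.ofReal p) (lebesgueOn Ω) := by
  obtain ⟨g, hg, hm⟩ := h.2 i
  exact hm.ae_eq (hg.ae_unique hΩ (hasWeakDeriv_weakDeriv hg))

/-! ### Mollification and its convergence in L¹ -/

section Mollification

variable {ι : Type*} {l : Filter ι} {φ : ι → ContDiffBump (0 : ℂ × ℂ)}

/-- This instance is required to see through the defeq `volume = volume.prod volume`. -/
instance isAddHaarMeasure_volume_prod : (volume : Measure (ℂ × ℂ)).IsAddHaarMeasure :=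
  Measure.prod.instIsAddHaarMeasure _ _

/-- Convolution of `F` with a normalised bump function. -/
noncomputable abbrev mollify (ρ : ContDiffBump (0 : ℂ × ℂ)) (F : ℂ × ℂ → ℂ) : ℂ × ℂ → ℂ :=
  convolution (ρ.normed volume) F (ContinuousLinearMap.lsmul ℝ ℝ) volume

theorem mollify_convolutionExists (ρ : ContDiffBump (0 : ℂ × ℂ)) {F : ℂ × ℂ → ℂ}
    (hF : LocallyIntegrable F) :
    ConvolutionExists (ρ.normed volume) F (ContinuousLinearMap.lsmul ℝ ℝ) volume :=
  ρ.hasCompactSupport_normed.convolutionExists_left _ ρ.continuous_normed hF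

theorem integrable_mollify (ρ : ContDiffBump (0 : ℂ × ℂ)) {F : ℂ × ℂ → ℂ}
    (hF : Integrable F) : Integrable (mollify ρ F) :=
  ρ.integrable_normed.integrable_convolution _ hF

theorem integral_norm_mollify_le (ρ : ContDiffBump (0 : ℂ × ℂ)) {F : ℂ × ℂ → ℂ}
    (hF : Integrable F) : ∫ x, ‖(mollify ρ F) x‖ ≤ ∫ x, ‖F x‖ := by
  have h1 := integral_convolution (ContinuousLinearMap.lsmul ℝ ℝ) (μ := volume) (ν := volume)
    ρ.integrable_normed hF.norm
  rw [ρ.integral_normed] at h1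
  simp only [ContinuousLinearMap.lsmul_apply, one_smul] at h1
  rw [← h1]
  refine integral_mono (integrable_mollify ρ hF).norm
    (ρ.integrable_normed.integrable_convolution _ hF.norm) fun x => ?_
  simp only [convolution_def, ContinuousLinearMap.lsmul_apply]
  refine (norm_integral_le_integral_norm _).trans (le_of_eq ?_)
  congr 1 with t
  rw [norm_smul, Real.norm_of_nonneg (ρ.nonneg_normed t), smul_eq_mul]

/-- As soon as the radius is below 1, the difference is supported in the compact 1-thickening of the
support of `c`, where uniform continuity makes it uniformly small. -/
theorem tendsto_integral_norm_mollify_sub_of_continuous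
    (hφ : Filter.Tendsto (fun i => (φ i).rOut) l (nhds 0)) {c : ℂ × ℂ → ℂ} (hc : Continuous c)
    (hcs : HasCompactSupport c) :
    Filter.Tendsto (fun i => ∫ x, ‖(mollify (φ i) c) x - c x‖) l (nhds 0) := by
  set S := Metric.cthickening 1 (tsupport c) with hS
  have hSc : IsCompact S := hcs.isCompact.cthickening
  have huc : UniformContinuous c := hc.uniformContinuous_of_tendsto_cocompact
    hcs.is_zero_at_infty
  rw [Metric.tendsto_nhds]
  intro η hη
  set m := (volume S).toReal with hm
  have hm0 : 0 ≤ m := ENNReal.toReal_nonneg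
  -- Chosen so that κm < η; the added 1 covers the case m = 0.
  set κ := η / (2 * (m + 1)) with hκ
  have hκ0 : 0 < κ := by positivity
  obtain ⟨δ, hδ, hδc⟩ := Metric.uniformContinuous_iff.1 huc κ hκ0
  have hev := hφ.eventually (gt_mem_nhds (lt_min hδ one_pos))
  filter_upwards [hev] with i hi
  have hb : ∀ x, ‖(mollify (φ i) c) x - c x‖ ≤ S.indicator (fun _ => κ) x := by
    intro x
    rw [← dist_eq_norm]
    by_cases hx : x ∈ S
    · rw [indicator_of_mem hx]
      refine (φ i).dist_normed_convolution_le hc.aestronglyMeasurable fun y hy => ?_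
      exact (hδc ((Metric.mem_ball.1 hy).trans (hi.trans_le (min_le_left _ _)))).le
    · rw [indicator_of_notMem hx]
      have hx0 : ∀ y ∈ Metric.ball x (φ i).rOut, c y = 0 := by
        intro y hy
        refine image_eq_zero_of_notMem_tsupport fun hy' => hx ?_
        refine Metric.mem_cthickening_of_dist_le x y 1 _ hy' ?_
        rw [dist_comm]
        exact ((Metric.mem_ball.1 hy).trans (hi.trans_le (min_le_right _ _))).le
      refine (φ i).dist_normed_convolution_le hc.aestronglyMeasurable fun y hy => ?_
      rw [hx0 y hy, hx0 x (Metric.mem_ball_self (φ i).rOut_pos), dist_self]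
  have hint : Integrable (S.indicator fun _ => κ) := by
    rw [integrable_indicator_iff hSc.measurableSet]
    exact integrableOn_const hSc.measure_lt_top.ne
  have hle : ∫ x, ‖(mollify (φ i) c) x - c x‖ ≤ κ * m := by
    refine (integral_mono_of_nonneg (Filter.Eventually.of_forall fun x => norm_nonneg _) hint
      (Filter.Eventually.of_forall hb)).trans (le_of_eq ?_)
    rw [integral_indicator hSc.measurableSet, setIntegral_const, smul_eq_mul, mul_comm]
    rfl
  rw [Real.dist_eq, sub_zero, abs_of_nonneg (integral_nonneg fun x => norm_nonneg _)]
  refine hle.trans_lt ?_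
  rw [hκ, div_mul_eq_mul_div, div_lt_iff₀ (by positivity)]
  nlinarith

/-- Mollifications of an integrable function converge in `L¹`. -/
theorem tendsto_integral_norm_mollify_sub
    (hφ : Filter.Tendsto (fun i => (φ i).rOut) l (nhds 0)) {F : ℂ × ℂ → ℂ} (hF : Integrable F) :
    Filter.Tendsto (fun i => ∫ x, ‖(mollify (φ i) F) x - F x‖) l (nhds 0) := by
  rw [Metric.tendsto_nhds]
  intro η hη
  -- Mollification contracts L¹, so this approximation error enters twice, mollified and
  -- unmollified; with the error for `c` the total stays below three quarters of η.
  obtain ⟨c, hcs, hcF, hc, hci⟩ := hF.exists_hasCompactSupport_integral_sub_le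
    (show 0 < η / 4 by positivity)
  have h1 := tendsto_integral_norm_mollify_sub_of_continuous hφ hc hcs
  filter_upwards [h1.eventually (gt_mem_nhds (show 0 < η / 4 by positivity))] with i hi
  rw [Real.dist_eq, sub_zero, abs_of_nonneg (integral_nonneg fun x => norm_nonneg _)]
  have he : Integrable (F - c) := hF.sub hci
  have hsplit : ∀ x, ‖(mollify (φ i) F) x - F x‖ ≤
      ‖(mollify (φ i) (F - c)) x‖ + ‖(mollify (φ i) c) x - c x‖ + ‖F x - c x‖ := by
    intro x
    have hadd : (mollify (φ i) F) x = (mollify (φ i) (F - c)) x + (mollify (φ i) c) x := by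
      have := (mollify_convolutionExists (φ i) he.locallyIntegrable x).distrib_add
        (mollify_convolutionExists (φ i) hci.locallyIntegrable x)
      rw [sub_add_cancel] at this
      exact this
    rw [hadd]
    calc _ = ‖(mollify (φ i) (F - c)) x + ((mollify (φ i) c) x - c x) - (F x - c x)‖ := by
          congr 1; ring
      _ ≤ _ := (norm_sub_le _ _).trans (by gcongr; exact norm_add_le _ _)
  have i1 := (integrable_mollify (φ i) he).norm
  have i2 := ((integrable_mollify (φ i) hci).sub hci).norm
  have i3 := he.norm
  have h2 := integral_norm_mollify_le (φ i) he
  calc ∫ x, ‖(mollify (φ i) F) x - F x‖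
      ≤ ∫ x, (‖(mollify (φ i) (F - c)) x‖ + ‖(mollify (φ i) c) x - c x‖ + ‖F x - c x‖) :=
        integral_mono ((integrable_mollify (φ i) hF).sub hF).norm ((i1.add i2).add i3) hsplit
    _ = (∫ x, ‖(mollify (φ i) (F - c)) x‖) + (∫ x, ‖(mollify (φ i) c) x - c x‖) +
        ∫ x, ‖F x - c x‖ := by
        have e1 := integral_add (i1.add i2) i3
        have e2 := integral_add i1 i2
        simp only [Pi.add_apply, Pi.sub_apply] at e1 e2
        rw [e1, e2]
    _ < η := by
        simp only [Pi.sub_apply] at h2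
        linarith

/-- Mollification commutes with weak differentiation away from the boundary. -/
theorem fderiv_mollify {Ω : Set (ℂ × ℂ)} {v : ℂ × ℂ} {f g : ℂ × ℂ → ℂ}
    (h : HasWeakDeriv Ω v f g) (ρ : ContDiffBump (0 : ℂ × ℂ)) {S : Set (ℂ × ℂ)}
    (hSm : MeasurableSet S) (hSΩ : S ⊆ Ω) (hfS : IntegrableOn f S) {x : ℂ × ℂ}
    (hx : Metric.closedBall x ρ.rOut ⊆ S) :
    fderiv ℝ (mollify ρ (S.indicator f)) x v = (mollify ρ (S.indicator g)) x := by
  have hfi : Integrable (S.indicator f) := hfS.integrable_indicator hSm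
  set r := ρ.normed volume with hr
  have hrc : ContDiff ℝ ∞ r := ρ.contDiff_normed
  have hrs : HasCompactSupport r := ρ.hasCompactSupport_normed
  have hd := hrs.hasFDerivAt_convolution_left (ContinuousLinearMap.lsmul ℝ ℝ)
    (hrc.of_le (by simp)) hfi.locallyIntegrable x (μ := volume)
  have hts : tsupport r = Metric.closedBall 0 ρ.rOut := ρ.tsupport_normed_eq
  have hzero : ∀ y, y ∉ S → r (x - y) = 0 ∧ fderiv ℝ r (x - y) = 0 := by
    intro y hy
    have : x - y ∉ tsupport r := by
      rw [hts]
      intro h'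
      refine hy (hx ?_)
      rw [Metric.mem_closedBall, dist_eq_norm, norm_sub_rev]
      simpa using h'
    exact ⟨image_eq_zero_of_notMem_tsupport this,
      image_eq_zero_of_notMem_tsupport fun h' => this (tsupport_fderiv_subset ℝ h')⟩
  -- The reflected mollifier centred at x is an admissible test function, because its supporting
  -- ball lies in S ⊆ Ω. Truncation to S makes f integrable and is invisible at x.
  set φ : ℂ × ℂ → ℝ := fun y => r (x - y) with hφ
  have hφc : ContDiff ℝ ∞ φ := hrc.comp (contDiff_const.sub contDiff_id)
  have hφt : tsupport φ ⊆ Metric.closedBall x ρ.rOut := by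
    refine closure_minimal (fun y hy => ?_) Metric.isClosed_closedBall
    by_contra hy'
    have : x - y ∉ tsupport r := by
      rw [hts]
      intro h'
      refine hy' ?_
      rw [Metric.mem_closedBall, dist_eq_norm, norm_sub_rev]
      simpa using h'
    exact hy (show r (x - y) = 0 from image_eq_zero_of_notMem_tsupport this)
  have hφs : HasCompactSupport φ :=
    HasCompactSupport.of_support_subset_isCompact (isCompact_closedBall x ρ.rOut)
      (subset_closure.trans hφt)
  have hφd : ∀ y, fderiv ℝ φ y v = -(fderiv ℝ r (x - y) v) := by
    intro y
    have h1 : HasFDerivAt r (fderiv ℝ r (x - y)) (x - y) :=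
      ((hrc.differentiable (by simp)) _).hasFDerivAt
    have h2 : HasFDerivAt (fun y : ℂ × ℂ => x - y) (-ContinuousLinearMap.id ℝ (ℂ × ℂ)) y :=
      (hasFDerivAt_id y).const_sub x
    have h3 := (h1.comp y h2).fderiv
    have h4 : fderiv ℝ φ y = (fderiv ℝ r (x - y)).comp (-ContinuousLinearMap.id ℝ (ℂ × ℂ)) := h3
    rw [h4]; simp
  have hw := h.2.2 φ hφc hφs (hφt.trans (hx.trans hSΩ))
  have hconv : ConvolutionExistsAt (fderiv ℝ r) (S.indicator f) x
      ((ContinuousLinearMap.lsmul ℝ ℝ : ℝ →L[ℝ] ℂ →L[ℝ] ℂ).precompL (ℂ × ℂ)) volume :=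
    (hrs.fderiv ℝ).convolutionExists_left _ (hrc.continuous_fderiv (by simp))
      hfi.locallyIntegrable x
  rw [show fderiv ℝ (mollify ρ (S.indicator f)) x = _ from hd.fderiv, convolution_eq_swap,
    ContinuousLinearMap.integral_apply hconv.integrable_swap]
  simp only [convolution_eq_swap, ContinuousLinearMap.precompL_apply,
    ContinuousLinearMap.lsmul_apply]
  have e1 : ∫ y, fderiv ℝ r (x - y) v • S.indicator f y =
      -∫ y in Ω, fderiv ℝ φ y v • f y := by
    rw [← integral_neg, ← setIntegral_eq_integral_of_forall_compl_eq_zero (s := Ω)]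
    · congr 1 with y
      rw [hφd, neg_smul, neg_neg]
      by_cases hy : y ∈ S
      · rw [indicator_of_mem hy]
      · rw [(hzero y hy).2]; simp
    · intro y hy
      rw [indicator_of_notMem fun h' => hy (hSΩ h'), smul_zero]
  have e2 : ∫ y, r (x - y) • S.indicator g y = ∫ y in Ω, φ y • g y := by
    rw [← setIntegral_eq_integral_of_forall_compl_eq_zero (s := Ω)]
    · congr 1 with y
      by_cases hy : y ∈ S
      · rw [indicator_of_mem hy]
      · rw [hφ]; simp only [(hzero y hy).1]; simp
    · intro y hy
      rw [indicator_of_notMem fun h' => hy (hSΩ h'), smul_zero]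
  rw [e1, e2, hw, neg_neg]

end Mollification

theorem norm_comp_le_of_fderiv_le {ψ : ℂ → ℂ} (hψ : ContDiff ℝ 1 ψ) {L : ℝ}
    (hL : ∀ ζ, ‖fderiv ℝ ψ ζ‖ ≤ L) (a b : ℂ) : ‖ψ a - ψ b‖ ≤ L * ‖a - b‖ :=
  Convex.norm_image_sub_le_of_norm_fderiv_le (𝕜 := ℝ) (s := univ)
    (fun x _ => (hψ.differentiable (by simp)) x) (fun x _ => hL x) convex_univ (mem_univ _)
    (mem_univ _)

/-- The chain rule for weak derivatives. -/
theorem HasWeakDeriv.comp {Ω : Set (ℂ × ℂ)} (hΩ : IsOpen Ω) {v : ℂ × ℂ} {f g : ℂ × ℂ → ℂ}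
    (h : HasWeakDeriv Ω v f g) {ψ : ℂ → ℂ} (hψ : ContDiff ℝ 1 ψ) {L : ℝ}
    (hL : ∀ ζ, ‖fderiv ℝ ψ ζ‖ ≤ L) :
    HasWeakDeriv Ω v (fun x => ψ (f x)) (fun x => fderiv ℝ ψ (f x) (g x)) := by
  have hL0 : 0 ≤ L := (norm_nonneg _).trans (hL 0)
  have hψlip := norm_comp_le_of_fderiv_le hψ hL
  have hcont' : Continuous fun p : ℂ × ℂ => fderiv ℝ ψ p.1 p.2 :=
    ((hψ.continuous_fderiv (by simp)).comp continuous_fst).clm_apply continuous_snd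
  have hint1 : ∀ K ⊆ Ω, IsCompact K → IntegrableOn (fun x => ψ (f x)) K := by
    intro K hK hKc
    have hfK := h.1.integrableOn_compact_subset hK hKc
    have : Integrable (fun x => ‖ψ 0‖ + L * ‖f x‖) (volume.restrict K) :=
      (integrableOn_const hKc.measure_lt_top.ne).add (hfK.norm.const_mul L)
    refine Integrable.mono' this
      (hψ.continuous.comp_aestronglyMeasurable hfK.aestronglyMeasurable)
      (Filter.Eventually.of_forall fun x => ?_)
    have h1 := hψlip (f x) 0
    rw [sub_zero] at h1
    have h2 := norm_sub_norm_le (ψ (f x)) (ψ 0)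
    linarith
  have hint2 : ∀ K ⊆ Ω, IsCompact K → IntegrableOn (fun x => fderiv ℝ ψ (f x) (g x)) K := by
    intro K hK hKc
    have hfK := h.1.integrableOn_compact_subset hK hKc
    have hgK := h.2.1.integrableOn_compact_subset hK hKc
    refine Integrable.mono' (hgK.norm.const_mul L)
      (hcont'.comp_aestronglyMeasurable
        (hfK.aestronglyMeasurable.prodMk hgK.aestronglyMeasurable))
      (Filter.Eventually.of_forall fun x => ?_)
    exact (ContinuousLinearMap.le_opNorm _ _).trans (by gcongr; exact hL _)
  refine ⟨(locallyIntegrableOn_iff hΩ.isLocallyClosed).2 hint1,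
    (locallyIntegrableOn_iff hΩ.isLocallyClosed).2 hint2, fun φ hφc hφs hφt => ?_⟩
  set K := tsupport φ with hK
  obtain ⟨δ, hδ, hδΩ⟩ := (hφs.isCompact).exists_cthickening_subset_open hΩ hφt
  set S := Metric.cthickening δ K with hS
  have hSc : IsCompact S := hφs.isCompact.cthickening
  have hfS := h.1.integrableOn_compact_subset hδΩ hSc
  have hgS := h.2.1.integrableOn_compact_subset hδΩ hSc
  set F := S.indicator f with hF
  set G := S.indicator g with hG
  have hFi : Integrable F := hfS.integrable_indicator hSc.measurableSet
  have hGi : Integrable G := hgS.integrable_indicator hSc.measurableSet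
  -- Outer radii at most δ keep the mollification inside S; the fixed ratio 2 to the inner radius is
  -- what the almost everywhere convergence requires.
  let b : ℕ → ContDiffBump (0 : ℂ × ℂ) := fun i =>
    ⟨δ / (i + 1) / 2, δ / (i + 1), by positivity, half_lt_self (by positivity)⟩
  have hb0 : Filter.Tendsto (fun i => (b i).rOut) Filter.atTop (nhds 0) := by
    have := (tendsto_one_div_add_atTop_nhds_zero_nat (𝕜 := ℝ)).const_mul δ
    rw [mul_zero] at this
    refine this.congr fun i => ?_
    simp [b, div_eq_mul_inv]
  have hb2 : ∀ᶠ i in Filter.atTop, (b i).rOut ≤ 2 * (b i).rIn :=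
    Filter.Eventually.of_forall fun i => by simp only [b]; linarith
  let Fm : ℕ → ℂ × ℂ → ℂ := fun i =>
    mollify (b i) F
  let Gm : ℕ → ℂ × ℂ → ℂ := fun i =>
    mollify (b i) G
  have hFa : ∀ᵐ x, Filter.Tendsto (fun i => Fm i x) Filter.atTop (nhds (F x)) :=
    ContDiffBump.ae_convolution_tendsto_right_of_locallyIntegrable hb0 hb2 hFi.locallyIntegrable
  have hF1 := tendsto_integral_norm_mollify_sub hb0 hFi
  have hG1 := tendsto_integral_norm_mollify_sub hb0 hGi
  have hFc : ∀ i, ContDiff ℝ 1 (Fm i) := fun i =>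
    ((b i).hasCompactSupport_normed).contDiff_convolution_left _
      ((b i).contDiff_normed) hFi.locallyIntegrable
  have hFmi : ∀ i, Integrable (Fm i) := fun i => integrable_mollify (b i) hFi
  have hGmi : ∀ i, Integrable (Gm i) := fun i => integrable_mollify (b i) hGi
  have hrO : ∀ i, (b i).rOut ≤ δ := fun i => by
    simp only [b]
    exact div_le_self hδ.le (by linarith [(Nat.cast_nonneg i : (0 : ℝ) ≤ i)])
  have hder : ∀ i, ∀ x ∈ K, fderiv ℝ (Fm i) x v = Gm i x := fun i x hx =>
    fderiv_mollify h (b i) hSc.measurableSet hδΩ hfS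
      ((Metric.closedBall_subset_closedBall (hrO i)).trans
        (Metric.closedBall_subset_cthickening hx δ))
  have hφd0 : ∀ x, x ∉ K → fderiv ℝ φ x v = 0 := fun x hx => by
    rw [image_eq_zero_of_notMem_tsupport fun h' => hx (tsupport_fderiv_subset ℝ h')]; simp
  have hφ0 : ∀ x, x ∉ K → φ x = 0 := fun x hx => image_eq_zero_of_notMem_tsupport hx
  have hφ'c : Continuous fun x => fderiv ℝ φ x v := continuous_fderiv_dir hφc v
  have hφ's : HasCompactSupport fun x => fderiv ℝ φ x v := hφs.fderiv_apply ℝ v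
  obtain ⟨M, hM⟩ := hφ'c.bounded_above_of_compact_support hφ's
  obtain ⟨N, hN⟩ := hφc.continuous.bounded_above_of_compact_support hφs
  have hM0 : 0 ≤ M := (norm_nonneg _).trans (hM 0)
  have hN0 : 0 ≤ N := (norm_nonneg _).trans (hN 0)
  -- For mollifications the chain rule and integration by parts are classical. The derivative of `Fm
  -- i` is known to be `Gm i` only on K, which suffices since φ vanishes elsewhere.
  have hparts : ∀ i, ∫ x, fderiv ℝ φ x v • ψ (Fm i x) =
      -∫ x, φ x • fderiv ℝ ψ (Fm i x) (Gm i x) := by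
    intro i
    have hψF : ContDiff ℝ 1 (fun x => ψ (Fm i x)) := hψ.comp (hFc i)
    have hd : ∀ x, φ x • fderiv ℝ (fun x => ψ (Fm i x)) x v =
        φ x • fderiv ℝ ψ (Fm i x) (Gm i x) := by
      intro x
      by_cases hx : x ∈ K
      · have := fderiv_comp x ((hψ.differentiable (by simp)) (Fm i x))
          ((hFc i).differentiable (by simp) x)
        rw [show (fun x => ψ (Fm i x)) = ψ ∘ Fm i from rfl, this,
          ContinuousLinearMap.comp_apply, hder i x hx]
      · rw [hφ0 x hx, zero_smul, zero_smul]
    have := integral_smul_fderiv_eq_neg_fderiv_smul_of_integrable (μ := volume) (f := φ)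
      (g := fun x => ψ (Fm i x)) (v := v) ?_ ?_ ?_ ?_ ?_
    · simp only [hd] at this
      rw [this, neg_neg]
    · exact (hφ'c.smul hψF.continuous).integrable_of_hasCompactSupport hφ's.smul_right
    · exact (hφc.continuous.smul ((hψF.continuous_fderiv (by simp)).clm_apply
        continuous_const)).integrable_of_hasCompactSupport hφs.smul_right
    · exact (hφc.continuous.smul hψF.continuous).integrable_of_hasCompactSupport hφs.smul_right
    · exact fun x _ => (hφc.differentiable (by simp)) x
    · exact fun x _ => (hψF.differentiable (by simp)) x
  have hKS : K ⊆ S := Metric.self_subset_cthickening K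
  have hlhs : ∫ x in Ω, fderiv ℝ φ x v • ψ (f x) = ∫ x, fderiv ℝ φ x v • ψ (F x) := by
    rw [← setIntegral_eq_integral_of_forall_compl_eq_zero (s := Ω)
      (f := fun x => fderiv ℝ φ x v • ψ (F x))]
    · congr 1 with x
      by_cases hx : x ∈ K
      · rw [hF, indicator_of_mem (hKS hx)]
      · rw [hφd0 x hx, zero_smul, zero_smul]
    · intro x hx
      rw [hφd0 x fun h' => hx (hφt h'), zero_smul]
  have hrhs : ∫ x in Ω, φ x • fderiv ℝ ψ (f x) (g x) = ∫ x, φ x • fderiv ℝ ψ (F x) (G x) := by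
    rw [← setIntegral_eq_integral_of_forall_compl_eq_zero (s := Ω)
      (f := fun x => φ x • fderiv ℝ ψ (F x) (G x))]
    · congr 1 with x
      by_cases hx : x ∈ K
      · rw [hF, hG, indicator_of_mem (hKS hx), indicator_of_mem (hKS hx)]
      · rw [hφ0 x hx, zero_smul, zero_smul]
    · intro x hx
      rw [hφ0 x fun h' => hx (hφt h'), zero_smul]
  rw [hlhs, hrhs]
  have hloc : ∀ {H : ℂ × ℂ → ℂ}, Integrable H → LocallyIntegrable fun x => ψ (H x) := by
    intro H hH
    rw [locallyIntegrable_iff]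
    intro k hk
    refine Integrable.mono' ((integrableOn_const (C := ‖ψ 0‖) hk.measure_lt_top.ne).add
      (hH.norm.const_mul L).integrableOn)
      (hψ.continuous.comp_aestronglyMeasurable hH.aestronglyMeasurable.restrict)
      (Filter.Eventually.of_forall fun x => ?_)
    have h1 := hψlip (H x) 0
    rw [sub_zero] at h1
    have h2 := norm_sub_norm_le (ψ (H x)) (ψ 0)
    simp only [Pi.add_apply]
    linarith
  have htest : ∀ {u : ℂ × ℂ → ℝ} {H : ℂ × ℂ → ℂ}, Continuous u → HasCompactSupport u →
      LocallyIntegrable H → Integrable fun x => u x • H x := fun hu hs hH =>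
    hH.integrable_smul_left_of_hasCompactSupport hu hs
  have hlimL : Filter.Tendsto (fun i => ∫ x, fderiv ℝ φ x v • ψ (Fm i x)) Filter.atTop
      (nhds (∫ x, fderiv ℝ φ x v • ψ (F x))) := by
    rw [tendsto_iff_norm_sub_tendsto_zero]
    have hz := hF1.const_mul (M * L)
    rw [mul_zero] at hz
    refine squeeze_zero (fun i => norm_nonneg _) (fun i => ?_) hz
    rw [← integral_sub (htest hφ'c hφ's (hloc (hFmi i))) (htest hφ'c hφ's (hloc hFi)),
      ← integral_const_mul]
    refine norm_integral_le_of_norm_le (((hFmi i).sub hFi).norm.const_mul _)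
      (Filter.Eventually.of_forall fun x => ?_)
    rw [← smul_sub, norm_smul, mul_assoc]
    exact mul_le_mul (hM x) (hψlip _ _) (norm_nonneg _) hM0
  -- Two separate limits: replacing `Gm i` by G costs an L¹ error because the derivative of ψ is
  -- bounded, while the derivative of ψ at `Fm i` converges only almost everywhere and is treated by
  -- domination by a multiple of |G|.
  have hlimR : Filter.Tendsto (fun i => ∫ x, φ x • fderiv ℝ ψ (Fm i x) (Gm i x)) Filter.atTop
      (nhds (∫ x, φ x • fderiv ℝ ψ (F x) (G x))) := by
    have hDint : ∀ {A B : ℂ × ℂ → ℂ}, Integrable A → Integrable B →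
        Integrable fun x => φ x • fderiv ℝ ψ (A x) (B x) := by
      intro A B hA hB
      refine Integrable.mono' (hB.norm.const_mul (N * L))
        (hφc.continuous.aestronglyMeasurable.smul (hcont'.comp_aestronglyMeasurable
          (hA.aestronglyMeasurable.prodMk hB.aestronglyMeasurable)))
        (Filter.Eventually.of_forall fun x => ?_)
      rw [norm_smul, mul_assoc]
      refine mul_le_mul (hN x) ((ContinuousLinearMap.le_opNorm _ _).trans ?_) (norm_nonneg _) hN0
      gcongr; exact hL _
    have hmid : Filter.Tendsto (fun i => ∫ x, φ x • fderiv ℝ ψ (Fm i x) (G x)) Filter.atTop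
        (nhds (∫ x, φ x • fderiv ℝ ψ (F x) (G x))) := by
      refine tendsto_integral_of_dominated_convergence (fun x => N * L * ‖G x‖)
        (fun i => (hDint (hFmi i) hGi).aestronglyMeasurable) (hGi.norm.const_mul _)
        (fun i => Filter.Eventually.of_forall fun x => ?_) ?_
      · rw [norm_smul, mul_assoc]
        refine mul_le_mul (hN x) ((ContinuousLinearMap.le_opNorm _ _).trans ?_)
          (norm_nonneg _) hN0
        gcongr; exact hL _
      · filter_upwards [hFa] with x hx
        refine Filter.Tendsto.const_smul ?_ (φ x)
        have : Filter.Tendsto (fun i => (Fm i x, G x)) Filter.atTop (nhds (F x, G x)) :=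
          hx.prodMk_nhds tendsto_const_nhds
        exact (hcont'.tendsto (F x, G x)).comp this
    have hdiff : Filter.Tendsto (fun i => (∫ x, φ x • fderiv ℝ ψ (Fm i x) (Gm i x)) -
        ∫ x, φ x • fderiv ℝ ψ (Fm i x) (G x)) Filter.atTop (nhds 0) := by
      rw [tendsto_zero_iff_norm_tendsto_zero]
      have hz := hG1.const_mul (N * L)
      rw [mul_zero] at hz
      refine squeeze_zero (fun i => norm_nonneg _) (fun i => ?_) hz
      rw [← integral_sub (hDint (hFmi i) (hGmi i)) (hDint (hFmi i) hGi), ← integral_const_mul]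
      refine norm_integral_le_of_norm_le (((hGmi i).sub hGi).norm.const_mul _)
        (Filter.Eventually.of_forall fun x => ?_)
      rw [← smul_sub, ← map_sub, norm_smul, mul_assoc]
      refine mul_le_mul (hN x) ((ContinuousLinearMap.le_opNorm _ _).trans ?_) (norm_nonneg _) hN0
      gcongr
      exact hL _
    simpa using hdiff.add hmid
  exact tendsto_nhds_unique hlimL (by simpa only [hparts] using hlimR.neg)

theorem contDiff_of_forall_mem_tsupport {φ : ℂ × ℂ → ℝ}
    (h : ∀ x ∈ tsupport φ, ContDiffAt ℝ ∞ φ x) : ContDiff ℝ ∞ φ := by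
  rw [contDiff_iff_contDiffAt]
  intro x
  by_cases hx : x ∈ tsupport φ
  · exact h x hx
  · exact contDiffAt_const.congr_of_eventuallyEq (notMem_tsupport_iff_eventuallyEq.1 hx)

/-! ### Linear vector fields and cutoff functions -/

/-- The real vector field with coefficients `c` in the four coordinate directions. -/
noncomputable def coordField (c : Fin 4 → ℂ × ℂ →L[ℝ] ℝ) (x : ℂ × ℂ) : ℂ × ℂ :=
  ∑ j, c j x • realDir j

/-- Testing the j-th weak derivative with φ times the j-th coefficient and summing gives weak
differentiation along the field. The coefficients are linear, so the divergence is a constant. -/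
theorem HasWeakDeriv.coordField {Ω : Set (ℂ × ℂ)} {f : ℂ × ℂ → ℂ} {g : Fin 4 → ℂ × ℂ → ℂ}
    (h : ∀ j, HasWeakDeriv Ω (realDir j) f (g j)) (c : Fin 4 → ℂ × ℂ →L[ℝ] ℝ)
    {φ : ℂ × ℂ → ℝ} (h1 : ContDiff ℝ ∞ φ) (h2 : HasCompactSupport φ) (h3 : tsupport φ ⊆ Ω) :
    ∫ x in Ω, (fderiv ℝ φ x (coordField c x) + (∑ j, c j (realDir j)) * φ x) • f x =
      -∫ x in Ω, φ x • ∑ j, c j x • g j x := by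
  have hc : ∀ j, ContDiff ℝ ∞ (fun x => φ x * c j x) := fun j => h1.mul (c j).contDiff
  have hs : ∀ j, HasCompactSupport (fun x => φ x * c j x) := fun j => h2.mul_right
  have ht : ∀ j, tsupport (fun x => φ x * c j x) ⊆ Ω := fun j =>
    (tsupport_mul_subset_left).trans h3
  have hw := fun j => (h j).2.2 _ (hc j) (hs j) (ht j)
  have hd : ∀ j x, fderiv ℝ (fun x => φ x * c j x) x (realDir j) =
      c j x * fderiv ℝ φ x (realDir j) + c j (realDir j) * φ x := by
    intro j x
    have := (((h1.differentiable (by simp)) x).hasFDerivAt.mul (c j).hasFDerivAt).fderiv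
    rw [show (fun x => φ x * c j x) = φ * ⇑(c j) from rfl, this]
    simp only [add_apply, smul_apply, smul_eq_mul]
    ring
  have hi1 : ∀ j, Integrable (fun x => fderiv ℝ (fun x => φ x * c j x) x (realDir j) • f x)
      (lebesgueOn Ω) := fun j =>
    integrable_testMul (h j).1 (continuous_fderiv_dir (hc j) _) ((hs j).fderiv_apply ℝ _)
      ((tsupport_fderiv_apply_subset ℝ _).trans (ht j))
  have hi2 : ∀ j, Integrable (fun x => (φ x * c j x) • g j x) (lebesgueOn Ω) := fun j =>
    integrable_testMul (h j).2.1 (hc j).continuous (hs j) (ht j)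
  have e1 : ∀ x, (fderiv ℝ φ x (_root_.coordField c x) + (∑ j, c j (realDir j)) * φ x) • f x =
      ∑ j, fderiv ℝ (fun x => φ x * c j x) x (realDir j) • f x := by
    intro x
    rw [← Finset.sum_smul]
    simp only [hd, Finset.sum_add_distrib, Finset.sum_mul, _root_.coordField, map_sum, map_smul,
      smul_eq_mul]
  have e2 : ∀ x, φ x • ∑ j, c j x • g j x = ∑ j, (φ x * c j x) • g j x := by
    intro x
    rw [Finset.smul_sum]
    simp only [smul_smul]
  simp only [e1, e2]
  rw [integral_finsetSum _ fun j _ => hi1 j, integral_finsetSum _ fun j _ => hi2 j,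
    ← Finset.sum_neg_distrib]
  exact Finset.sum_congr rfl fun j _ => hw j

/-- `|z₂|^{2n} - |z₁|²`, a defining function for the singular part of the boundary. -/
noncomputable def defFun (n : ℕ) (z : ℂ × ℂ) : ℝ := (‖z.2‖ ^ 2) ^ n - ‖z.1‖ ^ 2

theorem contDiff_defFun (n : ℕ) : ContDiff ℝ ∞ (defFun n) := by
  unfold defFun
  exact ((contDiff_snd.norm_sq ℝ).pow n).sub (contDiff_fst.norm_sq ℝ)

theorem defFun_pos {n : ℕ} (hn : 1 ≤ n) {z : ℂ × ℂ} (hz : z ∈ thinHartogs n) :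
    0 < defFun n z := by
  have h := ((mem_thinHartogs hn).1 hz).1
  unfold defFun
  rw [← pow_mul, mul_comm, pow_mul, sub_pos]
  exact pow_lt_pow_left₀ h (norm_nonneg _) two_ne_zero

theorem mem_thinHartogs_of_defFun_pos {n : ℕ} (hn : 1 ≤ n) {z : ℂ × ℂ} (h1 : 0 < defFun n z)
    (h2 : ‖z.2‖ ^ 2 < 1) : z ∈ thinHartogs n := by
  unfold defFun at h1
  rw [← pow_mul, mul_comm, pow_mul, sub_pos] at h1
  exact (mem_thinHartogs hn).2 ⟨lt_of_pow_lt_pow_left₀ 2 (by positivity) h1,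
    by rwa [sq_lt_one_iff₀ (norm_nonneg _)] at h2⟩

/-- These closed conditions stay away from the whole boundary, the origin included, since `defFun`
is not positive where z₂ = 0. -/
theorem isCompact_defFun_ge {n : ℕ} (hn : 1 ≤ n) {a b : ℝ} (ha : 0 < a) (hb : b < 1) :
    IsCompact {z : ℂ × ℂ | a ≤ defFun n z ∧ ‖z.2‖ ^ 2 ≤ b} ∧
      {z : ℂ × ℂ | a ≤ defFun n z ∧ ‖z.2‖ ^ 2 ≤ b} ⊆ thinHartogs n := by
  have hsub : {z : ℂ × ℂ | a ≤ defFun n z ∧ ‖z.2‖ ^ 2 ≤ b} ⊆ thinHartogs n := fun z hz =>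
    mem_thinHartogs_of_defFun_pos hn (ha.trans_le hz.1) (hz.2.trans_lt hb)
  refine ⟨Metric.isCompact_of_isClosed_isBounded ?_ ?_, hsub⟩
  · exact (isClosed_le continuous_const (contDiff_defFun n).continuous).inter
      (isClosed_le (continuous_snd.norm.pow 2) continuous_const)
  · exact Metric.isBounded_ball.subset (hsub.trans (thinHartogs_subset_ball hn))

/-- Smooth cutoff functions exhausting the thin Hartogs triangle. -/
noncomputable def cutoff (n k : ℕ) (z : ℂ × ℂ) : ℝ :=
  Real.smoothTransition (k * defFun n z - 1) * Real.smoothTransition (k * (1 - ‖z.2‖ ^ 2) - 1)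

theorem contDiff_cutoff (n k : ℕ) : ContDiff ℝ ∞ (cutoff n k) := by
  unfold cutoff
  refine ContDiff.mul ?_ ?_
  · exact Real.smoothTransition.contDiff.comp
      ((contDiff_const.mul (contDiff_defFun n)).sub contDiff_const)
  · exact Real.smoothTransition.contDiff.comp
      ((contDiff_const.mul (contDiff_const.sub (contDiff_snd.norm_sq ℝ))).sub contDiff_const)

theorem cutoff_nonneg (n k : ℕ) (z : ℂ × ℂ) : 0 ≤ cutoff n k z :=
  mul_nonneg (Real.smoothTransition.nonneg _) (Real.smoothTransition.nonneg _)

theorem cutoff_le_one (n k : ℕ) (z : ℂ × ℂ) : cutoff n k z ≤ 1 :=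
  mul_le_one₀ (Real.smoothTransition.le_one _) (Real.smoothTransition.nonneg _)
    (Real.smoothTransition.le_one _)

theorem one_le_natCast_mul {k : ℕ} {s : ℝ} (h : 0 < Real.smoothTransition (k * s - 1)) :
    0 < (k : ℝ) ∧ (1 : ℝ) / k < s := by
  have h1 : 0 < k * s - 1 := by
    by_contra h'
    rw [Real.smoothTransition.zero_of_nonpos (not_lt.1 h')] at h
    exact lt_irrefl _ h
  have hk : (0 : ℝ) < k := by
    rcases Nat.eq_zero_or_pos k with rfl | hk
    · simp at h1; linarith
    · exact_mod_cast hk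
  refine ⟨hk, ?_⟩
  rw [div_lt_iff₀ hk]; linarith

theorem tsupport_cutoff_subset {n : ℕ} (hn : 1 ≤ n) (k : ℕ) :
    HasCompactSupport (cutoff n k) ∧ tsupport (cutoff n k) ⊆ thinHartogs n := by
  rcases Nat.eq_zero_or_pos k with rfl | hk
  · have : cutoff n 0 = 0 := by
      ext z; simp [cutoff, Real.smoothTransition.zero_of_nonpos]
    rw [this]
    exact ⟨HasCompactSupport.zero, by simp⟩
  have hk0 : (0 : ℝ) < k := by exact_mod_cast hk
  obtain ⟨hc, hs⟩ := isCompact_defFun_ge hn (a := 1 / k) (b := 1 - 1 / k) (by positivity)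
    (by have : (0 : ℝ) < 1 / k := by positivity
        linarith)
  have hsub : tsupport (cutoff n k) ⊆ {z : ℂ × ℂ | 1 / (k : ℝ) ≤ defFun n z ∧
      ‖z.2‖ ^ 2 ≤ 1 - 1 / k} := by
    refine closure_minimal (fun z hz => ?_) hc.isClosed
    have h1 := lt_of_le_of_ne (Real.smoothTransition.nonneg _) (Ne.symm (left_ne_zero_of_mul hz))
    have h2 := lt_of_le_of_ne (Real.smoothTransition.nonneg _) (Ne.symm (right_ne_zero_of_mul hz))
    have h3 := (one_le_natCast_mul h1).2
    have h4 := (one_le_natCast_mul h2).2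
    exact ⟨h3.le, by linarith⟩
  exact ⟨HasCompactSupport.of_support_subset_isCompact hc (subset_closure.trans hsub),
    hsub.trans hs⟩

theorem smoothTransition_mul_sub_eventually_one {s : ℝ} (hs : 0 < s) :
    ∀ᶠ k : ℕ in Filter.atTop, Real.smoothTransition (k * s - 1) = 1 := by
  filter_upwards [(tendsto_natCast_atTop_atTop (R := ℝ)).eventually_ge_atTop (2 / s)] with k hk
  refine Real.smoothTransition.one_of_one_le ?_
  rw [div_le_iff₀ hs] at hk
  linarith

theorem tendsto_cutoff {n : ℕ} (hn : 1 ≤ n) {z : ℂ × ℂ} (hz : z ∈ thinHartogs n) :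
    Filter.Tendsto (fun k => cutoff n k z) Filter.atTop (nhds 1) := by
  have hz2 := ((mem_thinHartogs hn).1 hz).2
  refine tendsto_const_nhds.congr' ?_
  filter_upwards [smoothTransition_mul_sub_eventually_one (defFun_pos hn hz),
    smoothTransition_mul_sub_eventually_one (s := 1 - ‖z.2‖ ^ 2)
      (by nlinarith [norm_nonneg z.2])] with k h1 h2
  rw [cutoff, h1, h2, one_mul]

/-! ### Rotations -/

/-- The coefficients of the generator of the rotations in the first variable. -/
noncomputable def rotOne : Fin 4 → ℂ × ℂ →L[ℝ] ℝ :=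
  ![-(Complex.imCLM.comp (ContinuousLinearMap.fst ℝ ℂ ℂ)),
    Complex.reCLM.comp (ContinuousLinearMap.fst ℝ ℂ ℂ), 0, 0]

/-- The coefficients of the generator of the rotations in the second variable. -/
noncomputable def rotTwo : Fin 4 → ℂ × ℂ →L[ℝ] ℝ :=
  ![0, 0, -(Complex.imCLM.comp (ContinuousLinearMap.snd ℝ ℂ ℂ)),
    Complex.reCLM.comp (ContinuousLinearMap.snd ℝ ℂ ℂ)]

theorem coordField_rotOne (x : ℂ × ℂ) : coordField rotOne x = (Complex.I * x.1, 0) := by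
  have h : -(x.1.im : ℂ) + x.1.re * Complex.I = Complex.I * x.1 := by
    apply Complex.ext <;> simp
  rw [← h]
  simp [coordField, rotOne, realDir, Fin.sum_univ_four]

theorem coordField_rotTwo (x : ℂ × ℂ) : coordField rotTwo x = (0, Complex.I * x.2) := by
  have h : -(x.2.im : ℂ) + x.2.re * Complex.I = Complex.I * x.2 := by
    apply Complex.ext <;> simp
  rw [← h]
  simp [coordField, rotTwo, realDir, Fin.sum_univ_four]

theorem div_rotOne : ∑ j, rotOne j (realDir j) = 0 := by
  simp [rotOne, realDir, Fin.sum_univ_four]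

theorem div_rotTwo : ∑ j, rotTwo j (realDir j) = 0 := by
  simp [rotTwo, realDir, Fin.sum_univ_four]

/-- Derivatives along the linear fields are computed through their explicit flows, hence as
derivatives in one real variable. -/
theorem fderiv_apply_of_comp_curve {E : Type*} [NormedAddCommGroup E] [NormedSpace ℝ E]
    {u : ℂ × ℂ → E} {x v : ℂ × ℂ} {d : E}
    (hu : DifferentiableAt ℝ u x) {γ : ℝ → ℂ × ℂ} (h0 : γ 0 = x) (hγ : HasDerivAt γ v 0)
    (hd : HasDerivAt (fun t => u (γ t)) d 0) : fderiv ℝ u x v = d := by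
  rw [← h0] at hu ⊢
  exact (hu.hasFDerivAt.comp_hasDerivAt 0 hγ).unique hd

theorem hasDerivAt_exp_mul (a : ℂ) (w : ℂ) :
    HasDerivAt (fun t : ℝ => Complex.exp (t * a) * w) (a * w) 0 := by
  have h1 : HasDerivAt (fun t : ℝ => (t : ℂ) * a) a 0 := by
    simpa using (Complex.ofRealCLM.hasDerivAt (x := (0 : ℝ))).mul_const a
  have h2 := (h1.cexp).mul_const w
  simpa using h2

/-- The cutoff depends on |z₁| and |z₂| alone, so it is constant along the flow. This is why no
boundary terms arise later. -/
theorem fderiv_cutoff_rotOne (n k : ℕ) (x : ℂ × ℂ) :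
    fderiv ℝ (cutoff n k) x (coordField rotOne x) = 0 := by
  rw [coordField_rotOne]
  refine fderiv_apply_of_comp_curve (γ := fun t => (Complex.exp (t * Complex.I) * x.1, x.2))
    ((contDiff_cutoff n k).differentiable (by simp) x) (by simp)
    ((hasDerivAt_exp_mul _ _).prodMk (hasDerivAt_const _ _)) ?_
  have : (fun t : ℝ => cutoff n k (Complex.exp (t * Complex.I) * x.1, x.2)) =
      fun _ => cutoff n k x := by
    ext t
    simp [cutoff, defFun, Complex.norm_exp_ofReal_mul_I]
  rw [this]
  exact hasDerivAt_const _ _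

theorem fderiv_cutoff_rotTwo (n k : ℕ) (x : ℂ × ℂ) :
    fderiv ℝ (cutoff n k) x (coordField rotTwo x) = 0 := by
  rw [coordField_rotTwo]
  refine fderiv_apply_of_comp_curve (γ := fun t => (x.1, Complex.exp (t * Complex.I) * x.2))
    ((contDiff_cutoff n k).differentiable (by simp) x) (by simp)
    ((hasDerivAt_const _ _).prodMk (hasDerivAt_exp_mul _ _)) ?_
  have : (fun t : ℝ => cutoff n k (x.1, Complex.exp (t * Complex.I) * x.2)) =
      fun _ => cutoff n k x := by
    ext t
    simp [cutoff, defFun, Complex.norm_exp_ofReal_mul_I]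
  rw [this]
  exact hasDerivAt_const _ _

/-- Integration by parts along a divergence free linear field preserving the cutoff functions;
no boundary terms appear. -/
theorem integral_fderiv_coordField_mul {n : ℕ} (hn : 1 ≤ n) {c : Fin 4 → ℂ × ℂ →L[ℝ] ℝ}
    (hdiv : ∑ j, c j (realDir j) = 0)
    (hcut : ∀ k x, fderiv ℝ (cutoff n k) x (coordField c x) = 0)
    {f : ℂ × ℂ → ℂ} {g : Fin 4 → ℂ × ℂ → ℂ}
    (h : ∀ j, HasWeakDeriv (thinHartogs n) (realDir j) f (g j)) {Φ : ℂ × ℂ → ℂ}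
    (hΦ : ContDiffOn ℝ ∞ Φ (thinHartogs n))
    (hi1 : Integrable (fun x => fderiv ℝ Φ x (coordField c x) * f x) (lebesgueOn (thinHartogs n)))
    (hi2 : Integrable (fun x => Φ x * ∑ j, c j x • g j x) (lebesgueOn (thinHartogs n))) :
    ∫ x in thinHartogs n, fderiv ℝ Φ x (coordField c x) * f x =
      -∫ x in thinHartogs n, Φ x * ∑ j, c j x • g j x := by
  have hΩ := isOpen_thinHartogs hn
  -- Test functions are real valued, so Φ enters through its real and imaginary parts. The field
  -- annihilates the cutoff, so the derivative falls on Φ alone.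
  have part : ∀ (L : ℂ →L[ℝ] ℝ) (k : ℕ),
      ∫ x in thinHartogs n, (cutoff n k x * L (fderiv ℝ Φ x (coordField c x))) • f x =
        -∫ x in thinHartogs n, (cutoff n k x * L (Φ x)) • ∑ j, c j x • g j x := by
    intro L k
    obtain ⟨hcs, hct⟩ := tsupport_cutoff_subset hn k
    set φ : ℂ × ℂ → ℝ := fun x => cutoff n k x * L (Φ x) with hφ
    have hts : tsupport φ ⊆ tsupport (cutoff n k) := tsupport_mul_subset_left
    have hLΦ : ∀ x ∈ thinHartogs n, ContDiffAt ℝ ∞ (fun x => L (Φ x)) x := fun x hx =>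
      L.contDiff.contDiffAt.comp x (hΦ.contDiffAt (hΩ.mem_nhds hx))
    have hφc : ContDiff ℝ ∞ φ := contDiff_of_forall_mem_tsupport fun x hx =>
      (contDiff_cutoff n k).contDiffAt.mul (hLΦ x (hct (hts hx)))
    have hφs : HasCompactSupport φ := hcs.mul_right
    have key := HasWeakDeriv.coordField h c hφc hφs (hts.trans hct)
    rw [hdiv] at key
    rw [← key]
    refine setIntegral_congr_fun hΩ.measurableSet fun x hx => ?_
    have hd : fderiv ℝ φ x (coordField c x) =
        cutoff n k x * L (fderiv ℝ Φ x (coordField c x)) := by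
      have h1 := (((contDiff_cutoff n k).differentiable (by simp) x).hasFDerivAt).mul
        ((L.hasFDerivAt).comp x ((hΦ.contDiffAt (hΩ.mem_nhds hx)).differentiableAt
          (by simp)).hasFDerivAt)
      rw [show fderiv ℝ φ x = _ from h1.fderiv]
      simp [hcut]
    rw [hd]; simp
  have hcm : ∀ k, AEStronglyMeasurable (fun x => ((cutoff n k x : ℝ) : ℂ))
      (lebesgueOn (thinHartogs n)) := fun k =>
    (Complex.continuous_ofReal.comp (contDiff_cutoff n k).continuous).aestronglyMeasurable
  have hcb : ∀ k x, ‖((cutoff n k x : ℝ) : ℂ)‖ ≤ 1 := fun k x => by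
    rw [Complex.norm_real, Real.norm_of_nonneg (cutoff_nonneg n k x)]
    exact cutoff_le_one n k x
  -- The cutoffs are bounded by 1 and tend to 1, so integrability of the two limiting integrands is
  -- all that is needed to remove them.
  have lim : ∀ {H : ℂ × ℂ → ℂ}, Integrable H (lebesgueOn (thinHartogs n)) →
      Filter.Tendsto (fun k => ∫ x in thinHartogs n, (cutoff n k x : ℂ) * H x) Filter.atTop
        (nhds (∫ x in thinHartogs n, H x)) := by
    intro H hH
    refine tendsto_integral_of_dominated_convergence (fun x => ‖H x‖)
      (fun k => (hcm k).mul hH.aestronglyMeasurable) hH.norm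
      (fun k => Filter.Eventually.of_forall fun x => ?_) ?_
    · rw [norm_mul]
      exact mul_le_of_le_one_left (norm_nonneg _) (hcb k x)
    · refine ae_restrict_of_forall_mem hΩ.measurableSet fun x hx => ?_
      have h1 := (Complex.continuous_ofReal.tendsto 1).comp (tendsto_cutoff hn hx)
      have h2 := h1.mul_const (H x)
      simpa using h2
  have hk : ∀ k, ∫ x in thinHartogs n, (cutoff n k x : ℂ) * (fderiv ℝ Φ x (coordField c x) * f x) =
      -∫ x in thinHartogs n, (cutoff n k x : ℂ) * (Φ x * ∑ j, c j x • g j x) := by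
    intro k
    obtain ⟨hcs, hct⟩ := tsupport_cutoff_subset hn k
    have hre := part Complex.reCLM k
    have him := part Complex.imCLM k
    have split : ∀ {A H : ℂ × ℂ → ℂ}, AEStronglyMeasurable A (lebesgueOn (thinHartogs n)) →
        AEStronglyMeasurable H (lebesgueOn (thinHartogs n)) →
        Integrable (fun x => A x * H x) (lebesgueOn (thinHartogs n)) →
        ∫ x in thinHartogs n, (cutoff n k x : ℂ) * (A x * H x) =
          (∫ x in thinHartogs n, (cutoff n k x * Complex.reCLM (A x)) • H x) +
          Complex.I * ∫ x in thinHartogs n, (cutoff n k x * Complex.imCLM (A x)) • H x := by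
      intro A H hAm hHm hAH
      have hb : ∀ L : ℂ →L[ℝ] ℝ, (∀ ζ, |L ζ| ≤ ‖ζ‖) →
          Integrable (fun x => (cutoff n k x * L (A x)) • H x) (lebesgueOn (thinHartogs n)) := by
        intro L hL
        refine Integrable.mono' hAH.norm
          (((contDiff_cutoff n k).continuous.aestronglyMeasurable.mul
            (L.continuous.comp_aestronglyMeasurable hAm)).smul hHm)
          (Filter.Eventually.of_forall fun x => ?_)
        rw [norm_smul, norm_mul, norm_mul, Real.norm_of_nonneg (cutoff_nonneg n k x),
          Real.norm_eq_abs]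
        gcongr
        calc cutoff n k x * |L (A x)| ≤ 1 * ‖A x‖ := by
              gcongr
              · exact cutoff_le_one n k x
              · exact hL _
          _ = ‖A x‖ := one_mul _
      rw [← integral_const_mul, ← integral_add (hb _ Complex.abs_re_le_norm)
        ((hb _ Complex.abs_im_le_norm).const_mul _)]
      congr 1 with x
      simp only [Complex.reCLM_apply, Complex.imCLM_apply, Complex.real_smul]
      push_cast
      linear_combination ((cutoff n k x : ℂ) * H x) * (Complex.re_add_im (A x)).symm
    have hfm : AEStronglyMeasurable f (lebesgueOn (thinHartogs n)) :=
      (h 0).1.aestronglyMeasurable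
    have hΦm : AEStronglyMeasurable Φ (lebesgueOn (thinHartogs n)) :=
      hΦ.continuousOn.aestronglyMeasurable hΩ.measurableSet
    have hgm : AEStronglyMeasurable (fun x => ∑ j, c j x • g j x) (lebesgueOn (thinHartogs n)) :=
      Finset.aestronglyMeasurable_fun_sum _ fun j _ =>
        (c j).continuous.aestronglyMeasurable.smul (h j).2.1.aestronglyMeasurable
    have hXc : Continuous (coordField c) := by
      unfold coordField; fun_prop
    have hDm : AEStronglyMeasurable (fun x => fderiv ℝ Φ x (coordField c x))
        (lebesgueOn (thinHartogs n)) :=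
      ((hΦ.continuousOn_fderiv_of_isOpen hΩ (by simp)).clm_apply
        hXc.continuousOn).aestronglyMeasurable hΩ.measurableSet
    rw [split hDm hfm hi1, split hΦm hgm hi2, hre, him]
    ring
  exact tendsto_nhds_unique (lim hi1) (by simpa only [hk] using (lim hi2).neg)

/-! ### A Hardy inequality -/

/-- The Forelli-Rudin integral at b = 0, after bounding 1 by (1-|w|²)^(-1/2). -/
theorem lintegral_ball_rpow_lt_top {κ : ℝ} (hκ : -2 < κ) :
    ∫⁻ w in Metric.ball (0 : ℂ) 1, ENNReal.ofReal (‖w‖ ^ κ) < ⊤ := by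
  obtain ⟨C, -, hC⟩ := exists_lintegral_forelliRudin_le hκ (ε := 1 / 2) (by norm_num) (by norm_num)
  refine lt_of_le_of_lt ?_ ((hC 0 (by simp)).trans_lt ENNReal.ofReal_lt_top)
  refine setLIntegral_mono (by fun_prop) fun w hw => ENNReal.ofReal_le_ofReal ?_
  have h1 : ‖w‖ < 1 := by simpa using hw
  have h2 : 0 < 1 - ‖w‖ ^ 2 := by nlinarith [norm_nonneg w]
  have h3 : 1 ≤ (1 - ‖w‖ ^ 2) ^ (-(1 / 2 : ℝ)) :=
    Real.one_le_rpow_of_pos_of_le_one_of_nonpos h2 (by nlinarith [norm_nonneg w]) (by norm_num)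
  have h4 : 0 ≤ ‖w‖ ^ κ := by positivity
  simp only [zero_mul, sub_zero, norm_one, one_pow, inv_one, mul_one]
  nlinarith

/-- The fibre area π|w₂|²ⁿ raises the exponent to s + 2n, which must exceed -2 in the plane. -/
theorem lintegral_norm_snd_rpow_lt_top {n : ℕ} (hn : 1 ≤ n) {s : ℝ} (hs : -(2 * n + 2) < s) :
    ∫⁻ w in thinHartogs n, ENNReal.ofReal (‖w.2‖ ^ s) < ⊤ := by
  rw [setLIntegral_thinHartogs hn (by fun_prop)]
  have h : ∀ w₂ ∈ Metric.ball (0 : ℂ) 1,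
      ∫⁻ _ in Metric.ball (0 : ℂ) (‖w₂‖ ^ n), ENNReal.ofReal (‖w₂‖ ^ s) ≤
        NNReal.pi * ENNReal.ofReal (‖w₂‖ ^ (s + 2 * n)) := by
    intro w₂ _
    rw [setLIntegral_const, Complex.volume_ball, ← mul_assoc, mul_comm _ (NNReal.pi : ℝ≥0∞),
      ← ENNReal.ofReal_pow (by positivity), ← ENNReal.ofReal_mul (by positivity)]
    gcongr
    rcases eq_or_ne ‖w₂‖ 0 with h0 | h0
    · rw [h0, zero_pow (by omega), zero_pow two_ne_zero, mul_zero]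
      positivity
    · have hpos : 0 < ‖w₂‖ := lt_of_le_of_ne (norm_nonneg _) (Ne.symm h0)
      rw [Real.rpow_add hpos, ← pow_mul, ← Real.rpow_natCast]
      push_cast
      rw [mul_comm (n : ℝ) 2]
  refine (setLIntegral_mono (by fun_prop) h).trans_lt ?_
  rw [lintegral_const_mul _ (by fun_prop)]
  exact ENNReal.mul_lt_top ENNReal.coe_lt_top (lintegral_ball_rpow_lt_top (by linarith))

/-- The coefficients of the weighted Euler field `n z₁ ∂₁ + z₂ ∂₂`. -/
noncomputable def eulerField (n : ℕ) : Fin 4 → ℂ × ℂ →L[ℝ] ℝ :=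
  ![(n : ℝ) • Complex.reCLM.comp (ContinuousLinearMap.fst ℝ ℂ ℂ),
    (n : ℝ) • Complex.imCLM.comp (ContinuousLinearMap.fst ℝ ℂ ℂ),
    Complex.reCLM.comp (ContinuousLinearMap.snd ℝ ℂ ℂ),
    Complex.imCLM.comp (ContinuousLinearMap.snd ℝ ℂ ℂ)]

theorem coordField_eulerField (n : ℕ) (x : ℂ × ℂ) :
    coordField (eulerField n) x = (n * x.1, x.2) := by
  have h1 : (n : ℂ) * x.1.re + n * x.1.im * Complex.I = n * x.1 := by
    apply Complex.ext <;> simp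
  have h2 : (x.2.re : ℂ) + x.2.im * Complex.I = x.2 := Complex.re_add_im _
  rw [← h1]
  conv_rhs => rw [← h2]
  simp [coordField, eulerField, realDir, Fin.sum_univ_four]

theorem div_eulerField (n : ℕ) : ∑ j, eulerField n j (realDir j) = 2 * n + 2 := by
  simp [eulerField, realDir, Fin.sum_univ_four]; ring

theorem abs_eulerField_le {n : ℕ} (hn : 1 ≤ n) {x : ℂ × ℂ} (hx : x ∈ thinHartogs n) (j : Fin 4) :
    |eulerField n j x| ≤ n * ‖x.2‖ := by
  have h := (mem_thinHartogs hn).1 hx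
  have h1 : ‖x.1‖ ≤ ‖x.2‖ := h.1.le.trans (pow_le_of_le_one (norm_nonneg _) h.2.le (by omega))
  have hn1 : (1 : ℝ) ≤ n := by exact_mod_cast hn
  have hr1 := Complex.abs_re_le_norm x.1
  have hi1 := Complex.abs_im_le_norm x.1
  have hr2 := Complex.abs_re_le_norm x.2
  have hi2 := Complex.abs_im_le_norm x.2
  fin_cases j <;> simp only [eulerField, Fin.mk_zero, Fin.mk_one, Fin.reduceFinMk, Matrix.cons_val,
    smul_apply, ContinuousLinearMap.comp_apply, smul_eq_mul,
    Complex.reCLM_apply, Complex.imCLM_apply, abs_mul, Nat.abs_cast, ContinuousLinearMap.coe_fst',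
    ContinuousLinearMap.coe_snd']
  · gcongr; linarith
  · gcongr; linarith
  · nlinarith [abs_nonneg x.2.re]
  · nlinarith [abs_nonneg x.2.im]

/-- Test functions for the Hardy inequality. -/
noncomputable def hardyTest (n k : ℕ) (z : ℂ × ℂ) : ℝ :=
  Real.smoothTransition (k * defFun n z - 1) *
    (Real.smoothTransition (3 - 4 * ‖z.2‖ ^ 2) * (‖z.2‖ ^ n)⁻¹)

theorem hardyTest_nonneg (n k : ℕ) (z : ℂ × ℂ) : 0 ≤ hardyTest n k z :=
  mul_nonneg (Real.smoothTransition.nonneg _)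
    (mul_nonneg (Real.smoothTransition.nonneg _) (by positivity))

theorem hardyTest_le (n k : ℕ) (z : ℂ × ℂ) : hardyTest n k z ≤ (‖z.2‖ ^ n)⁻¹ := by
  have h : (0 : ℝ) ≤ (‖z.2‖ ^ n)⁻¹ := by positivity
  refine (mul_le_of_le_one_left (mul_nonneg (Real.smoothTransition.nonneg _) h)
    (Real.smoothTransition.le_one _)).trans ?_
  exact mul_le_of_le_one_left h (Real.smoothTransition.le_one _)

theorem tsupport_hardyTest_subset {n : ℕ} (hn : 1 ≤ n) (k : ℕ) :
    HasCompactSupport (hardyTest n k) ∧ tsupport (hardyTest n k) ⊆ thinHartogs n := by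
  rcases Nat.eq_zero_or_pos k with rfl | hk
  · have : hardyTest n 0 = 0 := by
      ext z; simp [hardyTest, Real.smoothTransition.zero_of_nonpos]
    rw [this]
    exact ⟨HasCompactSupport.zero, by simp⟩
  have hk0 : (0 : ℝ) < k := by exact_mod_cast hk
  obtain ⟨hc, hs⟩ := isCompact_defFun_ge hn (a := 1 / k) (b := 3 / 4) (by positivity) (by norm_num)
  have hsub : tsupport (hardyTest n k) ⊆ {z : ℂ × ℂ | 1 / (k : ℝ) ≤ defFun n z ∧
      ‖z.2‖ ^ 2 ≤ 3 / 4} := by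
    refine closure_minimal (fun z hz => ?_) hc.isClosed
    have h1 := lt_of_le_of_ne (Real.smoothTransition.nonneg _) (Ne.symm (left_ne_zero_of_mul hz))
    have h2 := left_ne_zero_of_mul (right_ne_zero_of_mul hz)
    refine ⟨(one_le_natCast_mul h1).2.le, ?_⟩
    by_contra h3
    exact h2 (Real.smoothTransition.zero_of_nonpos (by linarith [not_le.1 h3]))
  exact ⟨HasCompactSupport.of_support_subset_isCompact hc (subset_closure.trans hsub),
    hsub.trans hs⟩

theorem contDiff_hardyTest {n : ℕ} (hn : 1 ≤ n) (k : ℕ) : ContDiff ℝ ∞ (hardyTest n k) := by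
  refine contDiff_of_forall_mem_tsupport fun z hz => ?_
  have hz' := (tsupport_hardyTest_subset hn k).2 hz
  have hz2 : z.2 ≠ 0 := norm_pos_iff.1 (norm_snd_pos hz')
  unfold hardyTest
  refine ContDiffAt.mul ?_ (ContDiffAt.mul ?_ ?_)
  · exact (Real.smoothTransition.contDiff.comp
      ((contDiff_const.mul (contDiff_defFun n)).sub contDiff_const)).contDiffAt
  · exact (Real.smoothTransition.contDiff.comp
      (contDiff_const.sub (contDiff_const.mul (contDiff_snd.norm_sq ℝ)))).contDiffAt
  · exact (((contDiffAt_norm ℝ hz2).comp z contDiffAt_snd).pow n).inv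
      (pow_ne_zero n (norm_ne_zero_iff.2 hz2))

/-- The interval is the range of 3 - 4t for 0 ≤ t ≤ 1, the argument of the outer cutoff in
`hardyTest`. -/
theorem exists_abs_deriv_smoothTransition_le :
    ∃ B : ℝ, 0 ≤ B ∧ ∀ s ∈ Icc (-1 : ℝ) 3, |deriv Real.smoothTransition s| ≤ B := by
  have hc : Continuous (deriv Real.smoothTransition) :=
    (Real.smoothTransition.contDiff (n := 1)).continuous_deriv le_rfl
  obtain ⟨B, hB⟩ := isCompact_Icc.exists_bound_of_continuousOn (s := Icc (-1 : ℝ) 3)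
    hc.continuousOn
  exact ⟨max B 0, le_max_right _ _, fun s hs => (hB s hs).trans (le_max_left _ _)⟩

/-- `defFun` is homogeneous of degree 2n under the Euler flow, so the inner cutoff increases along
it and its derivative can be dropped by sign, uniformly in k. The weight |z₂|⁻ⁿ contributes -n,
leaving n+2 out of the divergence 2n+2. The outer cutoff varies only where |z₂|² ≥ 1/2: there the
weight is at most 2ⁿ and 4|z₂|² has flow derivative at most 8, which is the error term. -/
theorem hardyTest_fderiv_ge {n : ℕ} (hn : 1 ≤ n) {B : ℝ} (hB0 : 0 ≤ B)
    (hB : ∀ s ∈ Icc (-1 : ℝ) 3, |deriv Real.smoothTransition s| ≤ B) (k : ℕ) {x : ℂ × ℂ}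
    (hx : x ∈ thinHartogs n) :
    (n + 2) * hardyTest n k x - 8 * B * 2 ^ n ≤
      fderiv ℝ (hardyTest n k) x (coordField (eulerField n) x) + (2 * n + 2) * hardyTest n k x := by
  have hxΩ := (mem_thinHartogs hn).1 hx
  have hx2 := norm_snd_pos hx
  have hstd : ∀ s, HasDerivAt Real.smoothTransition (deriv Real.smoothTransition s) s := fun s =>
    ((Real.smoothTransition.contDiff (n := 1)).differentiable (by simp) s).hasDerivAt
  set q := defFun n x with hq
  have hqpos : 0 < q := defFun_pos hn hx
  set s₀ : ℝ := 3 - 4 * ‖x.2‖ ^ 2 with hs₀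
  set d₁ := deriv Real.smoothTransition (k * q - 1) with hd₁
  set d₂ := deriv Real.smoothTransition s₀ with hd₂
  set θ := Real.smoothTransition (k * q - 1) with hθ
  set χ := Real.smoothTransition s₀ with hχ
  set ρ := (‖x.2‖ ^ n)⁻¹ with hρ
  have hexp : ∀ a : ℝ, HasDerivAt (fun t : ℝ => Real.exp (t * a)) a 0 := by
    intro a
    have := ((hasDerivAt_id (0 : ℝ)).mul_const a).exp
    simpa using this
  have hfd : fderiv ℝ (hardyTest n k) x (coordField (eulerField n) x) =
      d₁ * (k * (2 * n * q)) * (χ * ρ) + θ * (d₂ * (-(4 * (2 * ‖x.2‖ ^ 2))) * ρ + χ * (-n * ρ)) := by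
    rw [coordField_eulerField]
    refine fderiv_apply_of_comp_curve (γ := fun t : ℝ =>
      (Complex.exp (t * n) * x.1, Complex.exp (t * 1) * x.2))
      ((contDiff_hardyTest hn k).differentiable (by simp) x) (by simp)
      ((hasDerivAt_exp_mul _ _).prodMk (by simpa using hasDerivAt_exp_mul 1 x.2)) ?_
    have hcurve : (fun t : ℝ => hardyTest n k
        (Complex.exp (t * n) * x.1, Complex.exp (t * 1) * x.2)) = fun t =>
        Real.smoothTransition (k * (Real.exp (t * (2 * n)) * q) - 1) *
          (Real.smoothTransition (3 - 4 * (Real.exp (t * 2) * ‖x.2‖ ^ 2)) *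
            (Real.exp (t * (-n)) * ρ)) := by
      ext t
      have e1 : ‖Complex.exp (t * n) * x.1‖ = Real.exp (t * n) * ‖x.1‖ := by
        rw [norm_mul, Complex.norm_exp]; simp
      have e2 : ‖Complex.exp (t * 1) * x.2‖ = Real.exp t * ‖x.2‖ := by
        rw [norm_mul, Complex.norm_exp]; simp
      have e3 : Real.exp (t * (2 * n)) = Real.exp t ^ (2 * n) := by
        rw [← Real.exp_nat_mul]; push_cast; ring_nf
      have e4 : Real.exp (t * n) = Real.exp t ^ n := by
        rw [← Real.exp_nat_mul]; ring_nf
      have e5 : Real.exp (t * 2) = Real.exp t ^ 2 := by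
        rw [← Real.exp_nat_mul]; push_cast; ring_nf
      have e6 : Real.exp (t * (-n)) = (Real.exp t ^ n)⁻¹ := by
        rw [mul_neg, Real.exp_neg, e4]
      simp only [hardyTest, defFun, hq, hρ]
      rw [e1, e2, e3, e4, e5, e6, mul_pow, mul_pow, mul_pow, mul_pow, ← pow_mul, ← pow_mul,
        mul_inv, pow_mul', ← mul_sub]
    rw [hcurve]
    have h1 : HasDerivAt (fun t : ℝ => k * (Real.exp (t * (2 * n)) * q) - 1)
        (k * (2 * n * q)) 0 := (((hexp (2 * n)).mul_const q).const_mul (k : ℝ)).sub_const 1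
    have h2 : HasDerivAt (fun t : ℝ => 3 - 4 * (Real.exp (t * 2) * ‖x.2‖ ^ 2))
        (-(4 * (2 * ‖x.2‖ ^ 2))) 0 :=
      (((hexp 2).mul_const (‖x.2‖ ^ 2)).const_mul (4 : ℝ)).const_sub 3
    have h3 : HasDerivAt (fun t : ℝ => Real.exp (t * (-n)) * ρ) (-n * ρ) 0 :=
      (hexp (-n)).mul_const ρ
    have h4 := HasDerivAt.comp (0 : ℝ) (hstd (k * (Real.exp (0 * (2 * n)) * q) - 1)) h1
    have h5 := HasDerivAt.comp (0 : ℝ) (hstd (3 - 4 * (Real.exp (0 * 2) * ‖x.2‖ ^ 2))) h2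
    have h6 := h4.mul (h5.mul h3)
    simp only [Function.comp, Pi.mul_apply, zero_mul, Real.exp_zero, one_mul] at h6
    exact h6
  have hd₁0 : 0 ≤ d₁ := Real.smoothTransition.monotone.deriv_nonneg
  have hθ0 : 0 ≤ θ := Real.smoothTransition.nonneg _
  have hθ1 : θ ≤ 1 := Real.smoothTransition.le_one _
  have hχ0 : 0 ≤ χ := Real.smoothTransition.nonneg _
  have hρ0 : 0 ≤ ρ := by positivity
  have hsq : ‖x.2‖ ^ 2 ≤ 1 := pow_le_one₀ (norm_nonneg _) hxΩ.2.le
  have hK : |d₂| * ρ ≤ B * 2 ^ n := by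
    rcases lt_or_ge (‖x.2‖ ^ 2) (1 / 2) with h | h
    · have : d₂ = 0 := by
        have hev : Real.smoothTransition =ᶠ[nhds s₀] fun _ => 1 := by
          filter_upwards [lt_mem_nhds (show 1 < s₀ by rw [hs₀]; linarith)] with s hs
          exact Real.smoothTransition.one_of_one_le hs.le
        rw [hd₂, hev.deriv_eq]; simp
      rw [this, abs_zero, zero_mul]; positivity
    · have h1 : |d₂| ≤ B := hB s₀ ⟨by rw [hs₀]; linarith, by rw [hs₀]; nlinarith [norm_nonneg x.2]⟩
      have h2 : (1 / 2 : ℝ) ≤ ‖x.2‖ := by nlinarith [hxΩ.2]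
      have h3 : ρ ≤ 2 ^ n := by
        rw [hρ, ← inv_pow]
        refine pow_le_pow_left₀ (by positivity) ?_ n
        rw [inv_le_comm₀ hx2 two_pos]; linarith
      gcongr
  have hmain : -(8 * B * 2 ^ n) ≤ θ * (d₂ * (-(4 * (2 * ‖x.2‖ ^ 2))) * ρ) := by
    have h1 : |θ * (d₂ * (-(4 * (2 * ‖x.2‖ ^ 2))) * ρ)| = θ * (8 * ‖x.2‖ ^ 2) * (|d₂| * ρ) := by
      rw [abs_mul, abs_mul, abs_mul, abs_neg, abs_of_nonneg hθ0, abs_of_nonneg hρ0,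
        abs_of_nonneg (show 0 ≤ 4 * (2 * ‖x.2‖ ^ 2) by positivity)]
      ring
    have h2 : θ * (8 * ‖x.2‖ ^ 2) ≤ 8 := by nlinarith [sq_nonneg ‖x.2‖]
    have h3 : θ * (8 * ‖x.2‖ ^ 2) * (|d₂| * ρ) ≤ 8 * (B * 2 ^ n) := by
      gcongr
    have h4 := neg_abs_le (θ * (d₂ * (-(4 * (2 * ‖x.2‖ ^ 2))) * ρ))
    rw [h1] at h4
    linarith
  have hnn : 0 ≤ d₁ * (k * (2 * n * q)) * (χ * ρ) := by positivity
  have hT : hardyTest n k x = θ * (χ * ρ) := rfl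
  rw [hfd, hT]
  nlinarith

theorem tendsto_hardyTest {n : ℕ} (hn : 1 ≤ n) {z : ℂ × ℂ} (hz : z ∈ thinHartogs n) :
    Filter.Tendsto (fun k => hardyTest n k z) Filter.atTop
      (nhds (Real.smoothTransition (3 - 4 * ‖z.2‖ ^ 2) * (‖z.2‖ ^ n)⁻¹)) := by
  refine tendsto_const_nhds.congr' ?_
  filter_upwards [smoothTransition_mul_sub_eventually_one (defFun_pos hn hz)] with k h1
  rw [hardyTest, h1, one_mul]

/-- The smooth function `√(1 + |ζ|²)`. -/
noncomputable def japaneseBracket (ζ : ℂ) : ℝ := Real.sqrt (1 + ‖ζ‖ ^ 2)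

theorem norm_le_japaneseBracket (ζ : ℂ) : ‖ζ‖ ≤ japaneseBracket ζ :=
  Real.le_sqrt_of_sq_le (by linarith)

theorem japaneseBracket_le (ζ : ℂ) : japaneseBracket ζ ≤ 1 + ‖ζ‖ := by
  rw [japaneseBracket, Real.sqrt_le_left (by positivity)]
  nlinarith [norm_nonneg ζ]

theorem contDiff_japaneseBracket : ContDiff ℝ 1 fun ζ => (japaneseBracket ζ : ℂ) := by
  refine Complex.ofRealCLM.contDiff.comp ?_
  exact (contDiff_const.add (contDiff_id.norm_sq ℝ)).sqrt fun ζ => by positivity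

/-- The bracket is the Euclidean norm of (1, ζ), hence 1-Lipschitz; `hab` is the Cauchy-Schwarz
inequality for these vectors. -/
theorem norm_fderiv_japaneseBracket_le (ζ : ℂ) :
    ‖fderiv ℝ (fun ζ => (japaneseBracket ζ : ℂ)) ζ‖ ≤ 1 := by
  have hlip : LipschitzWith 1 fun ζ => (japaneseBracket ζ : ℂ) := by
    refine LipschitzWith.of_dist_le_mul fun a b => ?_
    rw [NNReal.coe_one, one_mul, dist_eq_norm, dist_eq_norm, ← Complex.ofReal_sub,
      Complex.norm_real, Real.norm_eq_abs]
    have ha := Real.sq_sqrt (show 0 ≤ 1 + ‖a‖ ^ 2 by positivity)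
    have hb := Real.sq_sqrt (show 0 ≤ 1 + ‖b‖ ^ 2 by positivity)
    have h1 := abs_norm_sub_norm_le a b
    refine le_trans ?_ h1
    rw [← sq_le_sq]
    unfold japaneseBracket
    have hab : 1 + ‖a‖ * ‖b‖ ≤ Real.sqrt (1 + ‖a‖ ^ 2) * Real.sqrt (1 + ‖b‖ ^ 2) := by
      rw [← Real.sqrt_mul (by positivity)]
      refine Real.le_sqrt_of_sq_le ?_
      nlinarith [sq_nonneg (‖a‖ - ‖b‖)]
    nlinarith
  exact norm_fderiv_le_of_lipschitz ℝ hlip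

/-- An `L¹` Hardy inequality at the singular point of the thin Hartogs triangle. -/
theorem integrable_inv_norm_snd_pow_mul {n : ℕ} (hn : 1 ≤ n) {f : ℂ × ℂ → ℂ}
    {g : Fin 4 → ℂ × ℂ → ℂ} (h : ∀ j, HasWeakDeriv (thinHartogs n) (realDir j) f (g j))
    (hf : Integrable f (lebesgueOn (thinHartogs n)))
    (hg : ∀ j, Integrable (fun w => (‖w.2‖ ^ n)⁻¹ * ‖w.2‖ * ‖g j w‖) (lebesgueOn (thinHartogs n))) :
    Integrable (fun w => (‖w.2‖ ^ n)⁻¹ * ‖f w‖) (lebesgueOn (thinHartogs n)) := by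
  have hΩ := isOpen_thinHartogs hn
  have hfin := isFiniteMeasure_lebesgueOn hn
  -- The chain rule needs a C¹ function, which |ζ| is not at 0. The bracket dominates |f|, is
  -- nonnegative, and has weak derivatives no larger than those of f.
  set u : ℂ × ℂ → ℝ := fun w => japaneseBracket (f w) with hu
  have hu0 : ∀ w, 0 ≤ u w := fun w => (norm_nonneg _).trans (norm_le_japaneseBracket _)
  have hjc : Continuous japaneseBracket := by unfold japaneseBracket; fun_prop
  have hui : Integrable u (lebesgueOn (thinHartogs n)) := by
    refine Integrable.mono' ((integrable_const 1).add hf.norm)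
      (hjc.comp_aestronglyMeasurable hf.aestronglyMeasurable)
      (Filter.Eventually.of_forall fun w => ?_)
    rw [Real.norm_of_nonneg (hu0 w)]
    exact japaneseBracket_le _
  set U : Fin 4 → ℂ × ℂ → ℂ := fun j w =>
    fderiv ℝ (fun ζ => (japaneseBracket ζ : ℂ)) (f w) (g j w) with hU
  have hw : ∀ j, HasWeakDeriv (thinHartogs n) (realDir j) (fun w => (u w : ℂ)) (U j) := fun j =>
    (h j).comp hΩ contDiff_japaneseBracket norm_fderiv_japaneseBracket_le
  have hUg : ∀ j w, ‖U j w‖ ≤ ‖g j w‖ := fun j w => by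
    refine (ContinuousLinearMap.le_opNorm _ _).trans ?_
    exact mul_le_of_le_one_left (norm_nonneg _) (norm_fderiv_japaneseBracket_le _)
  obtain ⟨B, hB0, hB⟩ := exists_abs_deriv_smoothTransition_le
  set G : ℂ × ℂ → ℝ := fun w => ∑ j, n * ((‖w.2‖ ^ n)⁻¹ * ‖w.2‖ * ‖g j w‖) with hG
  have hGi : Integrable G (lebesgueOn (thinHartogs n)) :=
    integrable_finsetSum _ fun j _ => (hg j).const_mul _
  set A : ℝ := (∫ w in thinHartogs n, G w) + 8 * B * 2 ^ n * ∫ w in thinHartogs n, u w with hA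
  -- The bound is uniform in k: the coefficients of the Euler field are O(|w₂|) and the test
  -- function is at most |w₂|⁻ⁿ, so the gradient side is controlled by `G`.
  have hbound : ∀ k, ∫ w in thinHartogs n, hardyTest n k w * u w ≤ A := by
    intro k
    obtain ⟨hcs, hct⟩ := tsupport_hardyTest_subset hn k
    have hcd := contDiff_hardyTest hn k
    have key := HasWeakDeriv.coordField hw (eulerField n) hcd hcs hct
    rw [div_eulerField] at key
    set D : ℂ × ℂ → ℝ := fun x => fderiv ℝ (hardyTest n k) x (coordField (eulerField n) x) +
      (2 * n + 2) * hardyTest n k x with hD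
    have hXc : Continuous (coordField (eulerField n)) := by unfold coordField; fun_prop
    have hDi : Integrable (fun x => D x * u x) (lebesgueOn (thinHartogs n)) := by
      have hDc : Continuous D := ((hcd.continuous_fderiv (by simp)).clm_apply hXc).add
        (continuous_const.mul hcd.continuous)
      have hDs : HasCompactSupport D := by
        refine HasCompactSupport.of_support_subset_isCompact hcs.isCompact fun x hx => ?_
        by_contra h'
        refine hx ?_
        rw [hD]
        simp only
        rw [image_eq_zero_of_notMem_tsupport h', image_eq_zero_of_notMem_tsupport fun h'' =>
          h' (tsupport_fderiv_subset ℝ h'')]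
        simp
      obtain ⟨M, hM⟩ := hDc.bounded_above_of_compact_support hDs
      exact hui.bdd_mul hDc.aestronglyMeasurable (Filter.Eventually.of_forall hM)
    have hTi : Integrable (fun x => hardyTest n k x * u x) (lebesgueOn (thinHartogs n)) := by
      obtain ⟨M, hM⟩ := hcd.continuous.bounded_above_of_compact_support hcs
      exact hui.bdd_mul hcd.continuous.aestronglyMeasurable (Filter.Eventually.of_forall hM)
    have e1 : ∫ x in thinHartogs n, D x • (u x : ℂ) =
        ((∫ x in thinHartogs n, D x * u x : ℝ) : ℂ) := by
      refine Eq.trans ?_ integral_ofReal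
      congr 1 with x
      simp
    have e2 : ∫ x in thinHartogs n, D x * u x ≤ ∫ w in thinHartogs n, G w := by
      have h1 : ‖∫ x in thinHartogs n, hardyTest n k x • ∑ j, eulerField n j x • U j x‖ ≤
          ∫ w in thinHartogs n, G w := by
        refine norm_integral_le_of_norm_le hGi ?_
        refine ae_restrict_of_forall_mem hΩ.measurableSet fun x hx => ?_
        rw [norm_smul, Real.norm_of_nonneg (hardyTest_nonneg n k x)]
        have h2 : ‖∑ j, eulerField n j x • U j x‖ ≤ ∑ j, n * ‖x.2‖ * ‖g j x‖ := by
          refine norm_sum_le_of_le _ fun j _ => ?_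
          rw [norm_smul, Real.norm_eq_abs]
          exact mul_le_mul (abs_eulerField_le hn hx j) (hUg j x) (norm_nonneg _) (by positivity)
        calc _ ≤ (‖x.2‖ ^ n)⁻¹ * ∑ j, n * ‖x.2‖ * ‖g j x‖ :=
              mul_le_mul (hardyTest_le n k x) h2 (norm_nonneg _) (by positivity)
          _ = G x := by
              rw [hG, Finset.mul_sum]
              exact Finset.sum_congr rfl fun j _ => by ring
      have h3 : ((∫ x in thinHartogs n, D x * u x : ℝ) : ℂ) =
          -∫ x in thinHartogs n, hardyTest n k x • ∑ j, eulerField n j x • U j x := by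
        rw [← e1, ← key]
      rw [← norm_neg, ← h3, Complex.norm_real] at h1
      exact (Real.le_norm_self _).trans h1
    have e3 : ∫ x in thinHartogs n, (hardyTest n k x * u x - 8 * B * 2 ^ n * u x) ≤
        ∫ x in thinHartogs n, D x * u x := by
      refine setIntegral_mono_on (hTi.sub (hui.const_mul _)) hDi hΩ.measurableSet fun x hx => ?_
      have h1 := hardyTest_fderiv_ge hn hB0 hB k hx
      have h2 : hardyTest n k x ≤ (n + 2) * hardyTest n k x := by
        have := hardyTest_nonneg n k x
        have hn0 : (0 : ℝ) ≤ n := Nat.cast_nonneg n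
        nlinarith
      have h3 : hardyTest n k x - 8 * B * 2 ^ n ≤ D x := by linarith
      nlinarith [mul_le_mul_of_nonneg_right h3 (hu0 x)]
    rw [integral_sub hTi (hui.const_mul _), integral_const_mul] at e3
    linarith
  set χ : ℂ × ℂ → ℝ := fun w => Real.smoothTransition (3 - 4 * ‖w.2‖ ^ 2) * (‖w.2‖ ^ n)⁻¹ with hχ
  have hχ0 : ∀ w, 0 ≤ χ w := fun w => mul_nonneg (Real.smoothTransition.nonneg _) (by positivity)
  have hχm : Measurable χ :=
    (Real.smoothTransition.continuous.measurable.comp (by fun_prop)).mul (by fun_prop)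
  have hχi : Integrable (fun w => χ w * u w) (lebesgueOn (thinHartogs n)) := by
    refine ⟨hχm.aestronglyMeasurable.mul hui.aestronglyMeasurable, ?_⟩
    rw [hasFiniteIntegral_iff_ofReal
      (Filter.Eventually.of_forall fun w => mul_nonneg (hχ0 w) (hu0 w))]
    -- Fatou's lemma carries the uniform bound to the limit of the test functions.
    have hae : ∀ᵐ w ∂(lebesgueOn (thinHartogs n)), ENNReal.ofReal (χ w * u w) =
        Filter.liminf (fun k => ENNReal.ofReal (hardyTest n k w * u w)) Filter.atTop := by
      refine ae_restrict_of_forall_mem hΩ.measurableSet fun w hw => ?_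
      exact (((ENNReal.continuous_ofReal.tendsto _).comp
        ((tendsto_hardyTest hn hw).mul_const (u w))).liminf_eq).symm
    rw [lintegral_congr_ae hae]
    refine (lintegral_liminf_le' fun k => ?_).trans_lt ?_
    · exact ((contDiff_hardyTest hn k).continuous.aestronglyMeasurable.mul
        hui.aestronglyMeasurable).aemeasurable.ennreal_ofReal
    · refine lt_of_le_of_lt ?_ (ENNReal.ofReal_lt_top (r := A))
      refine Filter.liminf_le_of_le (by isBoundedDefault) fun b hb => ?_
      obtain ⟨k, hk⟩ := hb.exists
      refine hk.trans ?_
      rw [← ofReal_integral_eq_lintegral_ofReal]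
      · exact ENNReal.ofReal_le_ofReal (hbound k)
      · obtain ⟨M, hM⟩ := (contDiff_hardyTest hn k).continuous.bounded_above_of_compact_support
          (tsupport_hardyTest_subset hn k).1
        exact hui.bdd_mul (contDiff_hardyTest hn k).continuous.aestronglyMeasurable
          (Filter.Eventually.of_forall hM)
      · exact Filter.Eventually.of_forall fun w => mul_nonneg (hardyTest_nonneg n k w) (hu0 w)
  have hmeas : Measurable fun w : ℂ × ℂ => (‖w.2‖ ^ n)⁻¹ := by fun_prop
  refine Integrable.mono' (hχi.add (hui.const_mul (2 ^ n)))
    (hmeas.aestronglyMeasurable.mul hf.aestronglyMeasurable.norm) ?_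
  refine ae_restrict_of_forall_mem hΩ.measurableSet fun w hw => ?_
  have hw2 := norm_snd_pos hw
  have hfu : ‖f w‖ ≤ u w := norm_le_japaneseBracket _
  rw [Real.norm_of_nonneg (by positivity)]
  simp only [Pi.add_apply]
  -- In the first case the outer cutoff equals 1. In the second, |w₂| ≥ |w₂|² ≥ 1/2, so the weight
  -- is at most 2ⁿ and integrability of `u` is enough.
  rcases le_total (‖w.2‖ ^ 2) (1 / 2) with h' | h'
  · have : χ w = (‖w.2‖ ^ n)⁻¹ := by
      rw [hχ]; simp only
      rw [Real.smoothTransition.one_of_one_le (by linarith), one_mul]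
    rw [this]
    have h1 : (‖w.2‖ ^ n)⁻¹ * ‖f w‖ ≤ (‖w.2‖ ^ n)⁻¹ * u w := by gcongr
    have h2 : 0 ≤ 2 ^ n * u w := mul_nonneg (by positivity) (hu0 w)
    linarith
  · have h2 : (1 / 2 : ℝ) ≤ ‖w.2‖ := by nlinarith [((mem_thinHartogs hn).1 hw).2]
    have h3 : (‖w.2‖ ^ n)⁻¹ ≤ 2 ^ n := by
      rw [← inv_pow]
      refine pow_le_pow_left₀ (by positivity) ?_ n
      rw [inv_le_comm₀ hw2 two_pos]; linarith
    have h4 : (‖w.2‖ ^ n)⁻¹ * ‖f w‖ ≤ 2 ^ n * u w := by gcongr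
    have h5 := mul_nonneg (hχ0 w) (hu0 w)
    linarith

/-! ### The Schur test and weighted kernels -/

/-- The **Schur test** for a nonnegative kernel. -/
theorem lintegral_rpow_lintegral_mul_le_of_schur {X : Type*} [MeasurableSpace X] {μ : Measure X}
    [SFinite μ] {p q : ℝ} (hpq : p.HolderConjugate q) {k : X → X → ℝ≥0∞}
    (hk : Measurable (Function.uncurry k)) {h : X → ℝ≥0∞} (hh : Measurable h)
    (h0 : ∀ᵐ x ∂μ, h x ≠ 0 ∧ h x ≠ ⊤) {A B : ℝ≥0∞}
    (hA : ∀ᵐ z ∂μ, ∫⁻ w, k z w * h w ^ q ∂μ ≤ A * h z ^ q)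
    (hB : ∀ᵐ w ∂μ, ∫⁻ z, k z w * h z ^ p ∂μ ≤ B * h w ^ p)
    {G : X → ℝ≥0∞} (hG : AEMeasurable G μ) :
    ∫⁻ z, (∫⁻ w, k z w * G w ∂μ) ^ p ∂μ ≤ A ^ (p / q) * B * ∫⁻ w, G w ^ p ∂μ := by
  have hp := hpq.pos
  have hq := hpq.symm.pos
  have hk1 : ∀ z, Measurable (k z) := fun z => hk.comp measurable_prodMk_left
  -- Hölder's inequality after writing kG = (k^(1/p) h⁻¹ G)(k^(1/q) h); the second factor is the one
  -- controlled by the first Schur condition. Tonelli and the second condition then conclude.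
  have hpointwise : ∀ᵐ z ∂μ, (∫⁻ w, k z w * G w ∂μ) ^ p ≤
      A ^ (p / q) * h z ^ p * ∫⁻ w, k z w * ((h w)⁻¹ ^ p * G w ^ p) ∂μ := by
    filter_upwards [hA] with z hz
    have e1 : ∫⁻ w, k z w * G w ∂μ =
        ∫⁻ w, ((fun w => k z w ^ (1 / p) * ((h w)⁻¹ * G w)) *
          fun w => k z w ^ (1 / q) * h w) w ∂μ := by
      refine lintegral_congr_ae ?_
      filter_upwards [h0] with w hw
      have e2 : k z w ^ (1 / p) * k z w ^ (1 / q) = k z w := by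
        rw [← ENNReal.rpow_add_of_nonneg _ _ (by positivity) (by positivity), one_div, one_div,
          hpq.inv_add_inv_eq_one, ENNReal.rpow_one]
      calc k z w * G w = k z w ^ (1 / p) * k z w ^ (1 / q) * ((h w)⁻¹ * h w) * G w := by
            rw [e2, ENNReal.inv_mul_cancel hw.1 hw.2, mul_one]
        _ = _ := by simp only [Pi.mul_apply]; ring
    have e3 := ENNReal.lintegral_mul_le_Lp_mul_Lq μ hpq
      (f := fun w => k z w ^ (1 / p) * ((h w)⁻¹ * G w)) (g := fun w => k z w ^ (1 / q) * h w)
      (((hk1 z).pow_const _).aemeasurable.mul (hh.inv.aemeasurable.mul hG))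
      (((hk1 z).pow_const _).mul hh).aemeasurable
    have e4 : ∀ w, (k z w ^ (1 / p) * ((h w)⁻¹ * G w)) ^ p = k z w * ((h w)⁻¹ ^ p * G w ^ p) := by
      intro w
      rw [ENNReal.mul_rpow_of_nonneg _ _ hp.le, ENNReal.mul_rpow_of_nonneg _ _ hp.le,
        ← ENNReal.rpow_mul, one_div_mul_cancel hp.ne', ENNReal.rpow_one]
    have e5 : ∀ w, (k z w ^ (1 / q) * h w) ^ q = k z w * h w ^ q := by
      intro w
      rw [ENNReal.mul_rpow_of_nonneg _ _ hq.le, ← ENNReal.rpow_mul, one_div_mul_cancel hq.ne',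
        ENNReal.rpow_one]
    simp only [e4, e5] at e3
    rw [← e1] at e3
    calc (∫⁻ w, k z w * G w ∂μ) ^ p
        ≤ ((∫⁻ w, k z w * ((h w)⁻¹ ^ p * G w ^ p) ∂μ) ^ (1 / p) *
          (∫⁻ w, k z w * h w ^ q ∂μ) ^ (1 / q)) ^ p := by gcongr
      _ ≤ ((∫⁻ w, k z w * ((h w)⁻¹ ^ p * G w ^ p) ∂μ) ^ (1 / p) *
          (A * h z ^ q) ^ (1 / q)) ^ p := by gcongr
      _ = _ := by
        rw [ENNReal.mul_rpow_of_nonneg _ _ hp.le, ← ENNReal.rpow_mul, ← ENNReal.rpow_mul,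
          one_div_mul_cancel hp.ne', ENNReal.rpow_one,
          ENNReal.mul_rpow_of_nonneg _ _ (by positivity), ← ENNReal.rpow_mul, mul_comm,
          show 1 / q * p = p / q by ring, show q * (p / q) = p by field_simp]
  have hfm : AEMeasurable (fun w => (h w)⁻¹ ^ p * G w ^ p) μ :=
    (hh.inv.pow_const _).aemeasurable.mul (hG.pow_const _)
  have hm2 : AEMeasurable (Function.uncurry fun z w =>
      h z ^ p * (k z w * ((h w)⁻¹ ^ p * G w ^ p))) (μ.prod μ) := by
    refine AEMeasurable.mul ((hh.comp measurable_fst).pow_const p).aemeasurable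
      (hk.aemeasurable.mul ?_)
    exact hfm.comp_quasiMeasurePreserving Measure.quasiMeasurePreserving_snd
  calc ∫⁻ z, (∫⁻ w, k z w * G w ∂μ) ^ p ∂μ
      ≤ ∫⁻ z, A ^ (p / q) * ∫⁻ w, h z ^ p * (k z w * ((h w)⁻¹ ^ p * G w ^ p)) ∂μ ∂μ := by
        refine lintegral_mono_ae (hpointwise.mono fun z hz => hz.trans_eq ?_)
        rw [lintegral_const_mul'' (h z ^ p) (f := fun w => k z w * ((h w)⁻¹ ^ p * G w ^ p))
          ((hk1 z).aemeasurable.mul hfm), mul_assoc]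
    _ = A ^ (p / q) * ∫⁻ w, ∫⁻ z, h z ^ p * (k z w * ((h w)⁻¹ ^ p * G w ^ p)) ∂μ ∂μ := by
        rw [lintegral_const_mul'' (A ^ (p / q))
          (f := fun z => ∫⁻ w, h z ^ p * (k z w * ((h w)⁻¹ ^ p * G w ^ p)) ∂μ)
          hm2.lintegral_prod_right', lintegral_lintegral_swap hm2]
    _ ≤ A ^ (p / q) * ∫⁻ w, B * G w ^ p ∂μ := by
        refine mul_le_mul_right (lintegral_mono_ae ?_) _
        filter_upwards [hB, h0] with w hw hw0
        have hk2 : Measurable fun z => k z w := hk.comp measurable_prodMk_right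
        calc ∫⁻ z, h z ^ p * (k z w * ((h w)⁻¹ ^ p * G w ^ p)) ∂μ
            = (∫⁻ z, k z w * h z ^ p ∂μ) * ((h w)⁻¹ ^ p * G w ^ p) := by
              rw [← lintegral_mul_const _ (f := fun z => k z w * h z ^ p) (hk2.mul (hh.pow_const p))]
              exact lintegral_congr fun z => by ring
          _ ≤ B * h w ^ p * ((h w)⁻¹ ^ p * G w ^ p) := by gcongr
          _ = B * (h w * (h w)⁻¹) ^ p * G w ^ p := by
              rw [ENNReal.mul_rpow_of_nonneg _ _ hp.le]; ring
          _ = B * G w ^ p := by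
              rw [ENNReal.mul_inv_cancel hw0.1 hw0.2, ENNReal.one_rpow, mul_one]
    _ = A ^ (p / q) * B * ∫⁻ w, G w ^ p ∂μ := by
        rw [lintegral_const_mul'' _ (hG.pow_const p), mul_assoc]

/-- The product of the defining functions of the two discs on which `bidiscWeight` lives. -/
noncomputable def bidiscDefect (n : ℕ) (w : ℂ × ℂ) : ℝ :=
  (1 - ‖w.1 / w.2 ^ n‖ ^ 2) * (1 - ‖w.2‖ ^ 2)

theorem bidiscDefect_pos {n : ℕ} (hn : 1 ≤ n) {w : ℂ × ℂ} (hw : w ∈ thinHartogs n) :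
    0 < bidiscDefect n w := by
  have h1 := norm_fst_div_lt_one hn hw
  have h2 := ((mem_thinHartogs hn).1 hw).2
  exact mul_pos (by nlinarith [norm_nonneg (w.1 / w.2 ^ n)]) (by nlinarith [norm_nonneg w.2])

/-- Rescaling each fibre to the unit disc produces |w₂|²ⁿ, which cancels the shift -2n in the
exponent, and turns w₁/w₂ⁿ into the new variable times a unimodular constant. The integral splits
into two Forelli-Rudin integrals, unweighted in the fibre and with exponent κ in the base. -/
theorem exists_lintegral_bidiscWeight_le {n : ℕ} (hn : 1 ≤ n) {κ ε : ℝ} (hκ : -2 < κ) (hε : 0 < ε)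
    (hε1 : ε < 1) : ∃ C : ℝ, 0 ≤ C ∧ ∀ z ∈ thinHartogs n,
      ∫⁻ w in thinHartogs n, ENNReal.ofReal
        (‖w.2‖ ^ (κ - 2 * n) * bidiscDefect n w ^ (-ε) * bidiscWeight n z w) ≤
      ENNReal.ofReal (C * bidiscDefect n z ^ (-ε)) := by
  obtain ⟨C₁, hC₁, h₁⟩ := exists_lintegral_forelliRudin_le (κ := 0) (by norm_num) hε hε1
  obtain ⟨C₂, hC₂, h₂⟩ := exists_lintegral_forelliRudin_le hκ hε hε1
  refine ⟨C₁ * C₂, by positivity, fun z hz => ?_⟩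
  have hz1 := norm_fst_div_lt_one hn hz
  have hz2 := ((mem_thinHartogs hn).1 hz).2
  have hd1 : 0 < 1 - ‖z.1 / z.2 ^ n‖ ^ 2 := by nlinarith [norm_nonneg (z.1 / z.2 ^ n)]
  have hd2 : 0 < 1 - ‖z.2‖ ^ 2 := by nlinarith [norm_nonneg z.2]
  set u := z.1 / z.2 ^ n with hu
  rw [setLIntegral_thinHartogs hn (by unfold bidiscDefect bidiscWeight; fun_prop)]
  calc _ ≤ ∫⁻ w₂ in Metric.ball (0 : ℂ) 1,
        ENNReal.ofReal (C₁ * (1 - ‖u‖ ^ 2) ^ (-ε)) * ENNReal.ofReal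
          (‖w₂‖ ^ κ * (1 - ‖w₂‖ ^ 2) ^ (-ε) * (‖1 - z.2 * conj w₂‖ ^ 2)⁻¹) := ?_
    _ ≤ ENNReal.ofReal (C₁ * (1 - ‖u‖ ^ 2) ^ (-ε)) *
        ENNReal.ofReal (C₂ * (1 - ‖z.2‖ ^ 2) ^ (-ε)) := by
        rw [lintegral_const_mul _ (by fun_prop)]
        gcongr
        exact h₂ _ hz2
    _ = _ := by
        rw [← ENNReal.ofReal_mul (by positivity), bidiscDefect, Real.mul_rpow hd1.le hd2.le]
        congr 1; ring
  refine lintegral_mono_ae ?_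
  have hae : ∀ᵐ w₂ : ℂ, w₂ ≠ 0 := by simp [ae_iff]
  filter_upwards [ae_restrict_mem Metric.isOpen_ball.measurableSet, ae_restrict_of_ae hae] with w₂ hw hw0
  rw [mem_ball_zero_iff] at hw
  have hwp : 0 < ‖w₂‖ := norm_pos_iff.2 hw0
  have hdw : 0 < 1 - ‖w₂‖ ^ 2 := by nlinarith
  rw [setLIntegral_ball_scale (by unfold bidiscDefect bidiscWeight; fun_prop)
    (pow_pos hwp n)]
  set c : ℂ := ((‖w₂‖ ^ n : ℝ) : ℂ) / w₂ ^ n with hc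
  have hcn : ‖c‖ = 1 := by
    rw [hc, norm_div, norm_pow, Complex.norm_real, Real.norm_of_nonneg (by positivity),
      div_self (by positivity)]
  have hb : ‖u * conj c‖ < 1 := by rw [norm_mul, RCLike.norm_conj, hcn, mul_one]; exact hz1
  have hpt : ∀ v ∈ Metric.ball (0 : ℂ) 1, ENNReal.ofReal (‖w₂‖ ^ (κ - 2 * n) *
      bidiscDefect n (((‖w₂‖ ^ n : ℝ) : ℂ) * v, w₂) ^ (-ε) *
        bidiscWeight n z (((‖w₂‖ ^ n : ℝ) : ℂ) * v, w₂)) =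
      ENNReal.ofReal (‖w₂‖ ^ (κ - 2 * n) * (1 - ‖w₂‖ ^ 2) ^ (-ε) * (‖1 - z.2 * conj w₂‖ ^ 2)⁻¹) *
      ENNReal.ofReal (‖v‖ ^ (0 : ℝ) * (1 - ‖v‖ ^ 2) ^ (-ε) *
        (‖1 - u * conj c * conj v‖ ^ 2)⁻¹) := by
    intro v hv
    rw [mem_ball_zero_iff] at hv
    have hdv : 0 < 1 - ‖v‖ ^ 2 := by nlinarith [norm_nonneg v]
    rw [← ENNReal.ofReal_mul (by positivity)]
    congr 1
    have e1 : ((‖w₂‖ ^ n : ℝ) : ℂ) * v / w₂ ^ n = c * v := by rw [hc]; ring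
    simp only [bidiscDefect, bidiscWeight]
    rw [e1, norm_mul, hcn, one_mul, Real.mul_rpow hdv.le hdw.le, Real.rpow_zero, map_mul,
      mul_assoc u]
    ring
  rw [setLIntegral_congr_fun Metric.isOpen_ball.measurableSet hpt,
    lintegral_const_mul _ (by fun_prop)]
  calc _ ≤ ENNReal.ofReal ((‖w₂‖ ^ n) ^ 2) * (ENNReal.ofReal (‖w₂‖ ^ (κ - 2 * n) *
        (1 - ‖w₂‖ ^ 2) ^ (-ε) * (‖1 - z.2 * conj w₂‖ ^ 2)⁻¹) *
          ENNReal.ofReal (C₁ * (1 - ‖u * conj c‖ ^ 2) ^ (-ε))) := by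
        gcongr
        exact h₁ _ hb
    _ = _ := by
        rw [norm_mul, RCLike.norm_conj, hcn, mul_one, ← ENNReal.ofReal_mul (by positivity),
          ← ENNReal.ofReal_mul (by positivity), ← ENNReal.ofReal_mul (by positivity)]
        congr 1
        have e2 : ‖w₂‖ ^ (κ - 2 * n) * (‖w₂‖ ^ n) ^ 2 = ‖w₂‖ ^ κ := by
          rw [← pow_mul, ← Real.rpow_natCast, ← Real.rpow_add hwp]
          congr 1; push_cast; ring
        rw [← e2]; ring

/-- The kernels `|z₂|^{-m} |w₂|^{m - 2n} bidiscWeight` are bounded on `Lᵖ`. -/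
theorem exists_lintegral_rpow_bidiscWeight_le {n : ℕ} (hn : 1 ≤ n) {p m s : ℝ} (hp : 1 < p)
    (hs1 : 2 * n - m ≤ s) (hs2 : s < 2 * n - m + 2) (hs3 : m * (p - 1) ≤ s)
    (hs4 : s < (m + 2) * (p - 1)) :
    ∃ C : ℝ≥0, ∀ G : ℂ × ℂ → ℝ≥0∞, AEMeasurable G (lebesgueOn (thinHartogs n)) →
      ∫⁻ z in thinHartogs n, (∫⁻ w in thinHartogs n, ENNReal.ofReal
        (‖z.2‖ ^ (-m) * ‖w.2‖ ^ (m - 2 * n) * bidiscWeight n z w) * G w) ^ p ≤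
      C * ∫⁻ w in thinHartogs n, G w ^ p := by
  have hΩ := (isOpen_thinHartogs hn).measurableSet
  have hp1 : 0 < p - 1 := by linarith
  have hp0 : 0 < p := by linarith
  set q := p / (p - 1) with hq
  have hpq : p.HolderConjugate q := Real.HolderConjugate.conjExponent hp
  have hq0 := hpq.symm.pos
  have hq1 : 1 < q := hpq.symm.lt
  obtain ⟨A, hA0, hA⟩ := exists_lintegral_bidiscWeight_le hn (κ := m - s / (p - 1)) (ε := 1 / p)
    (by rw [← div_lt_iff₀ hp1] at hs4; linarith) (by positivity) (by rw [div_lt_one hp0]; exact hp)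
  obtain ⟨B, hB0, hB⟩ := exists_lintegral_bidiscWeight_le hn (κ := 2 * n - m - s) (ε := 1 / q)
    (by linarith) (by positivity) (by rw [div_lt_one hq0]; exact hq1)
  -- The defect exponent is chosen so that the powers h^q and h^p carry -1/p and -1/q, both
  -- admissible in Forelli-Rudin. The upper bounds on s say κ > -2 in the two integrals; the lower
  -- bounds, with |z₂| < 1, let |z₂|^(-m) and |w₂|^(m-2n) be compared with the powers in h^q and
  -- h^p.
  set h : ℂ × ℂ → ℝ≥0∞ := fun w =>
    ENNReal.ofReal (‖w.2‖ ^ (-(s / p)) * bidiscDefect n w ^ (-(1 / (p * q)))) with hh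
  have hpow : ∀ w ∈ thinHartogs n, ∀ r : ℝ, 0 < r → h w ^ r =
      ENNReal.ofReal (‖w.2‖ ^ (-(s / p) * r) * bidiscDefect n w ^ (-(1 / (p * q)) * r)) := by
    intro w hw r hr
    have h1 := norm_snd_pos hw
    have h2 := bidiscDefect_pos hn hw
    rw [hh]
    simp only
    rw [ENNReal.ofReal_rpow_of_nonneg (by positivity) hr.le,
      Real.mul_rpow (by positivity) (by positivity), ← Real.rpow_mul h1.le, ← Real.rpow_mul h2.le]
  have hhq : ∀ w ∈ thinHartogs n, h w ^ q =
      ENNReal.ofReal (‖w.2‖ ^ (-(s / (p - 1))) * bidiscDefect n w ^ (-(1 / p))) := by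
    intro w hw
    rw [hpow w hw q hq0, show -(s / p) * q = -(s / (p - 1)) by rw [hq]; field_simp,
      show -(1 / (p * q)) * q = -(1 / p) by field_simp]
  have hhp : ∀ w ∈ thinHartogs n, h w ^ p =
      ENNReal.ofReal (‖w.2‖ ^ (-s) * bidiscDefect n w ^ (-(1 / q))) := by
    intro w hw
    rw [hpow w hw p hp0, show -(s / p) * p = -s by field_simp,
      show -(1 / (p * q)) * p = -(1 / q) by field_simp]
  have hmono : ∀ w ∈ thinHartogs n, ∀ a b : ℝ, b ≤ a → ‖w.2‖ ^ a ≤ ‖w.2‖ ^ b := fun w hw a b hab =>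
    Real.rpow_le_rpow_of_exponent_ge (norm_snd_pos hw) ((mem_thinHartogs hn).1 hw).2.le hab
  set k : ℂ × ℂ → ℂ × ℂ → ℝ≥0∞ := fun z w => ENNReal.ofReal
    (‖z.2‖ ^ (-m) * ‖w.2‖ ^ (m - 2 * n) * bidiscWeight n z w) with hk
  have hkm : Measurable (Function.uncurry k) := by
    rw [hk]; unfold bidiscWeight Function.uncurry; fun_prop
  have hhm : Measurable h := by rw [hh]; unfold bidiscDefect; fun_prop
  refine ⟨Real.toNNReal A ^ (p / q) * Real.toNNReal B, fun G hG => ?_⟩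
  have key := lintegral_rpow_lintegral_mul_le_of_schur (μ := lebesgueOn (thinHartogs n)) hpq hkm
    hhm (A := ENNReal.ofReal A) (B := ENNReal.ofReal B) ?_ ?_ ?_ hG
  · refine key.trans_eq ?_
    rw [ENNReal.coe_mul, ENNReal.coe_rpow_of_nonneg _ (by positivity)]
    rfl
  · refine ae_restrict_of_forall_mem hΩ fun w hw => ⟨?_, ENNReal.ofReal_ne_top⟩
    have h1 := norm_snd_pos hw
    have h2 := bidiscDefect_pos hn hw
    rw [hh]
    simp only [ne_eq, ENNReal.ofReal_eq_zero, not_le]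
    positivity
  · refine ae_restrict_of_forall_mem hΩ fun z hz => ?_
    have hzp := norm_snd_pos hz
    have hdz := bidiscDefect_pos hn hz
    calc ∫⁻ w in thinHartogs n, k z w * h w ^ q
        = ∫⁻ w in thinHartogs n, ENNReal.ofReal (‖z.2‖ ^ (-m)) * ENNReal.ofReal
          (‖w.2‖ ^ (m - s / (p - 1) - 2 * n) * bidiscDefect n w ^ (-(1 / p)) *
            bidiscWeight n z w) := by
          refine setLIntegral_congr_fun hΩ fun w hw => ?_
          have hwp := norm_snd_pos hw
          have hQ := bidiscWeight_nonneg n z w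
          simp only [hk]
          rw [hhq w hw, ← ENNReal.ofReal_mul (by positivity), ← ENNReal.ofReal_mul (by positivity),
            show m - s / (p - 1) - 2 * n = m - 2 * n + -(s / (p - 1)) by ring, Real.rpow_add hwp]
          congr 1; ring
      _ ≤ ENNReal.ofReal (‖z.2‖ ^ (-m)) *
          ENNReal.ofReal (A * bidiscDefect n z ^ (-(1 / p))) := by
          rw [lintegral_const_mul' _ _ ENNReal.ofReal_ne_top]
          gcongr
          exact hA z hz
      _ ≤ ENNReal.ofReal A * h z ^ q := by
          rw [hhq z hz, ← ENNReal.ofReal_mul (by positivity), ← ENNReal.ofReal_mul hA0]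
          refine ENNReal.ofReal_le_ofReal ?_
          have h1 := hmono z hz (-m) (-(s / (p - 1))) (by
            rw [neg_le_neg_iff, le_div_iff₀ hp1]; exact hs3)
          rw [mul_left_comm]
          gcongr
  · refine ae_restrict_of_forall_mem hΩ fun w hw => ?_
    have hwp := norm_snd_pos hw
    have hdw := bidiscDefect_pos hn hw
    calc ∫⁻ z in thinHartogs n, k z w * h z ^ p
        = ∫⁻ z in thinHartogs n, ENNReal.ofReal (‖w.2‖ ^ (m - 2 * n)) * ENNReal.ofReal
          (‖z.2‖ ^ (2 * n - m - s - 2 * n) * bidiscDefect n z ^ (-(1 / q)) *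
            bidiscWeight n w z) := by
          refine setLIntegral_congr_fun hΩ fun z hz => ?_
          have hzp := norm_snd_pos hz
          have hQ := bidiscWeight_nonneg n z w
          simp only [hk]
          rw [hhp z hz, ← ENNReal.ofReal_mul (by positivity), ← ENNReal.ofReal_mul (by positivity),
            show 2 * n - m - s - 2 * n = -m + -s by ring, Real.rpow_add hzp, bidiscWeight_comm n w]
          congr 1; ring
      _ ≤ ENNReal.ofReal (‖w.2‖ ^ (m - 2 * n)) *
          ENNReal.ofReal (B * bidiscDefect n w ^ (-(1 / q))) := by
          rw [lintegral_const_mul' _ _ ENNReal.ofReal_ne_top]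
          gcongr
          exact hB w hw
      _ ≤ ENNReal.ofReal B * h w ^ p := by
          rw [hhp w hw, ← ENNReal.ofReal_mul (by positivity), ← ENNReal.ofReal_mul hB0]
          refine ENNReal.ofReal_le_ofReal ?_
          have h1 := hmono w hw (m - 2 * n) (-s) (by linarith)
          rw [mul_left_comm]
          gcongr

/-! ### Derivatives of the kernel -/

/-- The derivative of `hartogsKernel` in the first variable. -/
noncomputable def hartogsKernelDerivFst (n : ℕ) (z w : ℂ × ℂ) : ℂ :=
  hartogsKernel n z w * (2 * conj w.1 / ((z.2 * conj w.2) ^ n - z.1 * conj w.1))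

/-- The derivative of `hartogsKernel` in the second variable. -/
noncomputable def hartogsKernelDerivSnd (n : ℕ) (z w : ℂ × ℂ) : ℂ :=
  hartogsKernel n z w * ((n - 2 * n * ((z.2 * conj w.2) ^ n /
    ((z.2 * conj w.2) ^ n - z.1 * conj w.1)) + 2 * (z.2 * conj w.2) / (1 - z.2 * conj w.2)) / z.2)

/-- A primitive of `hartogsKernelDerivFst n z` along the rotations in the first variable of `w`. -/
noncomputable def rotPrimitive (n : ℕ) (z w : ℂ × ℂ) : ℂ :=
  conj w.1 * (2 * (z.2 * conj w.2) ^ n - z.1 * conj w.1) /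
    (Real.pi ^ 2 * ((z.2 * conj w.2) ^ n * ((z.2 * conj w.2) ^ n - z.1 * conj w.1) ^ 2 *
      (1 - z.2 * conj w.2) ^ 2))

theorem measurable_hartogsKernelDerivFst (n : ℕ) :
    Measurable fun p : (ℂ × ℂ) × (ℂ × ℂ) => hartogsKernelDerivFst n p.1 p.2 := by
  unfold hartogsKernelDerivFst hartogsKernel; fun_prop

theorem measurable_hartogsKernelDerivSnd (n : ℕ) :
    Measurable fun p : (ℂ × ℂ) × (ℂ × ℂ) => hartogsKernelDerivSnd n p.1 p.2 := by
  unfold hartogsKernelDerivSnd hartogsKernel; fun_prop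

theorem measurable_rotPrimitive (n : ℕ) :
    Measurable fun p : (ℂ × ℂ) × (ℂ × ℂ) => rotPrimitive n p.1 p.2 := by
  unfold rotPrimitive; fun_prop

section Derivatives

variable {n : ℕ} {z w : ℂ × ℂ}

theorem hasDerivAt_hartogsKernel_fst (hn : 1 ≤ n) (hz : z ∈ thinHartogs n)
    (hw : w ∈ thinHartogs n) : HasDerivAt (fun s => hartogsKernel n (s, z.2) w)
      (hartogsKernelDerivFst n z w) z.1 := by
  have hD := pow_sub_ne_zero hn hz hw
  have hE := one_sub_snd_ne_zero hn hz hw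
  have hpi : (Real.pi : ℂ) ≠ 0 := by simp [Real.pi_ne_zero]
  have h1 : HasDerivAt (fun s : ℂ => (z.2 * conj w.2) ^ n - s * conj w.1) (-conj w.1) z.1 := by
    simpa using ((hasDerivAt_id z.1).mul_const (conj w.1)).const_sub ((z.2 * conj w.2) ^ n)
  have h2 := (hasDerivAt_const z.1 ((z.2 * conj w.2) ^ n)).fun_div
    (((h1.fun_pow 2).const_mul ((Real.pi : ℂ) ^ 2)).mul_const ((1 - z.2 * conj w.2) ^ 2))
    (mul_ne_zero (mul_ne_zero (pow_ne_zero _ hpi) (pow_ne_zero _ hD)) (pow_ne_zero _ hE))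
  refine h2.congr_deriv ?_
  unfold hartogsKernelDerivFst hartogsKernel
  generalize (z.2 * conj w.2) ^ n - z.1 * conj w.1 = D at *
  generalize 1 - z.2 * conj w.2 = E at *
  simp
  field_simp

theorem hasDerivAt_hartogsKernel_snd (hn : 1 ≤ n) (hz : z ∈ thinHartogs n)
    (hw : w ∈ thinHartogs n) : HasDerivAt (fun s => hartogsKernel n (z.1, s) w)
      (hartogsKernelDerivSnd n z w) z.2 := by
  have hD := pow_sub_ne_zero hn hz hw
  have hE := one_sub_snd_ne_zero hn hz hw
  have hpi : (Real.pi : ℂ) ≠ 0 := by simp [Real.pi_ne_zero]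
  have hz2 : z.2 ≠ 0 := norm_pos_iff.1 (norm_snd_pos hz)
  have h0 : HasDerivAt (fun s : ℂ => s * conj w.2) (conj w.2) z.2 := by
    simpa using (hasDerivAt_id z.2).mul_const (conj w.2)
  have h1 : HasDerivAt (fun s : ℂ => (s * conj w.2) ^ n)
      (n * (z.2 * conj w.2) ^ n / z.2) z.2 := by
    refine (h0.fun_pow n).congr_deriv ?_
    obtain ⟨m, rfl⟩ : ∃ m, n = m + 1 := ⟨n - 1, by omega⟩
    rw [Nat.add_sub_cancel, pow_succ]
    field_simp
  have h2 := h1.fun_div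
    ((((h1.sub_const (z.1 * conj w.1)).fun_pow 2).const_mul ((Real.pi : ℂ) ^ 2)).fun_mul
      ((h0.const_sub 1).fun_pow 2))
    (mul_ne_zero (mul_ne_zero (pow_ne_zero _ hpi) (pow_ne_zero _ hD)) (pow_ne_zero _ hE))
  refine h2.congr_deriv ?_
  unfold hartogsKernelDerivSnd hartogsKernel
  generalize hDD : (z.2 * conj w.2) ^ n - z.1 * conj w.1 = D at *
  generalize hEE : 1 - z.2 * conj w.2 = E at *
  generalize (z.2 * conj w.2) ^ n = Y at *
  simp
  field_simp
  ring

theorem hasFDerivAt_hartogsKernel (hn : 1 ≤ n) (hz : z ∈ thinHartogs n)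
    (hw : w ∈ thinHartogs n) : HasFDerivAt (fun z => hartogsKernel n z w)
      (hartogsKernelDerivFst n z w • ContinuousLinearMap.fst ℂ ℂ ℂ +
        hartogsKernelDerivSnd n z w • ContinuousLinearMap.snd ℂ ℂ ℂ) z := by
  have hd := ((differentiableOn_hartogsKernel hn hw).differentiableAt
    ((isOpen_thinHartogs hn).mem_nhds hz)).hasFDerivAt
  have h1 := (hd.comp_hasDerivAt_of_eq z.1 ((hasDerivAt_id z.1).prodMk (hasDerivAt_const z.1 z.2))
    rfl).unique (hasDerivAt_hartogsKernel_fst hn hz hw)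
  have h2 := (hd.comp_hasDerivAt_of_eq z.2 ((hasDerivAt_const z.2 z.1).prodMk (hasDerivAt_id z.2))
    rfl).unique (hasDerivAt_hartogsKernel_snd hn hz hw)
  refine hd.congr_fderiv ?_
  ext <;> simp [h1, h2]

theorem contDiff_conj_fst : ContDiff ℝ ∞ fun w : ℂ × ℂ => conj w.1 :=
  Complex.conjCLE.contDiff.comp contDiff_fst

theorem contDiff_conj_snd : ContDiff ℝ ∞ fun w : ℂ × ℂ => conj w.2 :=
  Complex.conjCLE.contDiff.comp contDiff_snd

theorem contDiffOn_hartogsKernel (hn : 1 ≤ n) (hz : z ∈ thinHartogs n) :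
    ContDiffOn ℝ ∞ (hartogsKernel n z) (thinHartogs n) := by
  have h1 := contDiff_conj_fst
  have h2 := contDiff_conj_snd
  unfold hartogsKernel
  simp only [div_eq_mul_inv]
  refine ContDiffOn.mul ?_ (ContDiffOn.inv ?_ fun w hw => ?_)
  · exact ((contDiff_const.mul h2).pow n).contDiffOn
  · exact ((contDiff_const.mul ((((contDiff_const.mul h2).pow n).sub
      (contDiff_const.mul h1)).pow 2)).mul
        ((contDiff_const.sub (contDiff_const.mul h2)).pow 2)).contDiffOn
  · exact mul_ne_zero (mul_ne_zero (by simp [Real.pi_ne_zero])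
      (pow_ne_zero _ (pow_sub_ne_zero hn hz hw))) (pow_ne_zero _ (one_sub_snd_ne_zero hn hz hw))

theorem mul_conj_pow_ne_zero (hz : z ∈ thinHartogs n) (hw : w ∈ thinHartogs n) :
    (z.2 * conj w.2) ^ n ≠ 0 := by
  have hz2 : z.2 ≠ 0 := norm_pos_iff.1 (norm_snd_pos hz)
  have hw2 : w.2 ≠ 0 := norm_pos_iff.1 (norm_snd_pos hw)
  exact pow_ne_zero _ (mul_ne_zero hz2 (by simpa using hw2))

theorem contDiffOn_rotPrimitive (hn : 1 ≤ n) (hz : z ∈ thinHartogs n) :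
    ContDiffOn ℝ ∞ (rotPrimitive n z) (thinHartogs n) := by
  have h1 := contDiff_conj_fst
  have h2 := contDiff_conj_snd
  unfold rotPrimitive
  simp only [div_eq_mul_inv]
  refine ContDiffOn.mul ?_ (ContDiffOn.inv ?_ fun w hw => ?_)
  · exact (h1.mul ((contDiff_const.mul ((contDiff_const.mul h2).pow n)).sub
      (contDiff_const.mul h1))).contDiffOn
  · exact (contDiff_const.mul ((((contDiff_const.mul h2).pow n).mul
      ((((contDiff_const.mul h2).pow n).sub (contDiff_const.mul h1)).pow 2)).mul
        ((contDiff_const.sub (contDiff_const.mul h2)).pow 2))).contDiffOn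
  · exact mul_ne_zero (by simp [Real.pi_ne_zero]) (mul_ne_zero (mul_ne_zero
      (mul_conj_pow_ne_zero hz hw) (pow_ne_zero _ (pow_sub_ne_zero hn hz hw)))
        (pow_ne_zero _ (one_sub_snd_ne_zero hn hz hw)))

theorem conj_exp_ofReal_mul_I (t : ℝ) :
    conj (Complex.exp (t * Complex.I)) = Complex.exp (t * -Complex.I) := by
  rw [← Complex.exp_conj]; simp

/-- The variables z₂ and w₂ enter only through z₂w̄₂, so rotating w₂ by an angle t amounts to
rotating z₂ by -t. -/
theorem fderiv_hartogsKernel_rotTwo (hn : 1 ≤ n) (hz : z ∈ thinHartogs n)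
    (hw : w ∈ thinHartogs n) : fderiv ℝ (hartogsKernel n z) w (coordField rotTwo w) =
      -Complex.I * z.2 * hartogsKernelDerivSnd n z w := by
  rw [coordField_rotTwo]
  refine fderiv_apply_of_comp_curve (γ := fun t => (w.1, Complex.exp (t * Complex.I) * w.2))
    (((contDiffOn_hartogsKernel hn hz).contDiffAt
      ((isOpen_thinHartogs hn).mem_nhds hw)).differentiableAt (by simp)) (by simp)
    ((hasDerivAt_const _ _).prodMk (hasDerivAt_exp_mul _ _)) ?_
  have hcurve : (fun t : ℝ => hartogsKernel n z (w.1, Complex.exp (t * Complex.I) * w.2)) =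
      fun t : ℝ => hartogsKernel n (z.1, Complex.exp (t * -Complex.I) * z.2) w := by
    ext t
    unfold hartogsKernel
    simp only [map_mul, conj_exp_ofReal_mul_I]
    rw [show z.2 * (Complex.exp (t * -Complex.I) * conj w.2) =
      Complex.exp (t * -Complex.I) * z.2 * conj w.2 by ring]
  rw [hcurve]
  have h1 := hasDerivAt_hartogsKernel_snd hn hz hw
  have h2 := h1.comp_of_eq (0 : ℝ) (hasDerivAt_exp_mul (-Complex.I) z.2) (by simp)
  exact h2.congr_deriv (by ring)

/-- For z₁ ≠ 0, `rotPrimitive` is the kernel minus its value at z₁ = 0, divided by z₁. The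
subtracted term does not involve w₁, and rotating w₁ differentiates the kernel as -i z₁∂/∂z₁; the
factor z₁ cancels, and the closed form stays valid at z₁ = 0. -/
theorem fderiv_rotPrimitive_rotOne (hn : 1 ≤ n) (hz : z ∈ thinHartogs n)
    (hw : w ∈ thinHartogs n) : fderiv ℝ (rotPrimitive n z) w (coordField rotOne w) =
      -Complex.I * hartogsKernelDerivFst n z w := by
  rw [coordField_rotOne]
  have hY := mul_conj_pow_ne_zero hz hw
  have hD := pow_sub_ne_zero hn hz hw
  have hE := one_sub_snd_ne_zero hn hz hw
  have hpi : (Real.pi : ℂ) ≠ 0 := by simp [Real.pi_ne_zero]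
  refine fderiv_apply_of_comp_curve (γ := fun t => (Complex.exp (t * Complex.I) * w.1, w.2))
    (((contDiffOn_rotPrimitive hn hz).contDiffAt
      ((isOpen_thinHartogs hn).mem_nhds hw)).differentiableAt (by simp)) (by simp)
    ((hasDerivAt_exp_mul _ _).prodMk (hasDerivAt_const _ _)) ?_
  unfold rotPrimitive hartogsKernelDerivFst hartogsKernel
  simp only [map_mul, conj_exp_ofReal_mul_I]
  generalize 1 - z.2 * conj w.2 = E at *
  generalize (z.2 * conj w.2) ^ n = Y at *
  have h1 : HasDerivAt (fun t : ℝ => Complex.exp (t * -Complex.I) * conj w.1)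
    (-Complex.I * conj w.1) 0 := hasDerivAt_exp_mul (-Complex.I) (conj w.1)
  have h2 : HasDerivAt (fun t : ℝ => z.1 * (Complex.exp (t * -Complex.I) * conj w.1))
    (z.1 * (-Complex.I * conj w.1)) 0 := h1.const_mul z.1
  have h3 := (h1.fun_mul (h2.const_sub (2 * Y))).fun_div
    (((((h2.const_sub Y).fun_pow 2).const_mul Y).mul_const (E ^ 2)).const_mul ((Real.pi : ℂ) ^ 2))
    (by simpa using ⟨⟨hY, hD⟩, hE⟩)
  refine h3.congr_deriv ?_
  simp only [Complex.ofReal_zero, zero_mul, Complex.exp_zero, one_mul]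
  generalize conj w.1 = c at *
  simp
  field_simp
  ring

end Derivatives

/-! ### Convergence and differentiation of the Bergman projection -/

section Convergence

variable {n : ℕ} {z w : ℂ × ℂ} {f : ℂ × ℂ → ℂ}

theorem aestronglyMeasurable_hartogsKernel (z : ℂ × ℂ) :
    AEStronglyMeasurable (hartogsKernel n z) (lebesgueOn (thinHartogs n)) :=
  ((measurable_hartogsKernel n).comp measurable_prodMk_left).aestronglyMeasurable

theorem integrable_hartogsKernel_mul (hn : 1 ≤ n) (hz : z ∈ thinHartogs n)
    (hfm : AEStronglyMeasurable f (lebesgueOn (thinHartogs n)))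
    (hf : Integrable (fun w => (‖w.2‖ ^ n)⁻¹ * ‖f w‖) (lebesgueOn (thinHartogs n))) :
    Integrable (fun w => hartogsKernel n z w * f w) (lebesgueOn (thinHartogs n)) := by
  obtain ⟨C, hC, hb⟩ := exists_norm_hartogsKernel_le hn hz
  refine (hf.const_mul C).mono' ((aestronglyMeasurable_hartogsKernel z).mul hfm) ?_
  refine ae_restrict_of_forall_mem (isOpen_thinHartogs hn).measurableSet fun w hw => ?_
  rw [norm_mul, ← mul_assoc]
  exact mul_le_mul_of_nonneg_right (hb w hw) (norm_nonneg _)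

theorem thinHartogs_nonempty (hn : 1 ≤ n) : ((0, 1 / 2) : ℂ × ℂ) ∈ thinHartogs n := by
  rw [mem_thinHartogs hn]
  norm_num

/-- For each fixed z the kernel is bounded above and below in w by multiples of |w₂|⁻ⁿ. Convergence
at the one point (0, 1/2) thus gives the weighted condition, which gives convergence everywhere. -/
theorem bergmanConverges_iff (hn : 1 ≤ n)
    (hfm : AEStronglyMeasurable f (lebesgueOn (thinHartogs n))) :
    BergmanConverges (thinHartogs n) f ↔
      Integrable (fun w => (‖w.2‖ ^ n)⁻¹ * ‖f w‖) (lebesgueOn (thinHartogs n)) := by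
  have hΩ := (isOpen_thinHartogs hn).measurableSet
  have hcongr : ∀ z ∈ thinHartogs n, (fun w => bergmanKernel (thinHartogs n) z w * f w)
      =ᵐ[lebesgueOn (thinHartogs n)] fun w => hartogsKernel n z w * f w := fun z hz =>
    ae_restrict_of_forall_mem hΩ fun w hw => by
      simp only [bergmanKernel_thinHartogs hn hz hw]
  refine ⟨fun h => ?_, fun h z hz =>
    (integrable_congr (hcongr z hz)).2 (integrable_hartogsKernel_mul hn hz hfm h)⟩
  have hz := thinHartogs_nonempty hn
  set z : ℂ × ℂ := (0, 1 / 2)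
  have h1 := (integrable_congr (hcongr z hz)).1 (h z hz)
  have hz2 := norm_snd_pos hz
  set c := (Real.pi ^ 2)⁻¹ * ((‖z.2‖ ^ n)⁻¹ * (16 : ℝ)⁻¹) with hc
  have hc0 : 0 < c := by positivity
  refine (h1.norm.const_mul c⁻¹).mono' (by fun_prop) ?_
  refine ae_restrict_of_forall_mem hΩ fun w hw => ?_
  have h2 := le_bidiscWeight hn hz hw
  have h3 : c * (‖w.2‖ ^ n)⁻¹ ≤ ‖hartogsKernel n z w‖ := by
    rw [norm_hartogsKernel hz hw]
    calc c * (‖w.2‖ ^ n)⁻¹ = (Real.pi ^ 2)⁻¹ * ((‖z.2‖ ^ n)⁻¹ * (‖w.2‖ ^ n)⁻¹ * (16 : ℝ)⁻¹) := by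
          rw [hc]; ring
      _ ≤ _ := by gcongr
  rw [Real.norm_of_nonneg (by positivity), norm_mul, le_inv_mul_iff₀ hc0, ← mul_assoc]
  gcongr

theorem bergmanProj_eq (hn : 1 ≤ n) (hz : z ∈ thinHartogs n) :
    bergmanProj (thinHartogs n) f z = ∫ w in thinHartogs n, hartogsKernel n z w * f w :=
  setIntegral_congr_fun (isOpen_thinHartogs hn).measurableSet fun w hw => by
    simp only [bergmanKernel_thinHartogs hn hz hw]

theorem mul_le_norm_pow_sub (hn : 1 ≤ n) (hz : z ∈ thinHartogs n) (hw : w ∈ thinHartogs n)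
    {r : ℝ} (h1 : ‖z.1 / z.2 ^ n‖ ≤ r) :
    ‖(z.2 * conj w.2) ^ n‖ * (1 - r) ≤ ‖(z.2 * conj w.2) ^ n - z.1 * conj w.1‖ := by
  rw [pow_sub_eq_mul (norm_pos_iff.1 (norm_snd_pos hz)) (norm_pos_iff.1 (norm_snd_pos hw)),
    norm_mul]
  have := one_sub_le_norm_one_sub_mul_conj (a := z.1 / z.2 ^ n) (norm_fst_div_lt_one hn hw)
  gcongr
  linarith

/-- The constants r and c make the bound uniform for z near a given point. The kernel and both its
derivatives satisfy such bounds with the same weight |w₂|⁻ⁿ, so convergence of the integral already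
permits differentiation under it. -/
theorem norm_hartogsKernel_le (hn : 1 ≤ n) (hz : z ∈ thinHartogs n) (hw : w ∈ thinHartogs n)
    {r c : ℝ} (hr : r < 1) (hc : 0 < c) (h1 : ‖z.1 / z.2 ^ n‖ ≤ r) (h2 : ‖z.2‖ ≤ r)
    (h3 : c ≤ ‖z.2‖) :
    ‖hartogsKernel n z w‖ ≤ (c ^ n)⁻¹ * ((1 - r) ^ 4)⁻¹ * (‖w.2‖ ^ n)⁻¹ := by
  have hwp := norm_snd_pos hw
  have hr' : 0 < 1 - r := by linarith
  have hpi : (Real.pi ^ 2)⁻¹ ≤ 1 := inv_le_one_of_one_le₀ (by nlinarith [Real.pi_gt_three])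
  rw [norm_hartogsKernel hz hw]
  have hQ0 := bidiscWeight_nonneg n z w
  have hQ := bidiscWeight_le hn hr h1 h2 hw
  calc _ ≤ 1 * ((c ^ n)⁻¹ * (‖w.2‖ ^ n)⁻¹ * ((1 - r) ^ 4)⁻¹) := by gcongr
    _ = _ := by ring

/-- The denominator gained by differentiating is of size |w₂|ⁿ, compensated by the numerator w̄₁
since |w₁| < |w₂|ⁿ. -/
theorem norm_hartogsKernelDerivFst_le (hn : 1 ≤ n) (hz : z ∈ thinHartogs n)
    (hw : w ∈ thinHartogs n) {r c : ℝ} (hr : r < 1) (hc : 0 < c) (h1 : ‖z.1 / z.2 ^ n‖ ≤ r)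
    (h2 : ‖z.2‖ ≤ r) (h3 : c ≤ ‖z.2‖) : ‖hartogsKernelDerivFst n z w‖ ≤
      (c ^ n)⁻¹ * ((1 - r) ^ 4)⁻¹ * (‖w.2‖ ^ n)⁻¹ * (2 / (c ^ n * (1 - r))) := by
  have hwp := norm_snd_pos hw
  have hr' : 0 < 1 - r := by linarith
  unfold hartogsKernelDerivFst
  rw [norm_mul]
  have hK := norm_hartogsKernel_le hn hz hw hr hc h1 h2 h3
  have hD := mul_le_norm_pow_sub hn hz hw h1
  have hD' : c ^ n * ‖w.2‖ ^ n * (1 - r) ≤ ‖(z.2 * conj w.2) ^ n - z.1 * conj w.1‖ := by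
    refine le_trans ?_ hD
    rw [norm_pow, norm_mul, RCLike.norm_conj, mul_pow]
    gcongr
  have hw1 := ((mem_thinHartogs hn).1 hw).1.le
  refine mul_le_mul hK ?_ (norm_nonneg _) (by positivity)
  rw [norm_div, norm_mul, RCLike.norm_conj, Complex.norm_ofNat]
  calc _ ≤ 2 * ‖w.2‖ ^ n / (c ^ n * ‖w.2‖ ^ n * (1 - r)) := by gcongr
    _ = _ := by field_simp

theorem norm_hartogsKernelDerivSnd_le (hn : 1 ≤ n) (hz : z ∈ thinHartogs n)
    (hw : w ∈ thinHartogs n) {r c : ℝ} (hr : r < 1) (hc : 0 < c) (h1 : ‖z.1 / z.2 ^ n‖ ≤ r)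
    (h2 : ‖z.2‖ ≤ r) (h3 : c ≤ ‖z.2‖) : ‖hartogsKernelDerivSnd n z w‖ ≤
      (c ^ n)⁻¹ * ((1 - r) ^ 4)⁻¹ * (‖w.2‖ ^ n)⁻¹ *
        ((n + 2 * n * (1 - r)⁻¹ + 2 * (1 - r)⁻¹) / c) := by
  have hwp := norm_snd_pos hw
  have hr' : 0 < 1 - r := by linarith
  unfold hartogsKernelDerivSnd
  rw [norm_mul]
  have hK := norm_hartogsKernel_le hn hz hw hr hc h1 h2 h3
  have hD := mul_le_norm_pow_sub hn hz hw h1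
  have hY : 0 < ‖(z.2 * conj w.2) ^ n‖ := norm_pos_iff.2 (mul_conj_pow_ne_zero hz hw)
  have e1 : ‖(z.2 * conj w.2) ^ n / ((z.2 * conj w.2) ^ n - z.1 * conj w.1)‖ ≤ (1 - r)⁻¹ := by
    rw [norm_div, div_le_iff₀ (lt_of_lt_of_le (by positivity) hD), inv_mul_eq_div, le_div_iff₀ hr']
    exact hD
  have hw2 := ((mem_thinHartogs hn).1 hw).2
  have hz2 := ((mem_thinHartogs hn).1 hz).2
  have e2 : ‖2 * (z.2 * conj w.2) / (1 - z.2 * conj w.2)‖ ≤ 2 * (1 - r)⁻¹ := by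
    have h4 := one_sub_le_norm_one_sub_mul_conj (a := z.2) hw2
    rw [norm_div, norm_mul, norm_mul, RCLike.norm_conj, Complex.norm_ofNat, ← div_eq_mul_inv]
    have h5 : ‖z.2‖ * ‖w.2‖ ≤ 1 := mul_le_one₀ hz2.le (norm_nonneg _) hw2.le
    gcongr
    · linarith
    · linarith
  refine mul_le_mul hK ?_ (norm_nonneg _) (by positivity)
  rw [norm_div]
  gcongr
  refine (norm_add_le _ _).trans (add_le_add ((norm_sub_le _ _).trans (add_le_add ?_ ?_)) e2)
  · simp
  · rw [norm_mul, norm_mul, Complex.norm_ofNat, Complex.norm_natCast]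
    gcongr

theorem hasFDerivAt_bergmanProj (hn : 1 ≤ n) (hz : z ∈ thinHartogs n)
    (hfm : AEStronglyMeasurable f (lebesgueOn (thinHartogs n)))
    (hf : BergmanConverges (thinHartogs n) f) :
    Integrable (fun w => f w • (hartogsKernelDerivFst n z w • ContinuousLinearMap.fst ℂ ℂ ℂ +
      hartogsKernelDerivSnd n z w • ContinuousLinearMap.snd ℂ ℂ ℂ)) (lebesgueOn (thinHartogs n)) ∧
    HasFDerivAt (bergmanProj (thinHartogs n) f) (∫ w in thinHartogs n,
      f w • (hartogsKernelDerivFst n z w • ContinuousLinearMap.fst ℂ ℂ ℂ +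
        hartogsKernelDerivSnd n z w • ContinuousLinearMap.snd ℂ ℂ ℂ)) z := by
  have hΩ := isOpen_thinHartogs hn
  have hfi := (bergmanConverges_iff hn hfm).1 hf
  have h1 := norm_fst_div_lt_one hn hz
  have h2 := ((mem_thinHartogs hn).1 hz).2
  have hz2 := norm_snd_pos hz
  obtain ⟨r, hr1, hr⟩ := exists_between (max_lt h1 h2)
  rw [max_lt_iff] at hr1
  set c := ‖z.2‖ / 2 with hc
  have hc0 : 0 < c := by positivity
  have hr' : 0 < 1 - r := by linarith
  set s : Set (ℂ × ℂ) := {x | x ∈ thinHartogs n ∧ ‖x.1 / x.2 ^ n‖ ≤ r ∧ ‖x.2‖ ≤ r ∧ c ≤ ‖x.2‖}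
    with hs
  have hsn : s ∈ nhds z := by
    have c1 : ContinuousAt (fun x : ℂ × ℂ => ‖x.1 / x.2 ^ n‖) z := by
      refine ContinuousAt.norm (ContinuousAt.div (by fun_prop) (by fun_prop) ?_)
      exact pow_ne_zero _ (norm_pos_iff.1 hz2)
    have c2 : ContinuousAt (fun x : ℂ × ℂ => ‖x.2‖) z := by fun_prop
    filter_upwards [hΩ.mem_nhds hz, c1.eventually_le_const hr1.1, c2.eventually_le_const hr1.2,
      c2.eventually_const_le (show c < ‖z.2‖ by linarith)] with x a1 a2 a3 a4
    exact ⟨a1, a2, a3, a4⟩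
  set A := (c ^ n)⁻¹ * ((1 - r) ^ 4)⁻¹ * (2 / (c ^ n * (1 - r))) +
    (c ^ n)⁻¹ * ((1 - r) ^ 4)⁻¹ * ((n + 2 * n * (1 - r)⁻¹ + 2 * (1 - r)⁻¹) / c) with hA
  have hmeas : ∀ x : ℂ × ℂ, AEStronglyMeasurable (fun w => f w •
      (hartogsKernelDerivFst n x w • ContinuousLinearMap.fst ℂ ℂ ℂ +
        hartogsKernelDerivSnd n x w • ContinuousLinearMap.snd ℂ ℂ ℂ))
      (lebesgueOn (thinHartogs n)) := by
    intro x
    have m1 : AEStronglyMeasurable (hartogsKernelDerivFst n x) (lebesgueOn (thinHartogs n)) :=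
      ((measurable_hartogsKernelDerivFst n).comp measurable_prodMk_left).aestronglyMeasurable
    have m2 : AEStronglyMeasurable (hartogsKernelDerivSnd n x) (lebesgueOn (thinHartogs n)) :=
      ((measurable_hartogsKernelDerivSnd n).comp measurable_prodMk_left).aestronglyMeasurable
    exact hfm.smul ((m1.smul aestronglyMeasurable_const).add (m2.smul aestronglyMeasurable_const))
  have hbound : ∀ w ∈ thinHartogs n, ∀ x ∈ s, ‖f w •
      (hartogsKernelDerivFst n x w • ContinuousLinearMap.fst ℂ ℂ ℂ +
        hartogsKernelDerivSnd n x w • ContinuousLinearMap.snd ℂ ℂ ℂ)‖ ≤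
      A * ((‖w.2‖ ^ n)⁻¹ * ‖f w‖) := by
    intro w hw x hx
    have b1 := norm_hartogsKernelDerivFst_le hn hx.1 hw hr hc0 hx.2.1 hx.2.2.1 hx.2.2.2
    have b2 := norm_hartogsKernelDerivSnd_le hn hx.1 hw hr hc0 hx.2.1 hx.2.2.1 hx.2.2.2
    rw [norm_smul]
    have b3 : ‖hartogsKernelDerivFst n x w • ContinuousLinearMap.fst ℂ ℂ ℂ +
        hartogsKernelDerivSnd n x w • ContinuousLinearMap.snd ℂ ℂ ℂ‖ ≤
        ‖hartogsKernelDerivFst n x w‖ + ‖hartogsKernelDerivSnd n x w‖ := by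
      refine (norm_add_le _ _).trans (add_le_add ?_ ?_) <;> rw [norm_smul]
      · exact mul_le_of_le_one_right (norm_nonneg _) (ContinuousLinearMap.norm_fst_le ℂ ℂ ℂ)
      · exact mul_le_of_le_one_right (norm_nonneg _) (ContinuousLinearMap.norm_snd_le ℂ ℂ ℂ)
    calc _ ≤ ‖f w‖ * _ := mul_le_mul_of_nonneg_left (b3.trans (add_le_add b1 b2)) (norm_nonneg _)
      _ = A * ((‖w.2‖ ^ n)⁻¹ * ‖f w‖) := by rw [hA]; ring
  have hae := ae_restrict_of_forall_mem (μ := volume) hΩ.measurableSet hbound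
  refine ⟨(hfi.const_mul A).mono' (hmeas z) (hae.mono fun w hw => hw z (mem_of_mem_nhds hsn)), ?_⟩
  have key := hasFDerivAt_integral_of_dominated_of_fderiv_le (μ := lebesgueOn (thinHartogs n))
    (F := fun x w => hartogsKernel n x w * f w) (F' := fun x w => f w •
      (hartogsKernelDerivFst n x w • ContinuousLinearMap.fst ℂ ℂ ℂ +
        hartogsKernelDerivSnd n x w • ContinuousLinearMap.snd ℂ ℂ ℂ)) hsn
    (Filter.Eventually.of_forall fun x => (aestronglyMeasurable_hartogsKernel x).mul hfm)
    (integrable_hartogsKernel_mul hn hz hfm hfi) (hmeas z) hae (hfi.const_mul A)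
    (ae_restrict_of_forall_mem hΩ.measurableSet fun w hw x hx =>
      (hasFDerivAt_hartogsKernel hn hx.1 hw).mul_const (f w))
  refine key.congr_of_eventuallyEq ?_
  filter_upwards [hΩ.mem_nhds hz] with x hx using bergmanProj_eq hn hx

theorem differentiableOn_bergmanProj (hn : 1 ≤ n)
    (hfm : AEStronglyMeasurable f (lebesgueOn (thinHartogs n)))
    (hf : BergmanConverges (thinHartogs n) f) :
    DifferentiableOn ℂ (bergmanProj (thinHartogs n) f) (thinHartogs n) := fun _ hz =>
  (hasFDerivAt_bergmanProj hn hz hfm hf).2.differentiableAt.differentiableWithinAt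

theorem integral_hartogsKernelDeriv (hn : 1 ≤ n) (hz : z ∈ thinHartogs n)
    (hfm : AEStronglyMeasurable f (lebesgueOn (thinHartogs n)))
    (hf : BergmanConverges (thinHartogs n) f) (v : ℂ × ℂ) :
    Integrable (fun w => (hartogsKernelDerivFst n z w * v.1 + hartogsKernelDerivSnd n z w * v.2) *
      f w) (lebesgueOn (thinHartogs n)) ∧
    fderiv ℂ (bergmanProj (thinHartogs n) f) z v = ∫ w in thinHartogs n,
      (hartogsKernelDerivFst n z w * v.1 + hartogsKernelDerivSnd n z w * v.2) * f w := by
  obtain ⟨h1, h2⟩ := hasFDerivAt_bergmanProj hn hz hfm hf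
  have e : ∀ w, (f w • (hartogsKernelDerivFst n z w • ContinuousLinearMap.fst ℂ ℂ ℂ +
      hartogsKernelDerivSnd n z w • ContinuousLinearMap.snd ℂ ℂ ℂ)) v =
      (hartogsKernelDerivFst n z w * v.1 + hartogsKernelDerivSnd n z w * v.2) * f w := by
    intro w; simp; ring
  refine ⟨by simpa only [e] using h1.apply_continuousLinearMap v, ?_⟩
  rw [h2.fderiv, ContinuousLinearMap.integral_apply h1]
  simp only [e]

end Convergence

/-! ### Derivatives of the projection as integrals of angular derivatives -/

section Representation

variable {n : ℕ} {z w : ℂ × ℂ} {f : ℂ × ℂ → ℂ} {g : Fin 4 → ℂ × ℂ → ℂ}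

theorem norm_sum_rotOne_le (w : ℂ × ℂ) (g : Fin 4 → ℂ) :
    ‖∑ j, rotOne j w • g j‖ ≤ ‖w.1‖ * ∑ j, ‖g j‖ := by
  rw [Finset.mul_sum]
  refine norm_sum_le_of_le _ fun j _ => ?_
  rw [norm_smul]
  gcongr
  fin_cases j <;> simp [rotOne, Complex.abs_im_le_norm, Complex.abs_re_le_norm]

theorem norm_sum_rotTwo_le (w : ℂ × ℂ) (g : Fin 4 → ℂ) :
    ‖∑ j, rotTwo j w • g j‖ ≤ ‖w.2‖ * ∑ j, ‖g j‖ := by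
  rw [Finset.mul_sum]
  refine norm_sum_le_of_le _ fun j _ => ?_
  rw [norm_smul]
  gcongr
  fin_cases j <;> simp [rotTwo, Complex.abs_im_le_norm, Complex.abs_re_le_norm]

theorem aestronglyMeasurable_sum_coeff (c : Fin 4 → ℂ × ℂ →L[ℝ] ℝ) {μ : Measure (ℂ × ℂ)}
    (hg : ∀ j, AEStronglyMeasurable (g j) μ) :
    AEStronglyMeasurable (fun w => ∑ j, c j w • g j w) μ := by
  refine Finset.aestronglyMeasurable_fun_sum _ fun j _ => ?_
  exact ((c j).continuous.aestronglyMeasurable).smul (hg j)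

/-- The factor |w₁| comes from the angular derivative. Together with the w̄₁ in the primitive it is
worth |w₂|²ⁿ and cancels every power of w₂; the 3 from the numerator is absorbed by π² ≥ 3. -/
theorem norm_rotPrimitive_mul_le (hn : 1 ≤ n) (hz : z ∈ thinHartogs n) (hw : w ∈ thinHartogs n) :
    ‖rotPrimitive n z w‖ * ‖w.1‖ ≤ (‖z.2‖ ^ (2 * n))⁻¹ * bidiscWeight n z w := by
  have hz2 : z.2 ≠ 0 := norm_pos_iff.1 (norm_snd_pos hz)
  have hw2 : w.2 ≠ 0 := norm_pos_iff.1 (norm_snd_pos hw)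
  have hzp := norm_snd_pos hz
  have hwp := norm_snd_pos hw
  have hx := norm_one_sub_mul_conj_pos (norm_fst_div_lt_one hn hz) (norm_fst_div_lt_one hn hw)
  have hy := norm_pos_iff.2 (one_sub_snd_ne_zero hn hz hw)
  have hw1 := ((mem_thinHartogs hn).1 hw).1.le
  have hpi : 3 ≤ Real.pi ^ 2 := by nlinarith [Real.pi_gt_three]
  have hnum : ‖2 * (z.2 * conj w.2) ^ n - z.1 * conj w.1‖ ≤ 3 * ‖(z.2 * conj w.2) ^ n‖ := by
    have hz1 := ((mem_thinHartogs hn).1 hz).1.le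
    refine (norm_sub_le _ _).trans ?_
    rw [norm_mul, norm_mul, Complex.norm_ofNat, norm_pow, norm_mul, RCLike.norm_conj,
      RCLike.norm_conj, mul_pow]
    have : ‖z.1‖ * ‖w.1‖ ≤ ‖z.2‖ ^ n * ‖w.2‖ ^ n := by gcongr
    linarith
  unfold rotPrimitive bidiscWeight
  rw [pow_sub_eq_mul hz2 hw2, norm_div, norm_mul, RCLike.norm_conj, norm_mul, norm_mul, norm_mul,
    norm_pow _ 2, norm_pow _ 2, norm_mul ((z.2 * conj w.2) ^ n), norm_pow _ 2, Complex.norm_real,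
    Real.norm_of_nonneg Real.pi_pos.le]
  set X := ‖1 - z.1 / z.2 ^ n * conj (w.1 / w.2 ^ n)‖
  set E := ‖1 - z.2 * conj w.2‖
  have hY : ‖(z.2 * conj w.2) ^ n‖ = ‖z.2‖ ^ n * ‖w.2‖ ^ n := by
    rw [norm_pow, norm_mul, RCLike.norm_conj, mul_pow]
  rw [hY] at hnum ⊢
  calc _ ≤ ‖w.2‖ ^ n * (3 * (‖z.2‖ ^ n * ‖w.2‖ ^ n)) / (3 * (‖z.2‖ ^ n * ‖w.2‖ ^ n *
        (‖z.2‖ ^ n * ‖w.2‖ ^ n * X) ^ 2 * E ^ 2)) * ‖w.2‖ ^ n := by gcongr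
    _ = _ := by field_simp; ring

/-- No weight on the derivatives is needed, so this integral makes sense even for functions whose
Bergman integral diverges. That is what makes the extension in the first part possible. -/
theorem integrable_rotPrimitive_mul (hn : 1 ≤ n) (hz : z ∈ thinHartogs n)
    (hg : ∀ j, Integrable (g j) (lebesgueOn (thinHartogs n))) :
    Integrable (fun w => rotPrimitive n z w * ∑ j, rotOne j w • g j w)
      (lebesgueOn (thinHartogs n)) := by
  have hzp := norm_snd_pos hz
  set r := max ‖z.1 / z.2 ^ n‖ ‖z.2‖
  have hr : r < 1 := max_lt (norm_fst_div_lt_one hn hz) ((mem_thinHartogs hn).1 hz).2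
  have hm : AEStronglyMeasurable (rotPrimitive n z) (lebesgueOn (thinHartogs n)) :=
    ((measurable_rotPrimitive n).comp measurable_prodMk_left).aestronglyMeasurable
  have hgi : Integrable (fun w => ∑ j, ‖g j w‖) (lebesgueOn (thinHartogs n)) :=
    integrable_finsetSum _ fun j _ => (hg j).norm
  refine (hgi.const_mul ((‖z.2‖ ^ (2 * n))⁻¹ * ((1 - r) ^ 4)⁻¹)).mono'
    (hm.mul (aestronglyMeasurable_sum_coeff _ fun j => (hg j).1)) ?_
  refine ae_restrict_of_forall_mem (isOpen_thinHartogs hn).measurableSet fun w hw => ?_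
  have h1 := bidiscWeight_le hn hr (le_max_left _ _) (le_max_right _ _) hw
  rw [norm_mul]
  calc _ ≤ ‖rotPrimitive n z w‖ * (‖w.1‖ * ∑ j, ‖g j w‖) := by
        gcongr; exact norm_sum_rotOne_le _ _
    _ = ‖rotPrimitive n z w‖ * ‖w.1‖ * ∑ j, ‖g j w‖ := by ring
    _ ≤ _ := by
      refine mul_le_mul_of_nonneg_right ?_ (by positivity)
      exact (norm_rotPrimitive_mul_le hn hz hw).trans (by gcongr)

theorem integrable_hartogsKernel_mul_rotTwo (hn : 1 ≤ n) (hz : z ∈ thinHartogs n)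
    (hgm : ∀ j, AEStronglyMeasurable (g j) (lebesgueOn (thinHartogs n)))
    (hg : ∀ j, Integrable (fun w => (‖w.2‖ ^ n)⁻¹ * ‖w.2‖ * ‖g j w‖)
      (lebesgueOn (thinHartogs n))) :
    Integrable (fun w => hartogsKernel n z w * ∑ j, rotTwo j w • g j w)
      (lebesgueOn (thinHartogs n)) := by
  refine integrable_hartogsKernel_mul hn hz (aestronglyMeasurable_sum_coeff _ hgm) ?_
  have hgi : Integrable (fun w => ∑ j, (‖w.2‖ ^ n)⁻¹ * ‖w.2‖ * ‖g j w‖)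
    (lebesgueOn (thinHartogs n)) := integrable_finsetSum _ fun j _ => hg j
  have hm := aestronglyMeasurable_sum_coeff rotTwo hgm
  refine hgi.mono' (by fun_prop) (Filter.Eventually.of_forall fun w => ?_)
  rw [Real.norm_of_nonneg (by positivity), ← Finset.mul_sum, mul_assoc]
  gcongr
  exact norm_sum_rotTwo_le _ _

/-- The derivative of the Bergman projection in the first variable, in terms of the angular
derivative of the function. -/
theorem fderiv_bergmanProj_fst (hn : 1 ≤ n) (hz : z ∈ thinHartogs n)
    (hfm : AEStronglyMeasurable f (lebesgueOn (thinHartogs n)))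
    (hf : BergmanConverges (thinHartogs n) f)
    (h : ∀ j, HasWeakDeriv (thinHartogs n) (realDir j) f (g j))
    (hg : ∀ j, Integrable (g j) (lebesgueOn (thinHartogs n))) :
    fderiv ℂ (bergmanProj (thinHartogs n) f) z (1, 0) =
      -Complex.I * ∫ w in thinHartogs n, rotPrimitive n z w * ∑ j, rotOne j w • g j w := by
  have hΩ := (isOpen_thinHartogs hn).measurableSet
  obtain ⟨h1, h2⟩ := integral_hartogsKernelDeriv hn hz hfm hf (1, 0)
  simp only [mul_one, mul_zero, add_zero] at h1 h2
  have e : ∀ w ∈ thinHartogs n, fderiv ℝ (rotPrimitive n z) w (coordField rotOne w) * f w =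
      -Complex.I * (hartogsKernelDerivFst n z w * f w) := fun w hw => by
    rw [fderiv_rotPrimitive_rotOne hn hz hw]; ring
  have key := integral_fderiv_coordField_mul hn div_rotOne (fderiv_cutoff_rotOne n) h
    (contDiffOn_rotPrimitive hn hz)
    ((integrable_congr (ae_restrict_of_forall_mem hΩ e)).2 (h1.const_mul _))
    (integrable_rotPrimitive_mul hn hz hg)
  rw [setIntegral_congr_fun hΩ e, integral_const_mul, ← h2] at key
  linear_combination Complex.I * key + fderiv ℂ (bergmanProj (thinHartogs n) f) z (1, 0) *
    Complex.I_mul_I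

/-- The derivative of the Bergman projection in the second variable, in terms of the angular
derivative of the function. -/
theorem fderiv_bergmanProj_snd (hn : 1 ≤ n) (hz : z ∈ thinHartogs n)
    (hfm : AEStronglyMeasurable f (lebesgueOn (thinHartogs n)))
    (hf : BergmanConverges (thinHartogs n) f)
    (h : ∀ j, HasWeakDeriv (thinHartogs n) (realDir j) f (g j))
    (hgm : ∀ j, AEStronglyMeasurable (g j) (lebesgueOn (thinHartogs n)))
    (hg : ∀ j, Integrable (fun w => (‖w.2‖ ^ n)⁻¹ * ‖w.2‖ * ‖g j w‖)
      (lebesgueOn (thinHartogs n))) :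
    fderiv ℂ (bergmanProj (thinHartogs n) f) z (0, 1) =
      -Complex.I / z.2 * ∫ w in thinHartogs n, hartogsKernel n z w * ∑ j, rotTwo j w • g j w := by
  have hΩ := (isOpen_thinHartogs hn).measurableSet
  have hz2 : z.2 ≠ 0 := norm_pos_iff.1 (norm_snd_pos hz)
  obtain ⟨h1, h2⟩ := integral_hartogsKernelDeriv hn hz hfm hf (0, 1)
  simp only [mul_one, mul_zero, zero_add] at h1 h2
  have e : ∀ w ∈ thinHartogs n, fderiv ℝ (hartogsKernel n z) w (coordField rotTwo w) * f w =
      -Complex.I * z.2 * (hartogsKernelDerivSnd n z w * f w) := fun w hw => by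
    rw [fderiv_hartogsKernel_rotTwo hn hz hw]; ring
  have key := integral_fderiv_coordField_mul hn div_rotTwo (fderiv_cutoff_rotTwo n) h
    (contDiffOn_hartogsKernel hn hz)
    ((integrable_congr (ae_restrict_of_forall_mem hΩ e)).2 (h1.const_mul _))
    (integrable_hartogsKernel_mul_rotTwo hn hz hgm hg)
  rw [setIntegral_congr_fun hΩ e, integral_const_mul, ← h2] at key
  field_simp
  linear_combination Complex.I * key + z.2 * fderiv ℂ (bergmanProj (thinHartogs n) f) z (0, 1) *
    Complex.I_mul_I

end Representation

/-! ### Norm estimates -/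

section Estimates

variable {n : ℕ} {p : ℝ}

theorem eLpNorm_ofReal_eq (hp : 0 < p) {μ : Measure (ℂ × ℂ)} (f : ℂ × ℂ → ℂ) :
    eLpNorm f (ENNReal.ofReal p) μ = (∫⁻ x, ‖f x‖ₑ ^ p ∂μ) ^ (1 / p) := by
  rw [eLpNorm_eq_lintegral_rpow_enorm_toReal (by simpa using hp) ENNReal.ofReal_ne_top,
    ENNReal.toReal_ofReal hp.le]

theorem eLpNorm_weakDeriv_le_sobolevNorm (hp : 0 < p) {Ω : Set (ℂ × ℂ)} (f : ℂ × ℂ → ℂ)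
    (j : Fin 4) : eLpNorm (weakDeriv Ω (realDir j) f) (ENNReal.ofReal p) (lebesgueOn Ω) ≤
      sobolevNorm Ω p f := by
  rw [eLpNorm_ofReal_eq hp, sobolevNorm]
  gcongr
  refine le_add_left ?_
  exact Finset.single_le_sum (f := fun i => ∫⁻ x in Ω, ‖weakDeriv Ω (realDir i) f x‖ₑ ^ p)
    (fun _ _ => zero_le) (Finset.mem_univ j)

theorem lintegral_rpow_enorm_lt_top (hp : 0 < p) {μ : Measure (ℂ × ℂ)} {f : ℂ × ℂ → ℂ}
    (h : MemLp f (ENNReal.ofReal p) μ) : ∫⁻ x, ‖f x‖ₑ ^ p ∂μ < ⊤ := by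
  have h1 := h.2
  rw [eLpNorm_ofReal_eq hp] at h1
  exact (ENNReal.rpow_lt_top_iff_of_pos (by positivity)).1 h1

theorem MemSobolevOne.sobolevNorm_lt_top (hp : 0 < p) {Ω : Set (ℂ × ℂ)} (hΩ : IsOpen Ω)
    {f : ℂ × ℂ → ℂ} (h : MemSobolevOne Ω p f) : sobolevNorm Ω p f < ⊤ := by
  refine ENNReal.rpow_lt_top_of_nonneg (by positivity) (ENNReal.add_lt_top.2
    ⟨lintegral_rpow_enorm_lt_top hp h.1, ENNReal.sum_lt_top.2 fun j _ => ?_⟩).ne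
  exact lintegral_rpow_enorm_lt_top hp (h.memLp_weakDeriv hΩ j)

/-- Common form of the two derivative estimates: the weighted kernel acts on the sum of the four
derivative norms, which accounts for the factor 4. -/
theorem exists_eLpNorm_le_of_enorm_le (hn : 1 ≤ n) {m s : ℝ} (hp : 1 < p)
    (hs1 : 2 * n - m ≤ s) (hs2 : s < 2 * n - m + 2) (hs3 : m * (p - 1) ≤ s)
    (hs4 : s < (m + 2) * (p - 1)) :
    ∃ C : ℝ≥0, ∀ (f F : ℂ × ℂ → ℂ), MemSobolevOne (thinHartogs n) p f →
      (∀ z ∈ thinHartogs n, ‖F z‖ₑ ≤ ∫⁻ w in thinHartogs n, ENNReal.ofReal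
        (‖z.2‖ ^ (-m) * ‖w.2‖ ^ (m - 2 * n) * bidiscWeight n z w) *
          ∑ j, ‖weakDeriv (thinHartogs n) (realDir j) f w‖ₑ) →
      eLpNorm F (ENNReal.ofReal p) (lebesgueOn (thinHartogs n)) ≤
        C * sobolevNorm (thinHartogs n) p f := by
  obtain ⟨C, hC⟩ := exists_lintegral_rpow_bidiscWeight_le hn hp hs1 hs2 hs3 hs4
  have hΩ := isOpen_thinHartogs hn
  have hp0 : 0 < p := by linarith
  refine ⟨C ^ (1 / p) * 4, fun f F hf hF => ?_⟩
  set g := fun j => weakDeriv (thinHartogs n) (realDir j) f with hg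
  have hgm : ∀ j, AEStronglyMeasurable (fun w => ‖g j w‖) (lebesgueOn (thinHartogs n)) :=
    fun j => (hf.memLp_weakDeriv hΩ j).1.norm
  set G : ℂ × ℂ → ℝ := fun w => ∑ j, ‖g j w‖ with hG
  have hGe : ∀ w, ∑ j, ‖g j w‖ₑ = ‖G w‖ₑ := by
    intro w
    rw [hG]
    simp only
    rw [Real.enorm_of_nonneg (by positivity), ENNReal.ofReal_sum_of_nonneg fun _ _ => norm_nonneg _]
    simp only [ofReal_norm]
  have hGm : AEStronglyMeasurable G (lebesgueOn (thinHartogs n)) :=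
    Finset.aestronglyMeasurable_fun_sum _ fun j _ => hgm j
  have h1 := hC (fun w => ‖G w‖ₑ) hGm.enorm
  have h2 : eLpNorm G (ENNReal.ofReal p) (lebesgueOn (thinHartogs n)) ≤
      4 * sobolevNorm (thinHartogs n) p f := by
    have h3 : G = ∑ j, fun w => ‖g j w‖ := by ext w; simp [hG]
    rw [h3]
    refine (eLpNorm_sum_le (fun j _ => hgm j) (by simpa using hp.le)).trans ?_
    calc _ ≤ ∑ _j : Fin 4, sobolevNorm (thinHartogs n) p f := by
          refine Finset.sum_le_sum fun j _ => ?_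
          rw [eLpNorm_norm]
          exact eLpNorm_weakDeriv_le_sobolevNorm hp0 f j
      _ = _ := by simp
  calc eLpNorm F (ENNReal.ofReal p) (lebesgueOn (thinHartogs n))
      = (∫⁻ z in thinHartogs n, ‖F z‖ₑ ^ p) ^ (1 / p) := eLpNorm_ofReal_eq hp0 F
    _ ≤ (C * ∫⁻ w in thinHartogs n, ‖G w‖ₑ ^ p) ^ (1 / p) := by
        gcongr
        refine le_trans (setLIntegral_mono' hΩ.measurableSet fun z hz => ?_) h1
        gcongr
        simpa only [← hGe] using hF z hz
    _ = C ^ (1 / p) * eLpNorm G (ENNReal.ofReal p) (lebesgueOn (thinHartogs n)) := by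
        rw [ENNReal.mul_rpow_of_nonneg _ _ (by positivity),
          eLpNorm_eq_lintegral_rpow_enorm_toReal (by simpa using hp0) ENNReal.ofReal_ne_top,
          ENNReal.toReal_ofReal hp0.le]
    _ ≤ C ^ (1 / p) * (4 * sobolevNorm (thinHartogs n) p f) := by gcongr
    _ = _ := by
        rw [ENNReal.coe_mul, ENNReal.coe_rpow_of_nonneg _ (by positivity), mul_assoc]
        rfl

theorem enorm_integral_mul_sum_le {k : ℂ × ℂ → ℂ} {W : ℂ × ℂ → ℝ} {ρ : ℂ × ℂ → ℝ}
    {c : Fin 4 → ℂ × ℂ →L[ℝ] ℝ} {g : Fin 4 → ℂ × ℂ → ℂ} {Ω : Set (ℂ × ℂ)} (hΩ : MeasurableSet Ω)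
    (hc : ∀ w, ‖∑ j, c j w • g j w‖ ≤ ρ w * ∑ j, ‖g j w‖)
    (hk : ∀ w ∈ Ω, ‖k w‖ * ρ w ≤ W w) :
    ‖∫ w in Ω, k w * ∑ j, c j w • g j w‖ₑ ≤
      ∫⁻ w in Ω, ENNReal.ofReal (W w) * ∑ j, ‖g j w‖ₑ := by
  refine (enorm_integral_le_lintegral_enorm _).trans (setLIntegral_mono' hΩ fun w hw => ?_)
  have h0 : 0 ≤ ∑ j, ‖g j w‖ := by positivity
  have h1 : ∑ j, ‖g j w‖ₑ = ENNReal.ofReal (∑ j, ‖g j w‖) := by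
    rw [ENNReal.ofReal_sum_of_nonneg fun _ _ => norm_nonneg _]
    simp only [ofReal_norm]
  rw [h1, ← ENNReal.ofReal_mul' h0, ← ofReal_norm, norm_mul]
  refine ENNReal.ofReal_le_ofReal ?_
  calc _ ≤ ‖k w‖ * (ρ w * ∑ j, ‖g j w‖) := by gcongr; exact hc w
    _ = ‖k w‖ * ρ w * ∑ j, ‖g j w‖ := by ring
    _ ≤ _ := by gcongr; exact hk w hw

theorem aestronglyMeasurable_integral_mul {k : ℂ × ℂ → ℂ × ℂ → ℂ}
    (hk : Measurable fun q : (ℂ × ℂ) × (ℂ × ℂ) => k q.1 q.2) {h : ℂ × ℂ → ℂ}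
    {μ : Measure (ℂ × ℂ)} [SFinite μ] (hh : AEStronglyMeasurable h μ) :
    AEStronglyMeasurable (fun z => ∫ w, k z w * h w ∂μ) μ := by
  have h1 : AEStronglyMeasurable (fun q : (ℂ × ℂ) × (ℂ × ℂ) => k q.1 q.2 * h q.2) (μ.prod μ) :=
    hk.aestronglyMeasurable.mul hh.comp_snd
  exact h1.integral_prod_right'

/-- Hölder's inequality against the weight `|w₂|^{1 - n}`. -/
theorem integrable_inv_norm_snd_pow_mul_of_memLp (hn : 1 ≤ n) (hp : 1 < p)
    (hp1 : (2 * n + 2) / (n + 3) < p) {g : ℂ × ℂ → ℂ}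
    (hg : MemLp g (ENNReal.ofReal p) (lebesgueOn (thinHartogs n))) :
    Integrable (fun w => (‖w.2‖ ^ n)⁻¹ * ‖w.2‖ * ‖g w‖) (lebesgueOn (thinHartogs n)) := by
  have hp0 : 0 < p := by linarith
  have hp2 : 0 < p - 1 := by linarith
  have hpq : (p / (p - 1)).HolderConjugate p := (Real.HolderConjugate.conjExponent hp).symm
  have hq0 := hpq.pos
  have : ENNReal.HolderConjugate (ENNReal.ofReal (p / (p - 1))) (ENNReal.ofReal p) :=
    hpq.ennrealOfReal
  refine MemLp.integrable_mul (p := ENNReal.ofReal (p / (p - 1))) (q := ENNReal.ofReal p)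
    (f := fun w : ℂ × ℂ => (‖w.2‖ ^ n)⁻¹ * ‖w.2‖) ⟨by fun_prop, ?_⟩ hg.norm
  rw [eLpNorm_lt_top_iff_lintegral_rpow_enorm_lt_top (by simpa using hq0) ENNReal.ofReal_ne_top,
    ENNReal.toReal_ofReal hq0.le]
  refine lt_of_le_of_lt (le_of_eq ?_)
    (lintegral_norm_snd_rpow_lt_top hn (s := (1 - n) * (p / (p - 1))) ?_)
  · refine setLIntegral_congr_fun (isOpen_thinHartogs hn).measurableSet fun w hw => ?_
    have hw2 := norm_snd_pos hw
    rw [Real.enorm_of_nonneg (by positivity), ENNReal.ofReal_rpow_of_nonneg (by positivity) hq0.le,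
      Real.rpow_mul hw2.le]
    congr 2
    rw [sub_eq_add_neg, Real.rpow_add hw2, Real.rpow_one, Real.rpow_neg hw2.le, Real.rpow_natCast,
      mul_comm]
  -- With q the conjugate exponent, integrability of the weight asks for (n-1)q < 2n+2, which is the
  -- lower bound on p.
  · rw [div_lt_iff₀ (by positivity)] at hp1
    rw [← mul_div_assoc, lt_div_iff₀ hp2]
    nlinarith

end Estimates

/-! ### Density -/

section Density

/-- A bounded function that tends to the identity as `s` tends to `0`. -/
noncomputable def softClip (s : ℝ) (ζ : ℂ) : ℂ := (1 + s * ‖ζ‖ ^ 2)⁻¹ • ζ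

theorem contDiff_softClip {s : ℝ} (hs : 0 ≤ s) : ContDiff ℝ 1 (softClip s) := by
  have h1 : ContDiff ℝ 1 fun ζ : ℂ => 1 + s * ‖ζ‖ ^ 2 :=
    contDiff_const.add (contDiff_const.mul (contDiff_id.norm_sq ℝ))
  have h2 : ContDiff ℝ 1 fun ζ : ℂ => (1 + s * ‖ζ‖ ^ 2)⁻¹ := h1.inv fun ζ => by positivity
  exact h2.smul contDiff_id

theorem fderiv_softClip {s : ℝ} (hs : 0 ≤ s) (ζ v : ℂ) : fderiv ℝ (softClip s) ζ v =
    (1 + s * ‖ζ‖ ^ 2)⁻¹ • v - (((1 + s * ‖ζ‖ ^ 2) ^ 2)⁻¹ * (s * (2 * inner ℝ ζ v))) • ζ := by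
  have hpos : 1 + s * ‖ζ‖ ^ 2 ≠ 0 := by positivity
  have h1 := (((hasStrictFDerivAt_norm_sq ζ).hasFDerivAt.const_mul s).const_add 1)
  have h2 := (hasDerivAt_inv hpos).comp_hasFDerivAt ζ h1
  have h3 := (h2.smul (hasFDerivAt_id ζ)).fderiv
  have h4 : fderiv ℝ (softClip s) ζ = _ := h3
  rw [h4]
  simp
  ring

theorem norm_softClip_le {s : ℝ} (hs : 0 ≤ s) (ζ : ℂ) : ‖softClip s ζ‖ ≤ ‖ζ‖ := by
  rw [softClip, norm_smul, Real.norm_of_nonneg (by positivity)]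
  refine mul_le_of_le_one_left (norm_nonneg _) (inv_le_one_of_one_le₀ ?_)
  have : 0 ≤ s * ‖ζ‖ ^ 2 := by positivity
  linarith

/-- From (|ζ|-1)² ≥ 0 one gets 2s|ζ| ≤ s + s|ζ|² ≤ 1 + s|ζ|². -/
theorem norm_softClip_le_inv {s : ℝ} (hs : 0 < s) (hs1 : s ≤ 1) (ζ : ℂ) : ‖softClip s ζ‖ ≤ s⁻¹ := by
  rw [softClip, norm_smul, Real.norm_of_nonneg (by positivity),
    inv_mul_le_iff₀ (by positivity), ← div_eq_mul_inv, le_div_iff₀ hs]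
  nlinarith [mul_nonneg hs.le (sq_nonneg (‖ζ‖ - 1)), norm_nonneg ζ]

/-- The constant does not depend on s, which gives one dominating function for the whole sequence of
clipped functions. -/
theorem norm_fderiv_softClip_apply_le {s : ℝ} (hs : 0 ≤ s) (ζ v : ℂ) :
    ‖fderiv ℝ (softClip s) ζ v‖ ≤ 3 * ‖v‖ := by
  have h0 : 0 ≤ s * ‖ζ‖ ^ 2 := by positivity
  rw [fderiv_softClip hs]
  refine (norm_sub_le _ _).trans ?_
  rw [norm_smul, norm_smul, Real.norm_of_nonneg (by positivity), norm_mul,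
    Real.norm_of_nonneg (by positivity), norm_mul, norm_mul, Real.norm_of_nonneg hs,
    Real.norm_of_nonneg (by norm_num : (0 : ℝ) ≤ 2)]
  have h1 : (1 + s * ‖ζ‖ ^ 2)⁻¹ ≤ 1 := inv_le_one_of_one_le₀ (by linarith)
  have h2 : ‖inner ℝ ζ v‖ ≤ ‖ζ‖ * ‖v‖ := norm_inner_le_norm ζ v
  have h3 : ((1 + s * ‖ζ‖ ^ 2) ^ 2)⁻¹ * (s * ‖ζ‖ ^ 2) ≤ 1 := by
    rw [inv_mul_le_iff₀ (by positivity)]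
    nlinarith
  calc _ ≤ 1 * ‖v‖ + ((1 + s * ‖ζ‖ ^ 2) ^ 2)⁻¹ * (s * (2 * (‖ζ‖ * ‖v‖))) * ‖ζ‖ := by gcongr
    _ = ‖v‖ + 2 * (((1 + s * ‖ζ‖ ^ 2) ^ 2)⁻¹ * (s * ‖ζ‖ ^ 2)) * ‖v‖ := by ring
    _ ≤ ‖v‖ + 2 * 1 * ‖v‖ := by gcongr
    _ = _ := by ring

theorem norm_fderiv_softClip_le {s : ℝ} (hs : 0 ≤ s) (ζ : ℂ) : ‖fderiv ℝ (softClip s) ζ‖ ≤ 3 :=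
  ContinuousLinearMap.opNorm_le_bound _ (by norm_num) (norm_fderiv_softClip_apply_le hs ζ)

theorem continuousAt_inv_one_add_mul (a : ℝ) : ContinuousAt (fun s : ℝ => (1 + s * a)⁻¹) 0 :=
  ContinuousAt.inv₀ (by fun_prop) (by simp)

theorem tendsto_softClip (ζ : ℂ) : Filter.Tendsto (fun k : ℕ => softClip (1 / (k + 1)) ζ)
    Filter.atTop (nhds ζ) := by
  have h1 : Filter.Tendsto (fun s : ℝ => softClip s ζ) (nhds 0) (nhds (softClip 0 ζ)) :=
    ContinuousAt.smul (continuousAt_inv_one_add_mul _) continuousAt_const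
  have h2 := h1.comp tendsto_one_div_add_atTop_nhds_zero_nat
  rwa [show softClip 0 ζ = ζ by simp [softClip]] at h2

theorem tendsto_fderiv_softClip (ζ v : ℂ) :
    Filter.Tendsto (fun k : ℕ => fderiv ℝ (softClip (1 / (k + 1))) ζ v) Filter.atTop (nhds v) := by
  have h1 : ContinuousAt (fun s : ℝ => (1 + s * ‖ζ‖ ^ 2)⁻¹ • v -
      (((1 + s * ‖ζ‖ ^ 2) ^ 2)⁻¹ * (s * (2 * inner ℝ ζ v))) • ζ) 0 := by
    have h2 := continuousAt_inv_one_add_mul (‖ζ‖ ^ 2)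
    simp only [← inv_pow]
    fun_prop
  have h2 := h1.tendsto.comp tendsto_one_div_add_atTop_nhds_zero_nat
  simp only [zero_mul, add_zero, inv_one, one_smul, one_pow, mul_zero, zero_smul, sub_zero] at h2
  refine h2.congr fun k => ?_
  rw [fderiv_softClip (by positivity)]
  rfl

variable {n : ℕ} {p : ℝ}

theorem memSobolevOne_softClip (hn : 1 ≤ n) {f : ℂ × ℂ → ℂ}
    (hf : MemSobolevOne (thinHartogs n) p f) {s : ℝ} (hs : 0 ≤ s) :
    MemSobolevOne (thinHartogs n) p (fun x => softClip s (f x)) := by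
  have hΩ := isOpen_thinHartogs hn
  have hc := contDiff_softClip hs
  refine ⟨hf.1.mono (hc.continuous.comp_aestronglyMeasurable hf.1.1)
    (Filter.Eventually.of_forall fun x => norm_softClip_le hs _), fun i => ?_⟩
  refine ⟨_, (hf.hasWeakDeriv i).comp hΩ hc (norm_fderiv_softClip_le hs), ?_⟩
  have hg := hf.memLp_weakDeriv hΩ i
  have hcont : Continuous fun q : ℂ × ℂ => fderiv ℝ (softClip s) q.1 q.2 :=
    ((hc.continuous_fderiv (by simp)).comp continuous_fst).clm_apply continuous_snd
  refine (hg.norm.const_mul 3).mono (hcont.comp_aestronglyMeasurable (hf.1.1.prodMk hg.1))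
    (Filter.Eventually.of_forall fun x => ?_)
  refine (norm_fderiv_softClip_apply_le hs _ _).trans ?_
  exact Real.le_norm_self _

theorem tendsto_lintegral_rpow_enorm_sub (hp : 0 < p) {μ : Measure (ℂ × ℂ)} {f : ℂ × ℂ → ℂ}
    (hf : MemLp f (ENNReal.ofReal p) μ) {u : ℕ → ℂ × ℂ → ℂ}
    (hu : ∀ k, AEStronglyMeasurable (u k) μ) (hb : ∀ k x, ‖u k x‖ ≤ 3 * ‖f x‖)
    (hl : ∀ x, Filter.Tendsto (fun k => u k x) Filter.atTop (nhds (f x))) :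
    Filter.Tendsto (fun k => ∫⁻ x, ‖f x - u k x‖ₑ ^ p ∂μ) Filter.atTop (nhds 0) := by
  have key := tendsto_lintegral_of_dominated_convergence' (μ := μ)
    (F := fun k x => ‖f x - u k x‖ₑ ^ p) (f := fun _ => 0) (fun x => (4 * ‖f x‖ₑ) ^ p)
    (fun k => (hf.1.sub (hu k)).enorm.pow_const p) (fun k => ?_) ?_ ?_
  · simpa using key
  · refine Filter.Eventually.of_forall fun x => ?_
    simp only
    gcongr
    have h1 : ‖f x - u k x‖ ≤ 4 * ‖f x‖ := by
      refine (norm_sub_le _ _).trans ?_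
      linarith [hb k x]
    rw [← ofReal_norm, ← ofReal_norm,
      show (4 : ℝ≥0∞) = ENNReal.ofReal 4 by simp, ← ENNReal.ofReal_mul (by norm_num)]
    exact ENNReal.ofReal_le_ofReal h1
  · simp only [ENNReal.mul_rpow_of_nonneg _ _ hp.le]
    rw [lintegral_const_mul' _ _ (by finiteness)]
    exact ENNReal.mul_ne_top (by finiteness) (lintegral_rpow_enorm_lt_top hp hf).ne
  · refine Filter.Eventually.of_forall fun x => ?_
    have h1 : Filter.Tendsto (fun k => ‖f x - u k x‖ₑ) Filter.atTop (nhds 0) := by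
      have := ((tendsto_const_nhds (x := f x)).sub (hl x)).enorm
      simpa using this
    have h2 := h1.ennrpow_const p
    simpa [ENNReal.zero_rpow_of_pos hp] using h2

theorem tendsto_sobolevNorm_sub_softClip (hn : 1 ≤ n) (hp : 0 < p) {f : ℂ × ℂ → ℂ}
    (hf : MemSobolevOne (thinHartogs n) p f) :
    Filter.Tendsto (fun k : ℕ => sobolevNorm (thinHartogs n) p
      (f - fun x => softClip (1 / (k + 1)) (f x))) Filter.atTop (nhds 0) := by
  have hΩ := isOpen_thinHartogs hn
  have hs : ∀ k : ℕ, (0 : ℝ) ≤ 1 / (k + 1) := fun k => by positivity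
  have h0 := tendsto_lintegral_rpow_enorm_sub hp hf.1
    (u := fun k x => softClip (1 / (k + 1)) (f x))
    (fun k => (contDiff_softClip (hs k)).continuous.comp_aestronglyMeasurable hf.1.1)
    (fun k x => (norm_softClip_le (hs k) _).trans (by linarith [norm_nonneg (f x)]))
    (fun x => tendsto_softClip _)
  have hcont : ∀ k : ℕ, Continuous fun q : ℂ × ℂ => fderiv ℝ (softClip (1 / (k + 1))) q.1 q.2 :=
    fun k => (((contDiff_softClip (hs k)).continuous_fderiv (by simp)).comp
      continuous_fst).clm_apply continuous_snd
  have hj := fun j => tendsto_lintegral_rpow_enorm_sub hp (hf.memLp_weakDeriv hΩ j)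
    (u := fun k x => fderiv ℝ (softClip (1 / (k + 1))) (f x)
      (weakDeriv (thinHartogs n) (realDir j) f x))
    (fun k => (hcont k).comp_aestronglyMeasurable (hf.1.1.prodMk (hf.memLp_weakDeriv hΩ j).1))
    (fun k x => norm_fderiv_softClip_apply_le (hs k) _ _)
    (fun x => tendsto_fderiv_softClip _ _)
  have h1 := h0.add (tendsto_finsetSum Finset.univ fun j _ => hj j)
  simp only [Finset.sum_const_zero, add_zero] at h1
  have h2 := h1.ennrpow_const (1 / p)
  rw [ENNReal.zero_rpow_of_pos (by positivity)] at h2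
  refine h2.congr fun k => ?_
  unfold sobolevNorm
  congr 2
  -- `weakDeriv` is a chosen representative, equal to the derivative computed by the chain rule only
  -- almost everywhere.
  refine Finset.sum_congr rfl fun j _ => lintegral_congr_ae ?_
  have hw := (hf.hasWeakDeriv j).add (((hf.hasWeakDeriv j).comp hΩ (contDiff_softClip (hs k))
    (norm_fderiv_softClip_le (hs k))).const_smul (-1))
  have e : (f + (-1 : ℂ) • fun x => softClip (1 / (k + 1)) (f x)) =
      f - fun x => softClip (1 / (k + 1)) (f x) := by
    ext x; simp [sub_eq_add_neg]
  rw [e] at hw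
  filter_upwards [hw.ae_unique hΩ (hasWeakDeriv_weakDeriv hw)] with x hx
  rw [← hx]
  simp [sub_eq_add_neg]

theorem integrable_inv_norm_snd_pow (hn : 1 ≤ n) :
    Integrable (fun w : ℂ × ℂ => (‖w.2‖ ^ n)⁻¹) (lebesgueOn (thinHartogs n)) := by
  refine ⟨by fun_prop, lt_of_le_of_lt (le_of_eq ?_)
    (lintegral_norm_snd_rpow_lt_top hn (s := -n) (by linarith))⟩
  refine setLIntegral_congr_fun (isOpen_thinHartogs hn).measurableSet fun w hw => ?_
  simp only
  rw [Real.enorm_of_nonneg (by positivity), Real.rpow_neg (norm_nonneg _), Real.rpow_natCast]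

/-- The clipped function is bounded and |w₂|⁻ⁿ is integrable on the domain. -/
theorem bergmanConverges_softClip (hn : 1 ≤ n) {f : ℂ × ℂ → ℂ}
    (hfm : AEStronglyMeasurable f (lebesgueOn (thinHartogs n))) {s : ℝ} (hs : 0 < s)
    (hs1 : s ≤ 1) : BergmanConverges (thinHartogs n) (fun x => softClip s (f x)) := by
  have hm : AEStronglyMeasurable (fun x => softClip s (f x)) (lebesgueOn (thinHartogs n)) :=
    (contDiff_softClip hs.le).continuous.comp_aestronglyMeasurable hfm
  refine (bergmanConverges_iff hn hm).2 ?_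
  refine ((integrable_inv_norm_snd_pow hn).mul_const s⁻¹).mono' (by fun_prop)
    (Filter.Eventually.of_forall fun w => ?_)
  rw [Real.norm_of_nonneg (by positivity)]
  gcongr
  exact norm_softClip_le_inv hs hs1 _

end Density

/-! ### Derivatives of the Bergman projection as bounded operators -/

section Operator

variable {n : ℕ} {p : ℝ}

/-- The function that agrees with the first derivative of the Bergman projection of `f` whenever
the latter converges. -/
noncomputable def derivFstProj (n : ℕ) (f : ℂ × ℂ → ℂ) (z : ℂ × ℂ) : ℂ :=
  -Complex.I * ∫ w in thinHartogs n, rotPrimitive n z w *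
    ∑ j, rotOne j w • weakDeriv (thinHartogs n) (realDir j) f w

theorem integrable_weakDeriv (hn : 1 ≤ n) (hp : 1 < p) {f : ℂ × ℂ → ℂ}
    (hf : MemSobolevOne (thinHartogs n) p f) (j : Fin 4) :
    Integrable (weakDeriv (thinHartogs n) (realDir j) f) (lebesgueOn (thinHartogs n)) := by
  have := isFiniteMeasure_lebesgueOn hn
  exact (hf.memLp_weakDeriv (isOpen_thinHartogs hn) j).integrable (by simpa using hp.le)

theorem aestronglyMeasurable_derivFstProj (hn : 1 ≤ n) (hp : 1 < p) {f : ℂ × ℂ → ℂ}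
    (hf : MemSobolevOne (thinHartogs n) p f) :
    AEStronglyMeasurable (derivFstProj n f) (lebesgueOn (thinHartogs n)) :=
  (aestronglyMeasurable_integral_mul (measurable_rotPrimitive n)
    (aestronglyMeasurable_sum_coeff rotOne fun j =>
      (integrable_weakDeriv hn hp hf j).1)).const_mul _

theorem exists_eLpNorm_derivFstProj_le (hn : 1 ≤ n) (hp : 1 < p)
    (hp1 : p < (2 * n + 2) / (2 * n)) :
    ∃ C : ℝ≥0, ∀ f, MemSobolevOne (thinHartogs n) p f →
      eLpNorm (derivFstProj n f) (ENNReal.ofReal p) (lebesgueOn (thinHartogs n)) ≤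
        C * sobolevNorm (thinHartogs n) p f := by
  have hn0 : (1 : ℝ) ≤ n := by exact_mod_cast hn
  rw [lt_div_iff₀ (by positivity)] at hp1
  -- With m = 2n no power of w₂ remains. The value of s is the least one allowed by m(p-1) ≤ s, and
  -- s < 2n - m + 2 = 2 is then the hypothesis on p.
  obtain ⟨C, hC⟩ := exists_eLpNorm_le_of_enorm_le hn (m := 2 * n) (s := 2 * n * (p - 1)) hp
    (by nlinarith) (by nlinarith) le_rfl (by nlinarith)
  refine ⟨C, fun f hf => hC f _ hf fun z hz => ?_⟩
  rw [derivFstProj, enorm_mul, enorm_neg, enorm_eq_nnnorm, Complex.nnnorm_I, ENNReal.coe_one,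
    one_mul]
  refine enorm_integral_mul_sum_le (isOpen_thinHartogs hn).measurableSet
    (fun w => norm_sum_rotOne_le w _) fun w hw => ?_
  refine (norm_rotPrimitive_mul_le hn hz hw).trans_eq ?_
  rw [sub_self, Real.rpow_zero, mul_one, Real.rpow_neg (norm_nonneg _)]
  norm_cast

theorem memLp_derivFstProj (hn : 1 ≤ n) (hp : 1 < p) (hp1 : p < (2 * n + 2) / (2 * n))
    {f : ℂ × ℂ → ℂ} (hf : MemSobolevOne (thinHartogs n) p f) :
    MemLp (derivFstProj n f) (ENNReal.ofReal p) (lebesgueOn (thinHartogs n)) := by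
  obtain ⟨C, hC⟩ := exists_eLpNorm_derivFstProj_le hn hp hp1
  exact ⟨aestronglyMeasurable_derivFstProj hn hp hf, (hC f hf).trans_lt
    (ENNReal.mul_lt_top ENNReal.coe_lt_top
      (hf.sobolevNorm_lt_top (by linarith) (isOpen_thinHartogs hn)))⟩

/-- Independence of the chosen representatives; linearity follows although the choices for f, f' and
f + f' are unrelated. -/
theorem derivFstProj_congr {f : ℂ × ℂ → ℂ} {g : Fin 4 → ℂ × ℂ → ℂ} (hn : 1 ≤ n)
    (h : ∀ j, HasWeakDeriv (thinHartogs n) (realDir j) f (g j)) (z : ℂ × ℂ) :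
    derivFstProj n f z = -Complex.I * ∫ w in thinHartogs n, rotPrimitive n z w *
      ∑ j, rotOne j w • g j w := by
  unfold derivFstProj
  congr 1
  refine integral_congr_ae ?_
  filter_upwards [ae_all_iff.2 fun j => (hasWeakDeriv_weakDeriv (h j)).ae_unique
    (isOpen_thinHartogs hn) (h j)] with w hw
  simp only [hw]

theorem derivFstProj_add (hn : 1 ≤ n) (hp : 1 < p) {f f' : ℂ × ℂ → ℂ}
    (hf : MemSobolevOne (thinHartogs n) p f) (hf' : MemSobolevOne (thinHartogs n) p f')
    {z : ℂ × ℂ} (hz : z ∈ thinHartogs n) :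
    derivFstProj n (f + f') z = derivFstProj n f z + derivFstProj n f' z := by
  rw [derivFstProj_congr hn fun j => (hf.hasWeakDeriv j).add (hf'.hasWeakDeriv j)]
  unfold derivFstProj
  rw [← mul_add, ← integral_add
    (integrable_rotPrimitive_mul hn hz (integrable_weakDeriv hn hp hf))
    (integrable_rotPrimitive_mul hn hz (integrable_weakDeriv hn hp hf'))]
  simp only [Pi.add_apply, smul_add, Finset.sum_add_distrib, mul_add]

theorem derivFstProj_smul (hn : 1 ≤ n) (c : ℂ) {f : ℂ × ℂ → ℂ}
    (hf : MemSobolevOne (thinHartogs n) p f) (z : ℂ × ℂ) :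
    derivFstProj n (c • f) z = c * derivFstProj n f z := by
  rw [derivFstProj_congr hn fun j => (hf.hasWeakDeriv j).const_smul c]
  unfold derivFstProj
  rw [mul_left_comm, ← integral_const_mul c]
  congr 1
  refine integral_congr_ae (Filter.Eventually.of_forall fun w => ?_)
  simp only [Pi.smul_apply, smul_eq_mul, Complex.real_smul, Finset.mul_sum]
  exact Finset.sum_congr rfl fun j _ => by ring

/-- The bounded extension of `f ↦ ∂(𝐁 f)/∂z₁`. -/
noncomputable def derivFstProjLp (hn : 1 ≤ n) (hp : 1 < p) (hp1 : p < (2 * n + 2) / (2 * n)) :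
    sobolevOne (thinHartogs n) p →ₗ[ℂ] Lp ℂ (ENNReal.ofReal p) (lebesgueOn (thinHartogs n)) where
  toFun f := (memLp_derivFstProj hn hp hp1 f.2).toLp _
  map_add' f f' := by
    rw [← MemLp.toLp_add, MemLp.toLp_eq_toLp_iff]
    exact ae_restrict_of_forall_mem (isOpen_thinHartogs hn).measurableSet fun z hz =>
      derivFstProj_add hn hp f.2 f'.2 hz
  map_smul' c f := by
    rw [RingHom.id_apply, ← MemLp.toLp_const_smul, MemLp.toLp_eq_toLp_iff]
    exact Filter.Eventually.of_forall fun z => derivFstProj_smul hn c f.2 z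

theorem bergmanConverges_of_memSobolevOne (hn : 1 ≤ n) (hp : 1 < p)
    (hp1 : (2 * n + 2) / (n + 3) < p) {f : ℂ × ℂ → ℂ}
    (hf : MemSobolevOne (thinHartogs n) p f) : BergmanConverges (thinHartogs n) f := by
  have := isFiniteMeasure_lebesgueOn hn
  refine (bergmanConverges_iff hn hf.1.1).2 (integrable_inv_norm_snd_pow_mul hn hf.hasWeakDeriv
    (hf.1.integrable (by simpa using hp.le)) fun j => ?_)
  exact integrable_inv_norm_snd_pow_mul_of_memLp hn hp hp1
    (hf.memLp_weakDeriv (isOpen_thinHartogs hn) j)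

theorem exists_eLpNorm_fderiv_bergmanProj_snd_le (hn : 1 ≤ n) (hp : 1 < p)
    (hp1 : (2 * n + 2) / (n + 3) < p) (hp2 : p < 2) :
    ∃ C : ℝ≥0, ∀ f, MemSobolevOne (thinHartogs n) p f →
      MemLp (fun z => fderiv ℂ (bergmanProj (thinHartogs n) f) z (0, 1))
        (ENNReal.ofReal p) (lebesgueOn (thinHartogs n)) ∧
      eLpNorm (fun z => fderiv ℂ (bergmanProj (thinHartogs n) f) z (0, 1))
        (ENNReal.ofReal p) (lebesgueOn (thinHartogs n)) ≤
        C * sobolevNorm (thinHartogs n) p f := by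
  have hΩ := isOpen_thinHartogs hn
  have hn0 : (1 : ℝ) ≤ n := by exact_mod_cast hn
  have hp1' := hp1
  rw [div_lt_iff₀ (by positivity)] at hp1'
  -- The kernel has |z₂|⁻ⁿ|w₂|⁻ⁿ; the factor 1/z₂ and the |w₂| of the angular derivative shift this
  -- to m = n+1. With s the larger of the two lower bounds, s < n+1 amounts to p < 2 and s <
  -- (n+3)(p-1) to (2n+2)/(n+3) < p.
  obtain ⟨C, hC⟩ := exists_eLpNorm_le_of_enorm_le hn (m := n + 1)
    (s := max (n - 1) ((n + 1) * (p - 1))) hp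
    (le_trans (by linarith) (le_max_left _ _)) (max_lt (by linarith) (by nlinarith))
    (le_max_right _ _) (max_lt (by nlinarith) (by nlinarith))
  refine ⟨C, fun f hf => ?_⟩
  have hconv := bergmanConverges_of_memSobolevOne hn hp hp1 hf
  have hrep : ∀ z ∈ thinHartogs n, fderiv ℂ (bergmanProj (thinHartogs n) f) z (0, 1) =
      -Complex.I / z.2 * ∫ w in thinHartogs n, hartogsKernel n z w *
        ∑ j, rotTwo j w • weakDeriv (thinHartogs n) (realDir j) f w := fun z hz =>
    fderiv_bergmanProj_snd hn hz hf.1.1 hconv hf.hasWeakDeriv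
      (fun j => (hf.memLp_weakDeriv hΩ j).1) fun j =>
        integrable_inv_norm_snd_pow_mul_of_memLp hn hp hp1 (hf.memLp_weakDeriv hΩ j)
  have hbound := hC f (fun z => fderiv ℂ (bergmanProj (thinHartogs n) f) z (0, 1)) hf ?_
  · refine ⟨⟨?_, hbound.trans_lt (ENNReal.mul_lt_top ENNReal.coe_lt_top
      (hf.sobolevNorm_lt_top (by linarith) hΩ))⟩, hbound⟩
    refine AEStronglyMeasurable.congr (AEStronglyMeasurable.mul
      (f := fun z : ℂ × ℂ => -Complex.I / z.2) ?_ ?_)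
      (ae_restrict_of_forall_mem hΩ.measurableSet fun z hz => (hrep z hz).symm)
    · exact Measurable.aestronglyMeasurable (by fun_prop)
    · exact aestronglyMeasurable_integral_mul (measurable_hartogsKernel n)
        (aestronglyMeasurable_sum_coeff rotTwo fun j => (hf.memLp_weakDeriv hΩ j).1)
  · intro z hz
    have hz2 := norm_snd_pos hz
    rw [hrep z hz, ← integral_const_mul]
    simp only [← mul_assoc]
    refine enorm_integral_mul_sum_le hΩ.measurableSet (fun w => norm_sum_rotTwo_le w _)
      fun w hw => ?_
    have hw2 := norm_snd_pos hw
    have hQ := bidiscWeight_nonneg n z w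
    have hpi : (Real.pi ^ 2)⁻¹ ≤ 1 := inv_le_one_of_one_le₀ (by nlinarith [Real.pi_gt_three])
    have e1 : ‖z.2‖ ^ (-((n : ℝ) + 1)) = (‖z.2‖ ^ n)⁻¹ * ‖z.2‖⁻¹ := by
      rw [Real.rpow_neg hz2.le, Real.rpow_add hz2, Real.rpow_natCast, Real.rpow_one, mul_inv]
    have e2 : ‖w.2‖ ^ ((n : ℝ) + 1 - 2 * n) = (‖w.2‖ ^ n)⁻¹ * ‖w.2‖ := by
      rw [show (n : ℝ) + 1 - 2 * n = -n + 1 by ring, Real.rpow_add hw2, Real.rpow_neg hw2.le,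
        Real.rpow_natCast, Real.rpow_one]
    rw [e1, e2, norm_mul, norm_div, norm_neg, Complex.norm_I, norm_hartogsKernel hz hw]
    calc _ = (Real.pi ^ 2)⁻¹ * ((‖z.2‖ ^ n)⁻¹ * ‖z.2‖⁻¹ * ((‖w.2‖ ^ n)⁻¹ * ‖w.2‖) *
          bidiscWeight n z w) := by ring
      _ ≤ _ := mul_le_of_le_one_left (by positivity) hpi

end Operator

/-! ### The main theorem -/

theorem theoremT (n : ℕ) (hn : 1 ≤ n) :
    (∀ p : ℝ, 1 < p → p < (2 * n + 2) / (2 * n) →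
      (∀ f ∈ sobolevOne (thinHartogs n) p, ∀ ε : ℝ≥0∞, 0 < ε →
        ∃ g ∈ sobolevOne (thinHartogs n) p,
          BergmanConverges (thinHartogs n) g ∧ sobolevNorm (thinHartogs n) p (f - g) < ε) ∧
      ∃ T : sobolevOne (thinHartogs n) p →ₗ[ℂ]
          Lp ℂ (ENNReal.ofReal p) (lebesgueOn (thinHartogs n)),
        (∃ C : ℝ≥0, ∀ f : sobolevOne (thinHartogs n) p,
          eLpNorm (T f) (ENNReal.ofReal p) (lebesgueOn (thinHartogs n)) ≤
            C * sobolevNorm (thinHartogs n) p f) ∧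
        ∀ f : sobolevOne (thinHartogs n) p, BergmanConverges (thinHartogs n) f →
          DifferentiableOn ℂ (bergmanProj (thinHartogs n) f) (thinHartogs n) ∧
          T f =ᵐ[lebesgueOn (thinHartogs n)]
            fun z => fderiv ℂ (bergmanProj (thinHartogs n) f) z (1, 0)) ∧
    (∀ p : ℝ, (2 * n + 2) / (n + 3) < p → p < 2 →
      ∃ C : ℝ≥0, ∀ f ∈ sobolevOne (thinHartogs n) p,
        BergmanConverges (thinHartogs n) f ∧
        DifferentiableOn ℂ (bergmanProj (thinHartogs n) f) (thinHartogs n) ∧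
        MemLp (fun z => fderiv ℂ (bergmanProj (thinHartogs n) f) z (0, 1))
          (ENNReal.ofReal p) (lebesgueOn (thinHartogs n)) ∧
        eLpNorm (fun z => fderiv ℂ (bergmanProj (thinHartogs n) f) z (0, 1))
            (ENNReal.ofReal p) (lebesgueOn (thinHartogs n)) ≤
          C * sobolevNorm (thinHartogs n) p f) := by
  have hΩ := isOpen_thinHartogs hn
  refine ⟨fun p hp hp1 => ⟨fun f hf ε hε => ?_, ?_⟩, fun p hp1 hp2 => ?_⟩
  · obtain ⟨k, hk⟩ := ((tendsto_sobolevNorm_sub_softClip hn (by linarith) hf).eventually_lt_const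
      hε).exists
    have hs : (0 : ℝ) < 1 / (k + 1) := by positivity
    exact ⟨_, memSobolevOne_softClip hn hf hs.le, bergmanConverges_softClip hn hf.1.1 hs
      ((div_le_one (by positivity)).2 (by linarith [Nat.cast_nonneg (α := ℝ) k])), hk⟩
  · refine ⟨derivFstProjLp hn hp hp1, ?_, fun f hf => ⟨differentiableOn_bergmanProj hn f.2.1.1 hf, ?_⟩⟩
    · obtain ⟨C, hC⟩ := exists_eLpNorm_derivFstProj_le hn hp hp1
      refine ⟨C, fun f => ?_⟩
      exact (eLpNorm_congr_ae (memLp_derivFstProj hn hp hp1 f.2).coeFn_toLp).trans_le (hC f f.2)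
    · refine (memLp_derivFstProj hn hp hp1 f.2).coeFn_toLp.trans ?_
      refine ae_restrict_of_forall_mem hΩ.measurableSet fun z hz => ?_
      exact (fderiv_bergmanProj_fst hn hz f.2.1.1 hf f.2.hasWeakDeriv
        (integrable_weakDeriv hn hp f.2)).symm
  · have hn0 : (1 : ℝ) ≤ n := by exact_mod_cast hn
    -- The lower bound (2n+2)/(n+3) is at least 1 because n ≥ 1.
    have hp : 1 < p := lt_of_le_of_lt ((one_le_div (by positivity)).2 (by linarith)) hp1
    obtain ⟨C, hC⟩ := exists_eLpNorm_fderiv_bergmanProj_snd_le hn hp hp1 hp2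
    refine ⟨C, fun f hf => ?_⟩
    have hconv := bergmanConverges_of_memSobolevOne hn hp hp1 hf
    exact ⟨hconv, differentiableOn_bergmanProj hn hf.1.1 hconv, (hC f hf).1, (hC f hf).2⟩
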